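/- Let $n\ge 1$ and let $M$ be a non-empty compact (Hausdorff) $\mathcal C^\infty$-smooth manifold without boundary of real dimension $2n+1$, not assumed oriented, with a Levi-flat CR structure: a smooth complex subbundle $T^{0,1}\subset\mathbb C\otimes TM$ of complex rank $n$ such that, with $T^{1,0}:=\overline{T^{0,1}}$, one has $T^{1,0}\cap T^{0,1}=0$, the smooth sections of $T^{0,1}$ are closed under the Lie bracket, and so are the smooth sections of $T^{1,0}\oplus T^{0,1}$. Let $\pi:\mathbb C\otimes TM\to N^{1,0}:=(\mathbb C\otimes TM)/(T^{1,0}\oplus T^{0,1})$ be the projection onto the holomorphic normal bundle. For a $\mathcal C^\infty$-smooth hermitian metric $h^2$ on $N^{1,0}$, the leafwise Chern connection form $\alpha_h$ is the $(1,0)$-form $T^{1,0}\to\mathbb C$ determined by $\pi([v,\widetilde\xi]_p)=-\alpha_h(v_p)\,\xi_p$, where $v$ is any local smooth section of $T^{1,0}$ extending $v_p$, $\xi$ is any local smooth section of $N^{1,0}$ that is real ($\overline\xi=\xi$) and of length $1$ for $h^2$, and $\widetilde\xi$ is any local smooth lift of $\xi$ to $\mathbb C\otimes TM$. Its leafwise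 curvature form is the $(1,1)$-form $\Theta_h:T^{1,0}\otimes T^{0,1}\to\mathbb C$ determined by \[ \Theta_h(v_p\otimes\overline w_p)=-\overline w_p\,\alpha_h(v)-\alpha_h([v,\overline w]_p) \] for any local smooth sections $v,w$ of $T^{1,0}$ extending $v_p,w_p$, where $\alpha_h$ is extended by $0$ on $T^{0,1}$. The Diederich--Fornaess index $\eta(M)$ is the supremum of the $\eta\in(0,1)$ for which there is a $\mathcal C^\infty$-smooth hermitian metric $h^2$ on $N^{1,0}$ with \[ i\Theta_h-\frac{\eta}{1-\eta}\,i\alpha_h\wedge\overline{\alpha_h}>0 \] as quadratic forms on $T^{1,0}$, i.e. $\Theta_h(v\otimes\overline v)-\frac{\eta}{1-\eta}|\alpha_h(v)|^2>0$ for all nonzero $v\in T^{1,0}$; if there is no such $\eta$, then $\eta(M):=0$. Then \[ \eta(M)\le\frac1{n+1}. \] -/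

import Mathlib

open scoped Manifold ContDiff TensorProduct

noncomputable section

namespace CRGeometry

/-! ### Complexification of a real vector space -/

section Complexification

variable {F : Type*} [AddCommGroup F] [Module ℝ F]

/-- Real part `ℂ ⊗ F → F`, `(a + i b) ⊗ u ↦ a u`. -/
def rePart : ℂ ⊗[ℝ] F →ₗ[ℝ] F :=
  (TensorProduct.lid ℝ F).toLinearMap ∘ₗ LinearMap.rTensor F Complex.reLm

/-- Imaginary part `ℂ ⊗ F → F`, `(a + i b) ⊗ u ↦ b u`. -/
def imPart : ℂ ⊗[ℝ] F →ₗ[ℝ] F :=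
  (TensorProduct.lid ℝ F).toLinearMap ∘ₗ LinearMap.rTensor F Complex.imLm

/-- The vector `u + i v` of `ℂ ⊗ F`. -/
def ofReIm (u v : F) : ℂ ⊗[ℝ] F := (1 : ℂ) ⊗ₜ[ℝ] u + Complex.I ⊗ₜ[ℝ] v

/-- Complex conjugation `c ⊗ u ↦ c̄ ⊗ u` on `ℂ ⊗ F`, a conjugate-linear map. -/
def conjC : ℂ ⊗[ℝ] F →ₛₗ[starRingEnd ℂ] ℂ ⊗[ℝ] F where
  toFun := LinearMap.rTensor F Complex.conjAe.toLinearMap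
  map_add' := map_add _
  map_smul' c z := by
    induction z with
    | zero => simp
    | tmul a u => simp [TensorProduct.smul_tmul']
    | add x y hx hy => simp only [smul_add, map_add, hx, hy]

theorem rePart_ofReIm (u v : F) : rePart (ofReIm u v) = u := by
  simp [rePart, ofReIm]

theorem imPart_ofReIm (u v : F) : imPart (ofReIm u v) = v := by
  simp [imPart, ofReIm]

theorem ofReIm_rePart_imPart (z : ℂ ⊗[ℝ] F) : ofReIm (rePart z) (imPart z) = z := by
  induction z with
  | zero => simp [ofReIm]
  | tmul a u =>
    simp only [ofReIm, rePart, imPart, LinearMap.comp_apply, LinearMap.rTensor_tmul,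
      LinearEquiv.coe_coe, TensorProduct.lid_tmul, ← TensorProduct.smul_tmul,
      ← TensorProduct.add_tmul, Complex.reLm_coe, Complex.imLm_coe]
    congr 1
    apply Complex.ext <;> simp
  | add x y hx hy =>
    conv_rhs => rw [← hx, ← hy]
    simp only [ofReIm, map_add, TensorProduct.tmul_add]
    abel

theorem conjC_ofReIm (u v : F) : conjC (ofReIm u v) = ofReIm u (-v) := by
  simp [conjC, ofReIm, TensorProduct.neg_tmul, TensorProduct.tmul_neg]

theorem conjC_conjC (z : ℂ ⊗[ℝ] F) : conjC (conjC z) = z := by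
  rw [← ofReIm_rePart_imPart z, conjC_ofReIm, conjC_ofReIm, neg_neg]

end Complexification

/-! ### Complex vector fields on a manifold of dimension `2n+1` -/

section Manifold

variable {n : ℕ} {M : Type*} [TopologicalSpace M]
  [ChartedSpace (EuclideanSpace ℝ (Fin (2 * n + 1))) M] [IsManifold (𝓡 (2 * n + 1)) ∞ M]

variable (n) in
/-- The complexified tangent space `ℂ ⊗ T_x M`. -/
abbrev CTangent (x : M) : Type :=
  ℂ ⊗[ℝ] TangentSpace (𝓡 (2 * n + 1)) x

/-- The complex vector field `V` is smooth on the set `U`: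
its real and imaginary parts are smooth vector fields on `U`. -/
def SmoothOn (V : ∀ x : M, CTangent n x) (U : Set M) : Prop :=
  ContMDiffOn (𝓡 (2 * n + 1)) (𝓡 (2 * n + 1)).tangent ∞
      (fun x => (⟨x, rePart (V x)⟩ : TangentBundle (𝓡 (2 * n + 1)) M)) U ∧
    ContMDiffOn (𝓡 (2 * n + 1)) (𝓡 (2 * n + 1)).tangent ∞
      (fun x => (⟨x, imPart (V x)⟩ : TangentBundle (𝓡 (2 * n + 1)) M)) U

/-- `V` is a smooth local section over `U` of the family `S` of complex subspaces. -/
def IsSection (S : ∀ x : M, Submodule ℂ (CTangent n x)) (V : ∀ x : M, CTangent n x)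
    (U : Set M) : Prop :=
  SmoothOn V U ∧ ∀ x ∈ U, V x ∈ S x

/-- The `ℂ`-bilinear extension of the Lie bracket to complex vector fields:
`[X + iY, X' + iY'] = [X, X'] - [Y, Y'] + i ([X, Y'] + [Y, X'])`. -/
def bracket (V W : ∀ x : M, CTangent n x) (p : M) : CTangent n p :=
  ofReIm
    (VectorField.mlieBracket (𝓡 (2 * n + 1)) (fun x => rePart (V x)) (fun x => rePart (W x)) p -
      VectorField.mlieBracket (𝓡 (2 * n + 1)) (fun x => imPart (V x)) (fun x => imPart (W x)) p)
    (VectorField.mlieBracket (𝓡 (2 * n + 1)) (fun x => rePart (V x)) (fun x => imPart (W x)) p +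
      VectorField.mlieBracket (𝓡 (2 * n + 1)) (fun x => imPart (V x)) (fun x => rePart (W x)) p)

/-- The derivative `z f` of a complex function `f` at `p` along a complex tangent vector `z`. -/
def cderiv (f : M → ℂ) (p : M) (z : CTangent n p) : ℂ :=
  let a : ℂ := mfderiv (𝓡 (2 * n + 1)) 𝓘(ℝ, ℂ) f p (rePart z)
  let b : ℂ := mfderiv (𝓡 (2 * n + 1)) 𝓘(ℝ, ℂ) f p (imPart z)
  a + Complex.I * b

variable (n M) in
/-- A CR structure (of hypersurface type) on a manifold `M` of dimension `2n+1`: a smooth complex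
subbundle `T01` of rank `n` of `ℂ ⊗ TM`, meeting its conjugate only in the zero section,
whose sections are closed under the Lie bracket. -/
structure CRStructure where
  /-- The bundle of `(0,1)`-vectors. -/
  T01 : ∀ x : M, Submodule ℂ (CTangent n x)
  exists_frame : ∀ p : M, ∃ U : Set M, IsOpen U ∧ p ∈ U ∧
    ∃ e : Fin n → ∀ x : M, CTangent n x, (∀ j, SmoothOn (e j) U) ∧
      ∀ x ∈ U, LinearIndependent ℂ (fun j => e j x) ∧
        Submodule.span ℂ (Set.range fun j => e j x) = T01 x
  disjoint_conj : ∀ x : M, Disjoint ((T01 x).comap conjC) (T01 x)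
  involutive : ∀ (U : Set M) (V W : ∀ x : M, CTangent n x), IsOpen U →
    IsSection T01 V U → IsSection T01 W U → ∀ x ∈ U, bracket V W x ∈ T01 x

namespace CRStructure

variable (C : CRStructure n M)

/-- The holomorphic tangent bundle: `v` is of type `(1,0)` iff `v̄` is of type `(0,1)`. -/
def T10 (x : M) : Submodule ℂ (CTangent n x) := (C.T01 x).comap conjC

/-- The sum of the `(1,0)`- and `(0,1)`-tangent bundles (direct by `disjoint_conj`). -/
def HC (x : M) : Submodule ℂ (CTangent n x) := C.T10 x ⊔ C.T01 x

/-- Levi-flatness: the sections of `T10 ⊕ T01` are closed under the Lie bracket. -/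
def IsLeviFlat : Prop :=
  ∀ (U : Set M) (V W : ∀ x : M, CTangent n x), IsOpen U →
    IsSection C.HC V U → IsSection C.HC W U → ∀ x ∈ U, bracket V W x ∈ C.HC x

/-- The fibre at `x` of the holomorphic normal bundle `(ℂ ⊗ TM) / (T10 ⊕ T01)`. -/
abbrev Normal (x : M) : Type := CTangent n x ⧸ C.HC x

/-- The quotient map onto the holomorphic normal bundle. -/
abbrev toNormal (x : M) : CTangent n x →ₗ[ℂ] C.Normal x := (C.HC x).mkQ

theorem HC_le_comap_conj (x : M) : C.HC x ≤ (C.HC x).comap conjC := by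
  refine sup_le (fun v hv => ?_) (fun v hv => ?_)
  · exact Submodule.mem_sup_right hv
  · refine Submodule.mem_sup_left ?_
    change conjC (conjC v) ∈ C.T01 x
    rwa [conjC_conjC]

/-- Complex conjugation on the holomorphic normal bundle. -/
def normalConj (x : M) : C.Normal x →ₛₗ[starRingEnd ℂ] C.Normal x :=
  (C.HC x).mapQ (C.HC x) conjC (C.HC_le_comap_conj x)

/-- A smooth hermitian metric `h²` on the holomorphic normal bundle. -/
structure HermitianMetric where
  /-- The hermitian form on each fibre. -/
  form : ∀ x : M, C.Normal x →ₗ⋆[ℂ] C.Normal x →ₗ[ℂ] ℂ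
  conj_symm : ∀ (x : M) (ξ ζ : C.Normal x), starRingEnd ℂ (form x ξ ζ) = form x ζ ξ
  pos : ∀ (x : M) (ξ : C.Normal x), ξ ≠ 0 → 0 < (form x ξ ξ).re
  smooth : ∀ (U : Set M) (V W : ∀ x : M, CTangent n x), IsOpen U → SmoothOn V U → SmoothOn W U →
    ContMDiffOn (𝓡 (2 * n + 1)) 𝓘(ℝ, ℂ) ∞
      (fun x => form x (C.toNormal x (V x)) (C.toNormal x (W x))) U

variable {C}

namespace HermitianMetric

variable (h : C.HermitianMetric)

/-- `X` is a smooth lift over `U` of a real section `ξ` of the holomorphic normal bundle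
that is normalized by `h`. -/
def IsUnitRealLift (X : ∀ x : M, CTangent n x) (U : Set M) : Prop :=
  SmoothOn X U ∧ ∀ x ∈ U,
    C.normalConj x (C.toNormal x (X x)) = C.toNormal x (X x) ∧
      h.form x (C.toNormal x (X x)) (C.toNormal x (X x)) = 1

/-- `a` is the value of the leafwise Chern connection form `α_h` at the `(1,0)`-vector `v` at `p`:
`π [V, X]_p = -a ξ_p` for all local extensions `V` of `v` to a section of `T10` and all smooth
local lifts `X` of normalized real sections `ξ` of the normal bundle. -/
def IsAlphaValue (p : M) (v : CTangent n p) (a : ℂ) : Prop :=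
  ∀ (U : Set M) (V X : ∀ x : M, CTangent n x), IsOpen U → p ∈ U →
    IsSection C.T10 V U → V p = v → h.IsUnitRealLift X U →
      C.toNormal p (bracket V X p) = -(a • C.toNormal p (X p))

/-- The leafwise Chern connection form `α_h`, a `(1,0)`-form (only its values on `T10` matter). -/
def alpha (p : M) (v : CTangent n p) : ℂ := Classical.epsilon (h.IsAlphaValue p v)

/-- `θ` is the value `Θ_h(v ⊗ w̄)` of the leafwise curvature form, for `v`, `w` in `T10` at `p`:
`θ = - w̄ (α_h V) - α_h [V, W̄]_p` for all local extensions `V`, `W` of `v`, `w` to sections of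
`T10`. Here `α_h` vanishes on `T01`, so that `α_h [V, W̄]_p` is `α_h a`, where `a` is the
`(1,0)`-component of `[V, W̄]_p`. -/
def IsThetaValue (p : M) (v w : CTangent n p) (θ : ℂ) : Prop :=
  ∀ (U : Set M) (V W : ∀ x : M, CTangent n x), IsOpen U → p ∈ U →
    IsSection C.T10 V U → V p = v → IsSection C.T10 W U → W p = w →
      ∀ a ∈ C.T10 p, ∀ b ∈ C.T01 p, bracket V (fun x => conjC (W x)) p = a + b →
        θ = -cderiv (fun x => h.alpha x (V x)) p (conjC w) - h.alpha p a

/-- The leafwise curvature form: `h.theta p v w = Θ_h(v ⊗ w̄)` for `v`, `w` in `T10` at `p`. -/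
def theta (p : M) (v w : CTangent n p) : ℂ := Classical.epsilon (h.IsThetaValue p v w)

/-- `iΘ_h - c iα_h ∧ ᾱ_h > 0` as a quadratic form on `T10`: as usual, `iβ > 0` for a `(1,1)`-form
`β` means `β(v ⊗ v̄) > 0` for all nonzero `v` in `T10`, and `(α_h ∧ ᾱ_h)(v ⊗ v̄) = |α_h(v)|²`.
The number `Θ_h(v ⊗ v̄)` is real. -/
def CurvaturePos (c : ℝ) : Prop :=
  ∀ (p : M), ∀ v ∈ C.T10 p, v ≠ 0 → 0 < (h.theta p v v).re - c * ‖h.alpha p v‖ ^ 2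

end HermitianMetric

variable (C) in
/-- The Diederich--Fornaess index of a Levi-flat CR manifold; it is `0` if no exponent is
admissible (`sSup ∅ = 0` in `ℝ`). The factor `η / (1 - η)` restricts the exponents to `η < 1`;
as the condition gets stronger with `η`, the endpoint does not influence the supremum. -/
def dfIndex : ℝ :=
  sSup {η : ℝ | 0 < η ∧ η < 1 ∧ ∃ h : C.HermitianMetric, h.CurvaturePos (η / (1 - η))}

end CRStructure

end Manifold

end CRGeometry

end

/-!
Suppose that a metric `h` satisfies `iΘ - c iα ∧ ᾱ > 0` with `c > 1 / n`; for `c = η / (1 - η)` this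
means `η > 1 / (n + 1)`. Then `Θ` is positive definite, so there is a unique vector field `ζ` of
type `(0,1)` with `Θ(· ⊗ ζ) = α`. In a local frame `e` of `T¹⁰`, completed by a real lift `X` of a
normalized section of the normal bundle, put `μ = det Θ(e_j ⊗ ē_k) / |det (e, ē, X)|`. A change of
frame multiplies the numerator and the denominator by the same factor `|det A|²`, so that `μ` is a
globally defined positive density on `M`, and no orientation is needed. The key identity is

  `div_μ ζ = ᾱ(ζ) - n`,   where `ᾱ(ζ)` is the conjugate of `α(ζ̄)`.

It follows from the Jacobi identities of the frame. They say that `Θ` is Hermitian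
(`LeviFlatFrame.c_Θ`), that the partial connection of `T¹⁰` along `T⁰¹` is flat
(`LeviFlatFrame.flat`), and hence that `Θ = ∂̄α` is `∂̄`-closed (`LeviFlatFrame.eb_Θ`), so that the
Lie derivative of `Θ` along `ζ` is `-Θ` up to terms that come from `[ζ, e_j]` and `[ζ, ē_k]`
(`LeviFlatFrame.Θ_map_Z`). By Jacobi's formula `det Θ` contributes `-n` and `|det (e, ē, X)|`
contributes `ᾱ(ζ)`, the `X`-component of `[X, ζ]`, while the other terms cancel
(`LeviFlatFrame.divergence_Z`).

Let `a = α(ζ̄) = Θ(ζ̄ ⊗ ζ)`. Where `ζ ≠ 0`, the curvature condition at `ζ̄` reads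
`Re a > c |a|² ≥ c (Re a)²`, whence `Re a < 1 / c < n` (`alpha_conj_gradient_re_lt`). So the real vector field `2 Re ζ = ζ + ζ̄` has
negative divergence `2 (Re a - n)` everywhere, which contradicts the divergence theorem on the
compact manifold `M` (`IsVectorDensity.exists_euclideanDiv_nonneg`).

The structure equations are purely algebraic: they are proved for derivations of a commutative
ring with a conjugation, and applied to the ring `SmoothFun Ω` of smooth complex functions on an
open set `Ω` of coordinates. The lemmas `AdaptedFrame.alpha_eq` and `AdaptedFrame.theta_eq` compute
the connection and curvature forms of `h` in a frame; they contain the proof that these forms,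
which are defined by a condition on all local extensions, exist.
-/

noncomputable section

/-! ### Derivations and determinants -/

section DerivationAlgebra

variable {A : Type*} [CommRing A] [Algebra ℝ A]

theorem Derivation.apply_prod {κ : Type*} [DecidableEq κ] (D : Derivation ℝ A A) (s : Finset κ)
    (f : κ → A) : D (∏ i ∈ s, f i) = ∑ i ∈ s, D (f i) * ∏ j ∈ s.erase i, f j := by
  induction s using Finset.induction_on with
  | empty => simp
  | insert a s ha ih =>
    rw [Finset.prod_insert ha, D.leibniz, ih, Finset.sum_insert ha, Finset.erase_insert ha,
      smul_eq_mul, smul_eq_mul, add_comm, mul_comm, Finset.mul_sum]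
    congr 1
    refine Finset.sum_congr rfl fun i hi => ?_
    have hia : a ≠ i := fun h => ha (h ▸ hi)
    rw [Finset.erase_insert_of_ne hia, Finset.prod_insert (fun h => ha (Finset.mem_of_mem_erase h))]
    ring

/-- Jacobi's formula for the derivative of a determinant. -/
theorem Derivation.apply_det {κ : Type*} [Fintype κ] [DecidableEq κ] (D : Derivation ℝ A A)
    (N : Matrix κ κ A) : D N.det = (N.adjugate * N.map D).trace := by
  have h1 : (N.adjugate * N.map D).trace
      = ∑ i, (N.updateCol i fun r => D (N r i)).det := by
    refine Finset.sum_congr rfl fun i _ => ?_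
    rw [← Matrix.cramer_apply, Matrix.cramer_eq_adjugate_mulVec]
    rfl
  rw [h1, Matrix.det_apply', map_sum]
  simp_rw [Matrix.det_apply']
  rw [Finset.sum_comm]
  refine Finset.sum_congr rfl fun σ _ => ?_
  rw [D.leibniz, D.map_intCast, smul_zero, add_zero, D.apply_prod, smul_eq_mul, Finset.mul_sum]
  refine Finset.sum_congr rfl fun i _ => ?_
  rw [← Finset.mul_prod_erase _ _ (Finset.mem_univ i), Matrix.updateCol_self]
  congr 2
  refine Finset.prod_congr rfl fun j hj => ?_
  rw [Matrix.updateCol_ne (Finset.ne_of_mem_erase hj)]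

/-- If `D N = P N + N Q` then `D (det N) = det N (tr P + tr Q)`. -/
theorem Derivation.apply_det_of_map_eq {κ : Type*} [Fintype κ] [DecidableEq κ]
    (D : Derivation ℝ A A) (N P Q : Matrix κ κ A) (h : N.map D = P * N + N * Q) :
    D N.det = N.det * (P.trace + Q.trace) := by
  rw [D.apply_det, h, mul_add, Matrix.trace_add, ← mul_assoc, ← mul_assoc, Matrix.adjugate_mul,
    Matrix.trace_mul_comm, ← mul_assoc, Matrix.mul_adjugate]
  simp [mul_add]

theorem Derivation.lie_smul' (D D' : Derivation ℝ A A) (a : A) :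
    ⁅D, a • D'⁆ = a • ⁅D, D'⁆ + D a • D' := by
  ext x
  simp only [Derivation.commutator_apply, Derivation.smul_apply, Derivation.add_apply,
    Derivation.leibniz, smul_eq_mul]
  ring

theorem Derivation.smul_lie' (D D' : Derivation ℝ A A) (a : A) :
    ⁅a • D, D'⁆ = a • ⁅D, D'⁆ - D' a • D := by
  ext x
  simp only [Derivation.commutator_apply, Derivation.smul_apply, Derivation.sub_apply,
    Derivation.leibniz, smul_eq_mul]
  ring

/-- The conjugate `c ∘ D ∘ c` of a derivation `D` by an involution `c`. -/
def Derivation.conj (c : A →ₐ[ℝ] A) (hc : ∀ a, c (c a) = a) (D : Derivation ℝ A A) :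
    Derivation ℝ A A :=
  Derivation.mk' (c.toLinearMap ∘ₗ D.toLinearMap ∘ₗ c.toLinearMap) fun a b => by
    simp [hc]

variable {c : A →ₐ[ℝ] A} {hc : ∀ a, c (c a) = a}

theorem Derivation.conj_apply (D : Derivation ℝ A A) (a : A) : D.conj c hc a = c (D (c a)) := rfl

theorem Derivation.conj_add (D D' : Derivation ℝ A A) :
    (D + D').conj c hc = D.conj c hc + D'.conj c hc := by
  ext a; simp [Derivation.conj_apply]

theorem Derivation.conj_neg (D : Derivation ℝ A A) : (-D).conj c hc = -D.conj c hc := by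
  ext a; simp [Derivation.conj_apply]

theorem Derivation.conj_smul (D : Derivation ℝ A A) (a : A) :
    (a • D).conj c hc = c a • D.conj c hc := by
  ext b; simp [Derivation.conj_apply]

theorem Derivation.conj_sum {κ : Type*} (s : Finset κ) (D : κ → Derivation ℝ A A) :
    (∑ i ∈ s, D i).conj c hc = ∑ i ∈ s, (D i).conj c hc := by
  classical
  induction s using Finset.induction_on with
  | empty => ext a; simp [Derivation.conj_apply]
  | insert a s ha ih => rw [Finset.sum_insert ha, Finset.sum_insert ha, Derivation.conj_add, ih]

theorem Derivation.conj_lie (D D' : Derivation ℝ A A) :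
    ⁅D, D'⁆.conj c hc = ⁅D.conj c hc, D'.conj c hc⁆ := by
  ext a; simp [Derivation.conj_apply, Derivation.commutator_apply, hc]

theorem Derivation.conj_conj (D : Derivation ℝ A A) : (D.conj c hc).conj c hc = D := by
  ext a; simp [Derivation.conj_apply, hc]

theorem Derivation.sum_smul_apply {κ : Type*} [Fintype κ] (a : κ → A) (D : κ → Derivation ℝ A A)
    (x : A) : (∑ k, a k • D k) x = ∑ k, a k * D k x := by
  classical
  have h : ∀ s : Finset κ, (∑ k ∈ s, a k • D k) x = ∑ k ∈ s, a k * D k x := fun s => by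
    induction s using Finset.induction_on with
    | empty => simp
    | insert a s ha ih => rw [Finset.sum_insert ha, Finset.sum_insert ha, ← ih]; rfl
  exact h _

theorem Derivation.apply_eq_zero_of_mul_self_eq_one {t : A} (ht : t * t = 1)
    (D : Derivation ℝ A A) : D t = 0 := by
  have h1 := congrArg D ht
  rw [Derivation.leibniz, Derivation.map_one_eq_zero, smul_eq_mul] at h1
  have h2 : (2 : ℝ) • D t = 0 := by
    rw [two_smul]
    linear_combination t * h1 - 2 * D t * ht
  exact (smul_eq_zero_iff_right (two_ne_zero)).1 h2

end DerivationAlgebra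

/-! ### The structure equations of a Levi-flat frame -/

/-- A frame `(e, ē, X)` of a Levi-flat CR structure, viewed inside the derivations of a
commutative ring `A` of functions with conjugation `c`, together with its structure functions.
The coefficient of `X` in `[e_j, X]` is `-α_j`, so that `α` is the connection form. -/
structure LeviFlatFrame (A : Type*) [CommRing A] [Algebra ℝ A] (n : ℕ) where
  /-- The conjugation of `A`. -/
  c : A →ₐ[ℝ] A
  c_c : ∀ a, c (c a) = a
  /-- The frame of `T¹⁰`; its conjugate is a frame of `T⁰¹`. -/
  e : Fin n → Derivation ℝ A A
  /-- The real field transverse to the leaves. -/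
  X : Derivation ℝ A A
  conj_X : X.conj c c_c = X
  indep : ∀ (f g : Fin n → A) (t : A),
    ∑ j, f j • e j + ∑ j, g j • (e j).conj c c_c + t • X = 0 → f = 0 ∧ g = 0 ∧ t = 0
  /-- The coefficients of `[e_i, e_k]`. -/
  cc : Fin n → Fin n → Fin n → A
  /-- The `e`-coefficients of `[e_j, ē_k]`. -/
  p : Fin n → Fin n → Fin n → A
  /-- The `ē`-coefficients of `[e_j, ē_k]`. -/
  q : Fin n → Fin n → Fin n → A
  /-- The `e`-coefficients of `[e_j, X]`. -/
  r : Fin n → Fin n → A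
  /-- The `ē`-coefficients of `[e_j, X]`. -/
  s : Fin n → Fin n → A
  /-- The values of the connection form on the frame. -/
  α : Fin n → A
  lie_e_e : ∀ i k, ⁅e i, e k⁆ = ∑ l, cc i k l • e l
  lie_e_conj : ∀ j k, ⁅e j, (e k).conj c c_c⁆ =
    ∑ l, p j k l • e l + ∑ l, q j k l • (e l).conj c c_c
  lie_e_X : ∀ j, ⁅e j, X⁆ =
    ∑ l, r j l • e l + ∑ l, s j l • (e l).conj c c_c - α j • X

namespace LeviFlatFrame

variable {A : Type*} [CommRing A] [Algebra ℝ A] {n : ℕ} (F : LeviFlatFrame A n)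

/-- The conjugate vector fields `ē_j`. -/
def eb (j : Fin n) : Derivation ℝ A A := (F.e j).conj F.c F.c_c

/-- The curvature matrix `Θ(e_j ⊗ ē_k) = -ē_k α(e_j) - α([e_j, ē_k])`. -/
def Θ : Matrix (Fin n) (Fin n) A :=
  Matrix.of fun j k => -F.eb k (F.α j) - ∑ l, F.p j k l * F.α l

theorem Θ_apply (j k : Fin n) : F.Θ j k = -F.eb k (F.α j) - ∑ l, F.p j k l * F.α l := rfl

theorem conj_eb (j : Fin n) : (F.eb j).conj F.c F.c_c = F.e j := Derivation.conj_conj _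

theorem lie_e_eb (j k : Fin n) :
    ⁅F.e j, F.eb k⁆ = ∑ l, F.p j k l • F.e l + ∑ l, F.q j k l • F.eb l := F.lie_e_conj j k

theorem lie_eb_e (j k : Fin n) :
    ⁅F.eb k, F.e j⁆ = -(∑ l, F.p j k l • F.e l + ∑ l, F.q j k l • F.eb l) := by
  rw [← lie_skew, lie_e_eb]

theorem lie_eb_eb (i k : Fin n) : ⁅F.eb i, F.eb k⁆ = ∑ l, F.c (F.cc i k l) • F.eb l := by
  have h := congrArg (Derivation.conj F.c F.c_c) (F.lie_e_e i k)
  simp only [Derivation.conj_lie, Derivation.conj_sum, Derivation.conj_smul] at h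
  exact h

theorem lie_e_X' (j : Fin n) : ⁅F.e j, F.X⁆ =
    ∑ l, F.r j l • F.e l + ∑ l, F.s j l • F.eb l - F.α j • F.X := F.lie_e_X j

theorem eb_apply (j : Fin n) (a : A) : F.eb j a = F.c (F.e j (F.c a)) := rfl

theorem lie_eb_X (j : Fin n) : ⁅F.eb j, F.X⁆ =
    ∑ l, F.c (F.s j l) • F.e l + ∑ l, F.c (F.r j l) • F.eb l - F.c (F.α j) • F.X := by
  have h := congrArg (Derivation.conj F.c F.c_c) (F.lie_e_X j)
  simp only [Derivation.conj_lie, Derivation.conj_sum, Derivation.conj_smul, sub_eq_add_neg,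
    Derivation.conj_neg, Derivation.conj_add, Derivation.conj_conj, F.conj_X] at h
  rw [eb, h, add_comm (∑ l, F.c (F.r j l) • _), sub_eq_add_neg]
  rfl

theorem eq_zero_of_smul_X (a : A)
    (h : a • F.X ∈ Submodule.span A (Set.range F.e ∪ Set.range F.eb)) : a = 0 := by
  rw [Submodule.span_union, Submodule.mem_sup] at h
  obtain ⟨u, hu, v, hv, h⟩ := h
  obtain ⟨f, rfl⟩ := (Submodule.mem_span_range_iff_exists_fun A).1 hu
  obtain ⟨g, rfl⟩ := (Submodule.mem_span_range_iff_exists_fun A).1 hv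
  have := (F.indep f g (-a) (by rw [neg_smul, ← h, ← sub_eq_add_neg]; exact sub_self _)).2.2
  simpa using this

theorem eq_zero_of_sum_e (f : Fin n → A)
    (h : ∑ j, f j • F.e j ∈ Submodule.span A (Set.range F.eb)) : f = 0 := by
  obtain ⟨g, h⟩ := (Submodule.mem_span_range_iff_exists_fun A).1 h
  refine (F.indep f (-g) 0 ?_).1
  rw [← h]
  simp [eb]

/-- `q_{jk}^l` is minus the conjugate of `p_{kj}^l`, as `[e_j, ē_k]` is minus the conjugate of
`[e_k, ē_j]`. -/
theorem c_p (j k l : Fin n) : F.c (F.p k j l) = -F.q j k l := by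
  have h := congrArg (Derivation.conj F.c F.c_c) (F.lie_e_eb k j)
  simp only [Derivation.conj_lie, Derivation.conj_sum, Derivation.conj_smul,
    Derivation.conj_add, F.conj_eb] at h
  change ⁅F.eb k, F.e j⁆ = ∑ l, _ • F.eb l + _ at h
  rw [F.lie_eb_e] at h
  have := (F.indep (fun l => F.p j k l + F.c (F.q k j l)) (fun l => F.q j k l + F.c (F.p k j l)) 0
    (by
      simp only [add_smul, Finset.sum_add_distrib, zero_smul, add_zero]
      change _ + _ + (∑ l, _ • F.eb l + ∑ l, _ • F.eb l) = 0
      rw [neg_eq_iff_add_eq_zero] at h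
      rw [← h]
      abel)).2.1
  exact eq_neg_of_add_eq_zero_right (congrFun this l)

/-- The curvature matrix is Hermitian: this is the `X`-component of the Jacobi identity for
`e_j`, `ē_k` and `X`. -/
theorem c_Θ (j k : Fin n) : F.c (F.Θ k j) = F.Θ j k := by
  -- all brackets are computed modulo the span `S` of the tangential fields
  let S := Submodule.span A (Set.range F.e ∪ Set.range F.eb)
  have he : ∀ l, S.mkQ (F.e l) = 0 := fun l =>
    (Submodule.Quotient.mk_eq_zero _).2 (Submodule.subset_span (Or.inl ⟨l, rfl⟩))
  have heb : ∀ l, S.mkQ (F.eb l) = 0 := fun l =>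
    (Submodule.Quotient.mk_eq_zero _).2 (Submodule.subset_span (Or.inr ⟨l, rfl⟩))
  have hJ := congrArg S.mkQ (leibniz_lie (F.e j) (F.eb k) F.X)
  rw [F.lie_eb_X, F.lie_e_eb, F.lie_e_X'] at hJ
  simp only [lie_sub, lie_add, lie_sum, Derivation.lie_smul', add_lie, sum_lie,
    Derivation.smul_lie', map_add, map_sub, map_sum, map_smul, he, heb, F.lie_e_e, F.lie_e_eb,
    F.lie_eb_e, F.lie_eb_eb, F.lie_e_X', F.lie_eb_X, map_neg, smul_zero, Finset.sum_const_zero,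
    add_zero, sub_zero, neg_zero, zero_sub] at hJ
  have h0 : F.Θ j k - F.c (F.Θ k j) = 0 := by
    refine F.eq_zero_of_smul_X _ ((Submodule.Quotient.mk_eq_zero _).1 ?_)
    change S.mkQ ((F.Θ j k - F.c (F.Θ k j)) • F.X) = 0
    rw [map_smul]
    simp only [Θ_apply, map_sub, map_neg, map_sum, map_mul, F.c_p, F.eb_apply, F.c_c,
      neg_mul, Finset.sum_neg_distrib, sub_smul, neg_smul, Finset.sum_smul] at hJ ⊢
    simp only [smul_smul, smul_neg, Finset.sum_neg_distrib, sub_eq_add_neg, neg_add, neg_neg,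
      mul_comm (F.α j)] at hJ ⊢
    rw [← sub_eq_zero] at hJ
    rw [← neg_eq_zero, ← hJ]
    abel
  exact (sub_eq_zero.1 h0).symm

/-- The partial connection of `T¹⁰` along `T⁰¹` with matrices `p` is flat: this is the
`e`-component of the Jacobi identity for `ē_i`, `ē_k` and `e_j`. -/
theorem flat (i j k r : Fin n) :
    F.eb i (F.p j k r) - ∑ l, F.p j k l * F.p l i r =
      ∑ l, F.c (F.cc i k l) * F.p j l r + F.eb k (F.p j i r) - ∑ l, F.p j i l * F.p l k r := by
  -- all brackets are computed modulo the span `S` of the fields of type `(0,1)`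
  let S := Submodule.span A (Set.range F.eb)
  have heb : ∀ l, S.mkQ (F.eb l) = 0 := fun l =>
    (Submodule.Quotient.mk_eq_zero _).2 (Submodule.subset_span ⟨l, rfl⟩)
  have hJ := congrArg S.mkQ (leibniz_lie (F.eb i) (F.eb k) (F.e j))
  rw [F.lie_eb_e, F.lie_eb_e, F.lie_eb_eb] at hJ
  simp only [lie_neg, lie_add, lie_sum, Derivation.lie_smul', sum_lie,
    Derivation.smul_lie', map_add, map_sub, map_sum, map_smul, heb,
    F.lie_eb_e, F.lie_eb_eb, map_neg, smul_zero, Finset.sum_const_zero, add_zero, sub_zero] at hJ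
  have h0 := F.eq_zero_of_sum_e (fun r => F.eb i (F.p j k r) - ∑ l, F.p j k l * F.p l i r -
      (∑ l, F.c (F.cc i k l) * F.p j l r + F.eb k (F.p j i r) - ∑ l, F.p j i l * F.p l k r))
    ((Submodule.Quotient.mk_eq_zero _).1 (by
      change S.mkQ _ = 0
      simp only [map_sum, map_smul]
      simp only [sub_smul, add_smul, Finset.sum_smul, Finset.sum_sub_distrib,
        Finset.sum_add_distrib, Finset.smul_sum, smul_smul, smul_neg, Finset.sum_neg_distrib]
        at hJ ⊢
      rw [← sub_eq_zero] at hJ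
      rw [Finset.sum_comm (f := fun r l => (F.p j k l * F.p l i r) • S.mkQ (F.e r)),
        Finset.sum_comm (f := fun r l => (F.p j i l * F.p l k r) • S.mkQ (F.e r)),
        Finset.sum_comm (f := fun r l => (F.c (F.cc i k l) * F.p j l r) • S.mkQ (F.e r)),
        ← neg_eq_zero, ← hJ]
      abel))
  exact sub_eq_zero.1 (congrFun h0 r)

/-- The curvature form is `∂̄`-closed. -/
theorem eb_Θ (i j k : Fin n) :
    F.eb i (F.Θ j k) = F.eb k (F.Θ j i) + ∑ l, F.c (F.cc i k l) * F.Θ j l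
      - ∑ l, F.p j i l * F.Θ l k + ∑ l, F.p j k l * F.Θ l i := by
  -- the second derivatives of `α` and the derivatives of `p` are exchanged by `lie_eb_eb`, `flat`
  have h1 : F.eb i (F.eb k (F.α j)) - F.eb k (F.eb i (F.α j)) =
      ∑ l, F.c (F.cc i k l) * F.eb l (F.α j) := by
    rw [← Derivation.commutator_apply, F.lie_eb_eb, Derivation.sum_smul_apply]
  have h2 : ∑ r, (F.eb i (F.p j k r) - ∑ l, F.p j k l * F.p l i r) * F.α r =
      ∑ r, (∑ l, F.c (F.cc i k l) * F.p j l r + F.eb k (F.p j i r)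
        - ∑ l, F.p j i l * F.p l k r) * F.α r :=
    Finset.sum_congr rfl fun r _ => by rw [F.flat]
  simp only [Θ_apply, map_sub, map_neg, map_sum, Derivation.leibniz, smul_eq_mul, mul_sub,
    Finset.sum_sub_distrib, Finset.sum_add_distrib, mul_neg, Finset.sum_neg_distrib,
    Finset.mul_sum, sub_mul, add_mul, Finset.sum_mul] at h2 ⊢
  rw [Finset.sum_comm (f := fun r l => F.p j k l * F.p l i r * F.α r),
    Finset.sum_comm (f := fun r l => F.p j i l * F.p l k r * F.α r),
    Finset.sum_comm (f := fun r l => F.c (F.cc i k l) * F.p j l r * F.α r)] at h2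
  simp only [mul_assoc, mul_comm (F.α _)] at h2 ⊢
  linear_combination -h1 - h2

/-- The `X`-component of `[V, W]` for a section `V` of `T¹⁰` and a lift `W` of a normalized
section; the condition `t * t = 1` expresses that the lift is `±X` modulo tangential fields. -/
theorem lie_section_lift (f g k : Fin n → A) {t : A} (ht : t * t = 1) (b d : Fin n → A) (a : A)
    (h : ⁅∑ j, f j • F.e j, ∑ j, g j • F.e j + ∑ j, k j • F.eb j + t • F.X⁆ =
      ∑ j, b j • F.e j + ∑ j, d j • F.eb j + a • F.X) :
    a = -(t * ∑ j, f j * F.α j) := by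
  let S := Submodule.span A (Set.range F.e ∪ Set.range F.eb)
  have he : ∀ l, S.mkQ (F.e l) = 0 := fun l =>
    (Submodule.Quotient.mk_eq_zero _).2 (Submodule.subset_span (Or.inl ⟨l, rfl⟩))
  have heb : ∀ l, S.mkQ (F.eb l) = 0 := fun l =>
    (Submodule.Quotient.mk_eq_zero _).2 (Submodule.subset_span (Or.inr ⟨l, rfl⟩))
  have hJ := congrArg S.mkQ h
  simp only [lie_add, lie_sum, Derivation.lie_smul', sum_lie,
    Derivation.smul_lie', map_add, map_sub, map_sum, map_smul, he, heb, F.lie_e_e, F.lie_e_eb,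
    F.lie_e_X', smul_zero, Finset.sum_const_zero, Derivation.apply_eq_zero_of_mul_self_eq_one ht,
    add_zero, zero_add, sub_zero, zero_sub, zero_smul] at hJ
  refine eq_neg_of_add_eq_zero_left (F.eq_zero_of_smul_X _
    ((Submodule.Quotient.mk_eq_zero _).1 ?_))
  change S.mkQ ((a + t * ∑ j, f j * F.α j) • F.X) = 0
  rw [map_smul, add_smul, ← hJ, Finset.mul_sum, Finset.sum_smul]
  simp only [smul_smul, smul_neg, Finset.sum_neg_distrib]
  abel

/-- The `e`-components of `[V, W̄]` for sections `V` and `W` of `T¹⁰`. -/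
theorem lie_section_conj (f g b d : Fin n → A)
    (h : ⁅∑ j, f j • F.e j, ∑ k, g k • F.eb k⁆ = ∑ j, b j • F.e j + ∑ j, d j • F.eb j)
    (l : Fin n) :
    b l = ∑ j, ∑ k, f j * g k * F.p j k l - ∑ k, g k * F.eb k (f l) := by
  let S := Submodule.span A (Set.range F.eb)
  have heb : ∀ l, S.mkQ (F.eb l) = 0 := fun l =>
    (Submodule.Quotient.mk_eq_zero _).2 (Submodule.subset_span ⟨l, rfl⟩)
  have hJ := congrArg S.mkQ h
  simp only [lie_sum, Derivation.lie_smul', sum_lie,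
    Derivation.smul_lie', map_add, map_sub, map_sum, map_smul, heb, F.lie_e_eb,
    smul_zero, Finset.sum_const_zero, add_zero] at hJ
  have h0 := F.eq_zero_of_sum_e (fun l => b l -
      (∑ j, ∑ k, f j * g k * F.p j k l - ∑ k, g k * F.eb k (f l)))
    ((Submodule.Quotient.mk_eq_zero _).1 (by
      change S.mkQ _ = 0
      simp only [map_sum, map_smul]
      have h1 : ∑ l, ∑ j, ∑ k, (f j * g k * F.p j k l) • S.mkQ (F.e l) =
          ∑ k, ∑ j, ∑ l, (g k * (f j * F.p j k l)) • S.mkQ (F.e l) := by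
        rw [Finset.sum_comm_cycle]
        refine Finset.sum_congr rfl fun k _ => ?_
        rw [Finset.sum_comm]
        simp only [mul_comm (f _) (g _), mul_assoc]
      have h2 : ∑ l, ∑ k, (g k * F.eb k (f l)) • S.mkQ (F.e l) =
          ∑ k, ∑ j, (g k * F.eb k (f j)) • S.mkQ (F.e j) := Finset.sum_comm
      simp only [sub_smul, Finset.sum_smul, Finset.sum_sub_distrib, ← hJ, Finset.smul_sum,
        smul_smul, smul_sub, h1, h2]
      exact sub_self _))
  exact sub_eq_zero.1 (congrFun h0 l)

/-! ### The divergence of the gradient of the connection form -/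

/-- The frame `(e, ē, X)` as a single family. -/
def b : (Fin n ⊕ Fin n) ⊕ Unit → Derivation ℝ A A :=
  Sum.elim (Sum.elim F.e F.eb) fun _ => F.X

/-- The matrix of the components of the frame with respect to coordinates `x`. -/
def B (x : (Fin n ⊕ Fin n) ⊕ Unit → A) :
    Matrix ((Fin n ⊕ Fin n) ⊕ Unit) ((Fin n ⊕ Fin n) ⊕ Unit) A :=
  Matrix.of fun i k => F.b i (x k)

/-- The vector field `∑ z_k ē_k` of type `(0,1)`. -/
def Z (z : Fin n → A) : Derivation ℝ A A := ∑ k, z k • F.eb k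

/-- The matrix of `e_j ↦ [Z, e_j]` modulo vectors of type `(0,1)`. -/
def Q (z : Fin n → A) : Matrix (Fin n) (Fin n) A := Matrix.of fun j l => -∑ i, z i * F.p j i l

/-- The matrix of `ē_k ↦ [Z, ē_k]`. -/
def R (z : Fin n → A) : Matrix (Fin n) (Fin n) A :=
  Matrix.of fun k l => ∑ i, z i * F.c (F.cc i k l) - F.eb k (z l)

theorem Z_apply (z : Fin n → A) (a : A) : F.Z z a = ∑ k, z k * F.eb k a :=
  Derivation.sum_smul_apply _ _ _

/-- The derivative along `Z` of the curvature matrix, if `Θ(·, Z) = α`. -/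
theorem Θ_map_Z (z : Fin n → A) (hz : ∀ j, ∑ k, F.Θ j k * z k = F.α j) :
    F.Θ.map (F.Z z) = (-1 + F.Q z) * F.Θ + F.Θ * (F.R z).transpose := by
  ext j k
  have h1 : F.eb k (F.α j) = ∑ i, (F.Θ j i * F.eb k (z i) + z i * F.eb k (F.Θ j i)) := by
    simp_rw [← hz j, map_sum, Derivation.leibniz, smul_eq_mul]
  have h2 : ∑ l, F.p j k l * F.α l = ∑ i, z i * ∑ l, F.p j k l * F.Θ l i := by
    simp_rw [← hz, Finset.mul_sum]
    rw [Finset.sum_comm]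
    exact Finset.sum_congr rfl fun i _ => Finset.sum_congr rfl fun l _ => by ring
  rw [Matrix.map_apply, Z_apply]
  simp_rw [F.eb_Θ _ j k]
  simp only [Matrix.add_mul, Matrix.add_apply, Matrix.neg_mul, Matrix.one_mul, Matrix.neg_apply,
    Matrix.mul_apply, Matrix.transpose_apply]
  simp only [Q, R, Matrix.of_apply, mul_add, mul_sub, Finset.sum_add_distrib,
    Finset.sum_sub_distrib]
  rw [← h2]
  have h3 : F.Θ j k = -F.eb k (F.α j) - ∑ l, F.p j k l * F.α l := rfl
  rw [Finset.sum_add_distrib] at h1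
  have h4 : ∑ i, z i * ∑ l, F.c (F.cc i k l) * F.Θ j l =
      ∑ l, F.Θ j l * ∑ i, z i * F.c (F.cc i k l) := by
    simp_rw [Finset.mul_sum]
    rw [Finset.sum_comm]
    exact Finset.sum_congr rfl fun i _ => Finset.sum_congr rfl fun l _ => by ring
  have h5 : ∑ i, z i * ∑ l, F.p j i l * F.Θ l k = -∑ l, (-∑ i, z i * F.p j i l) * F.Θ l k := by
    simp_rw [neg_mul, Finset.sum_neg_distrib, neg_neg, Finset.mul_sum, Finset.sum_mul]
    rw [Finset.sum_comm]
    exact Finset.sum_congr rfl fun i _ => Finset.sum_congr rfl fun l _ => by ring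
  linear_combination h3 - h1 + h4 - h5

/-- The matrix of `[Z, ·]` in the frame `(e, ē, X)` and its trace. No condition on `z` is needed. -/
theorem exists_lie_b (z : Fin n → A) :
    ∃ C : Matrix ((Fin n ⊕ Fin n) ⊕ Unit) ((Fin n ⊕ Fin n) ⊕ Unit) A,
      (∀ i, ⁅F.Z z, F.b i⁆ = ∑ j, C i j • F.b j) ∧
      C.trace = (F.Q z).trace + (F.R z).trace - ∑ k, z k * F.c (F.α k) := by
  have key : ∀ i, ∃ f g : Fin n → A, ∃ t, ⁅F.Z z, F.b i⁆ =
      ∑ l, f l • F.e l + ∑ l, g l • F.eb l + t • F.X ∧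
      (∀ j, i = .inl (.inl j) → f j = F.Q z j j) ∧ (∀ j, i = .inl (.inr j) → g j = F.R z j j) ∧
      (i = .inr () → t = -∑ k, z k * F.c (F.α k)) := by
    rintro ((j | k) | ⟨⟩)
    · refine ⟨fun l => F.Q z j l, fun l => -∑ i, z i * F.q j i l - F.e j (z l), 0, ?_, ?_, ?_, ?_⟩
      · simp only [Z, sum_lie, b, Sum.elim_inl, Derivation.smul_lie', lie_eb_e, Q, Matrix.of_apply,
          zero_smul, add_zero, sub_smul, neg_smul, Finset.sum_smul, Finset.sum_sub_distrib,
          smul_neg, smul_add, Finset.sum_neg_distrib, Finset.sum_add_distrib, Finset.smul_sum,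
          smul_smul]
        rw [Finset.sum_comm (f := fun i l => (z i * F.p j i l) • F.e l),
          Finset.sum_comm (f := fun i l => (z i * F.q j i l) • F.eb l)]
        abel
      · rintro j' ⟨⟩; rfl
      · rintro j' ⟨⟩
      · rintro ⟨⟩
    · refine ⟨0, fun l => F.R z k l, 0, ?_, ?_, ?_, ?_⟩
      · simp only [Z, sum_lie, b, Sum.elim_inl, Sum.elim_inr, Derivation.smul_lie', lie_eb_eb, R,
          Matrix.of_apply, zero_smul, add_zero, sub_smul, Finset.sum_smul, Finset.sum_sub_distrib,
          Finset.smul_sum, smul_smul, Pi.zero_apply, Finset.sum_const_zero, zero_add]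
        rw [Finset.sum_comm (f := fun i l => (z i * F.c (F.cc i k l)) • F.eb l)]
      · rintro j' ⟨⟩
      · rintro j' ⟨⟩; rfl
      · rintro ⟨⟩
    · refine ⟨fun l => ∑ i, z i * F.c (F.s i l), fun l => ∑ i, z i * F.c (F.r i l) - F.X (z l),
        -∑ k, z k * F.c (F.α k), ?_, ?_, ?_, ?_⟩
      · simp only [Z, sum_lie, b, Sum.elim_inr, Derivation.smul_lie', lie_eb_X,
          sub_smul, neg_smul, Finset.sum_smul, Finset.sum_sub_distrib,
          smul_sub, smul_add, Finset.sum_add_distrib, Finset.smul_sum,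
          smul_smul]
        rw [Finset.sum_comm (f := fun i l => (z i * F.c (F.s i l)) • F.e l),
          Finset.sum_comm (f := fun i l => (z i * F.c (F.r i l)) • F.eb l)]
        abel
      · rintro j' ⟨⟩
      · rintro j' ⟨⟩
      · rintro ⟨⟩; rfl
  choose f g t h hf hg ht using key
  refine ⟨Matrix.of fun i => Sum.elim (Sum.elim (f i) (g i)) fun _ => t i, fun i => ?_, ?_⟩
  · rw [h]
    simp [Fintype.sum_sum_type, b]
  · simp only [Matrix.trace, Matrix.diag, Fintype.sum_sum_type, Matrix.of_apply, Sum.elim_inl,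
      Sum.elim_inr, Finset.univ_unique, Finset.sum_singleton]
    rw [Finset.sum_congr rfl fun j _ => hf _ j rfl, Finset.sum_congr rfl fun j _ => hg _ j rfl,
      ht _ rfl]
    ring

/-- The divergence of `Z` with respect to the density `g = det Θ / |det B|`: if `Θ(·, Z) = α` then
`div (g Z) = g (ᾱ(Z) - n)`. The density enters through `g γ = det Θ`, `γ² = ± (det B)²`. -/
theorem divergence_Z (D : (Fin n ⊕ Fin n) ⊕ Unit → Derivation ℝ A A)
    (x : (Fin n ⊕ Fin n) ⊕ Unit → A)
    (hD : ∀ E : Derivation ℝ A A, E ∈ Submodule.span A (Set.range F.b) → E = ∑ k, E (x k) • D k)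
    (z : Fin n → A) (hz : ∀ j, ∑ k, F.Θ j k * z k = F.α j) (g γ : A) (s : ℤ)
    (hg : g * γ = F.Θ.det) (hγ : γ * γ = s * ((F.B x).det * (F.B x).det)) (hγu : IsUnit γ) :
    ∑ k, D k (g * F.Z z (x k)) = g * (∑ k, z k * F.c (F.α k) - n) := by
  obtain ⟨C, hC, htr⟩ := F.exists_lie_b z
  set J : Matrix ((Fin n ⊕ Fin n) ⊕ Unit) ((Fin n ⊕ Fin n) ⊕ Unit) A :=
    Matrix.of fun l k => D l (F.Z z (x k)) with hJ
  have hb : ∀ i, F.b i = ∑ k, F.b i (x k) • D k := fun i =>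
    hD _ (Submodule.subset_span ⟨i, rfl⟩)
  -- the derivative of `b i (x k)` along `Z` comes from the commutator and from `Z (x k)`
  have hB : (F.B x).map (F.Z z) = C * F.B x + F.B x * J := by
    ext i k
    have h1 := Derivation.congr_fun (hC i) (x k)
    rw [Derivation.commutator_apply, Derivation.sum_smul_apply] at h1
    have h2 := Derivation.congr_fun (hb i) (F.Z z (x k))
    rw [Derivation.sum_smul_apply] at h2
    rw [Matrix.map_apply, Matrix.add_apply, Matrix.mul_apply, Matrix.mul_apply]
    simp only [B, hJ, Matrix.of_apply]
    linear_combination h1 + h2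
  have hdB := Derivation.apply_det_of_map_eq (F.Z z) _ _ _ hB
  have hdΘ := Derivation.apply_det_of_map_eq (F.Z z) _ _ _ (F.Θ_map_Z z hz)
  have hZ : F.Z z ∈ Submodule.span A (Set.range F.b) :=
    Submodule.sum_mem _ fun k _ => Submodule.smul_mem _ _
      (Submodule.subset_span ⟨.inl (.inr k), rfl⟩)
  -- `γ² = ± (det B)²`, so `γ` has the same logarithmic derivative as `det B`
  have hγZ : F.Z z γ = γ * (C.trace + J.trace) := by
    have h := congrArg (F.Z z) hγ
    simp only [Derivation.leibniz, smul_eq_mul, Derivation.map_intCast, mul_zero, add_zero,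
      hdB] at h
    have h2 : algebraMap ℝ A 2 = 2 := map_ofNat _ 2
    have hu : IsUnit (2 * γ) := by
      rw [← h2]
      exact ((IsUnit.mk0 (2 : ℝ) two_ne_zero).map _).mul hγu
    refine hu.mul_left_cancel ?_
    linear_combination h - 2 * (C.trace + J.trace) * hγ
  -- the summand `-n` is the trace of the matrix `-1` in `Θ_map_Z`
  have hgZ : F.Z z g = g * (-n + (F.Q z).trace + (F.R z).trace - C.trace - J.trace) := by
    have h := congrArg (F.Z z) hg
    rw [Derivation.leibniz, hdΘ, hγZ, smul_eq_mul, smul_eq_mul, Matrix.trace_add,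
      Matrix.trace_neg, Matrix.trace_one, Matrix.trace_transpose, Fintype.card_fin, ← hg] at h
    refine hγu.mul_left_cancel ?_
    linear_combination h
  have h3 : ∑ k, D k (g * F.Z z (x k)) = F.Z z g + g * J.trace := by
    have h4 := Derivation.congr_fun (hD _ hZ) g
    rw [Derivation.sum_smul_apply] at h4
    rw [h4]
    simp only [Derivation.leibniz, smul_eq_mul, Finset.sum_add_distrib, ← Finset.mul_sum]
    rw [add_comm]
    rfl
  rw [h3, hgZ, htr]
  ring

end LeviFlatFrame

/-! ### Smooth functions on an open subset of Euclidean space -/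

open TopologicalSpace (Opens)

/-- The algebra of smooth complex-valued functions on an open set `Ω` of `ℝᵐ`: those functions on
`Ω` that have an extension to `ℝᵐ` which is smooth on `Ω`. -/
def smoothSubalgebra {m : ℕ} (Ω : Opens (EuclideanSpace ℝ (Fin m))) : Subalgebra ℝ (Ω → ℂ) where
  carrier := {f | ∃ F : EuclideanSpace ℝ (Fin m) → ℂ, ContDiffOn ℝ ∞ F Ω ∧ ∀ y : Ω, F y = f y}
  mul_mem' := by
    rintro f g ⟨F, hF, hFf⟩ ⟨G, hG, hGg⟩
    exact ⟨F * G, hF.mul hG, fun y => by simp [hFf, hGg]⟩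
  add_mem' := by
    rintro f g ⟨F, hF, hFf⟩ ⟨G, hG, hGg⟩
    exact ⟨F + G, hF.add hG, fun y => by simp [hFf, hGg]⟩
  algebraMap_mem' r := ⟨fun _ => r, contDiffOn_const, fun y => rfl⟩

/-- The type of smooth complex-valued functions on an open set `Ω` of `ℝᵐ`. -/
def SmoothFun {m : ℕ} (Ω : Opens (EuclideanSpace ℝ (Fin m))) : Type := smoothSubalgebra Ω

namespace SmoothFun

variable {m : ℕ} {Ω : Opens (EuclideanSpace ℝ (Fin m))}

instance : CommRing (SmoothFun Ω) := inferInstanceAs (CommRing (smoothSubalgebra Ω))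

instance : Algebra ℝ (SmoothFun Ω) := inferInstanceAs (Algebra ℝ (smoothSubalgebra Ω))

/-- The underlying function. -/
def toFun (f : SmoothFun Ω) : Ω → ℂ := Subtype.val f

instance : CoeFun (SmoothFun Ω) fun _ => Ω → ℂ := ⟨toFun⟩

@[ext] theorem ext {f g : SmoothFun Ω} (h : ∀ y : Ω, f y = g y) : f = g := Subtype.ext (funext h)

/-- The restriction to `Ω` of a function that is smooth on `Ω`. -/
def mk (F : EuclideanSpace ℝ (Fin m) → ℂ) (hF : ContDiffOn ℝ ∞ F Ω) : SmoothFun Ω :=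
  ⟨fun y => F y, F, hF, fun _ => rfl⟩

@[simp] theorem mk_apply (F : EuclideanSpace ℝ (Fin m) → ℂ) (hF : ContDiffOn ℝ ∞ F Ω) (y : Ω) :
    mk F hF y = F y := rfl

/-- An extension of `f` to the whole space. -/
def rep (f : SmoothFun Ω) : EuclideanSpace ℝ (Fin m) → ℂ := f.2.choose

theorem contDiffOn_rep (f : SmoothFun Ω) : ContDiffOn ℝ ∞ (rep f) Ω := f.2.choose_spec.1

theorem rep_apply (f : SmoothFun Ω) (y : Ω) : rep f y = f y := f.2.choose_spec.2 y

@[simp] theorem add_apply (f g : SmoothFun Ω) (y : Ω) : (f + g) y = f y + g y := rfl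
@[simp] theorem mul_apply (f g : SmoothFun Ω) (y : Ω) : (f * g) y = f y * g y := rfl
@[simp] theorem real_smul_apply (r : ℝ) (f : SmoothFun Ω) (y : Ω) : (r • f) y = r • f y := rfl
@[simp] theorem neg_apply (f : SmoothFun Ω) (y : Ω) : (-f) y = -f y := rfl
@[simp] theorem sub_apply (f g : SmoothFun Ω) (y : Ω) : (f - g) y = f y - g y := rfl
@[simp] theorem zero_apply (y : Ω) : (0 : SmoothFun Ω) y = 0 := rfl
@[simp] theorem one_apply (y : Ω) : (1 : SmoothFun Ω) y = 1 := rfl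

/-- Evaluation at a point. -/
def eval (y : Ω) : SmoothFun Ω →+* ℂ := (Pi.evalRingHom (fun _ : Ω => ℂ) y).comp
  (smoothSubalgebra Ω).val.toRingHom

theorem eval_apply (y : Ω) (f : SmoothFun Ω) : eval y f = f y := rfl

@[simp] theorem sum_apply {κ : Type*} (s : Finset κ) (f : κ → SmoothFun Ω) (y : Ω) :
    (∑ i ∈ s, f i) y = ∑ i ∈ s, f i y := by
  simp [← eval_apply]

theorem differentiableAt_of_contDiffOn {F : EuclideanSpace ℝ (Fin m) → ℂ}
    (hF : ContDiffOn ℝ ∞ F Ω) (y : Ω) : DifferentiableAt ℝ F y :=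
  (hF.contDiffAt (Ω.isOpen.mem_nhds y.2)).differentiableAt (by simp)

theorem eventuallyEq_rep {f : SmoothFun Ω} {F : EuclideanSpace ℝ (Fin m) → ℂ}
    (h : ∀ y : Ω, F y = f y) (y : Ω) : rep f =ᶠ[nhds (y : EuclideanSpace ℝ (Fin m))] F := by
  filter_upwards [Ω.isOpen.mem_nhds y.2] with z hz
  rw [rep_apply f ⟨z, hz⟩, h ⟨z, hz⟩]

theorem contDiffOn_fderiv_apply {F : EuclideanSpace ℝ (Fin m) → ℂ} (hF : ContDiffOn ℝ ∞ F Ω)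
    (v : EuclideanSpace ℝ (Fin m)) : ContDiffOn ℝ ∞ (fun y => fderiv ℝ F y v) Ω :=
  (hF.fderiv_of_isOpen Ω.isOpen (m := ∞) (by simp)).clm_apply contDiffOn_const

/-- The partial derivative in the `k`-th coordinate. -/
def pd (k : Fin m) : Derivation ℝ (SmoothFun Ω) (SmoothFun Ω) :=
  Derivation.mk'
    { toFun f := mk (fun y => fderiv ℝ (rep f) y (EuclideanSpace.single k 1))
        (contDiffOn_fderiv_apply (contDiffOn_rep f) _)
      map_add' f g := by
        ext y
        rw [mk_apply, (eventuallyEq_rep (F := rep f + rep g)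
          (fun y => by simp [rep_apply]) y).fderiv_eq, fderiv_add
          (differentiableAt_of_contDiffOn (contDiffOn_rep f) y)
          (differentiableAt_of_contDiffOn (contDiffOn_rep g) y)]
        rfl
      map_smul' r f := by
        ext y
        rw [mk_apply, (eventuallyEq_rep (F := r • rep f)
          (fun y => by simp [rep_apply]) y).fderiv_eq, fderiv_const_smul
          (differentiableAt_of_contDiffOn (contDiffOn_rep f) y)]
        rfl }
    fun f g => by
      ext y
      change fderiv ℝ (rep (f * g)) y _ = _
      rw [(eventuallyEq_rep (F := rep f * rep g)
          (fun y => by simp [rep_apply]) y).fderiv_eq, fderiv_mul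
          (differentiableAt_of_contDiffOn (contDiffOn_rep f) y)
          (differentiableAt_of_contDiffOn (contDiffOn_rep g) y)]
      simp [rep_apply]

/-- The partial derivative may be computed with any extension of `f`. -/
theorem pd_apply_of_eq {f : SmoothFun Ω} {F : EuclideanSpace ℝ (Fin m) → ℂ}
    (h : ∀ y : Ω, F y = f y) (k : Fin m) (y : Ω) :
    pd k f y = fderiv ℝ F y (EuclideanSpace.single k 1) := by
  rw [← (eventuallyEq_rep h y).fderiv_eq]
  rfl

theorem pd_comm (j k : Fin m) (f : SmoothFun Ω) : pd j (pd k f) = pd k (pd j f) := by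
  ext y
  have h : ∀ i, pd i f = mk (fun y => fderiv ℝ (rep f) y (EuclideanSpace.single i 1))
      (contDiffOn_fderiv_apply (contDiffOn_rep f) _) := fun i => rfl
  have hd : DifferentiableAt ℝ (fderiv ℝ (rep f)) y :=
    (((contDiffOn_rep f).fderiv_of_isOpen Ω.isOpen (m := ∞) (by simp)).contDiffAt
      (Ω.isOpen.mem_nhds y.2)).differentiableAt (by simp)
  have hsymm : IsSymmSndFDerivAt ℝ (rep f) y :=
    ((contDiffOn_rep f).contDiffAt (Ω.isOpen.mem_nhds y.2)).isSymmSndFDerivAt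
      (by simpa using WithTop.coe_le_coe.2 (le_top : (2 : ℕ∞) ≤ ⊤))
  rw [pd_apply_of_eq (F := fun y => fderiv ℝ (rep f) y (EuclideanSpace.single k 1))
      (fun y => rfl) j y, pd_apply_of_eq (F := fun y => fderiv ℝ (rep f) y
      (EuclideanSpace.single j 1)) (fun y => rfl) k y,
    fderiv_clm_apply hd (differentiableAt_const _), fderiv_clm_apply hd (differentiableAt_const _)]
  simpa using hsymm _ _

/-- The `k`-th coordinate function. -/
def coord (k : Fin m) : SmoothFun Ω :=
  mk (fun y => (y k : ℂ)) (Complex.ofRealCLM.contDiff.comp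
    (EuclideanSpace.proj (𝕜 := ℝ) k).contDiff).contDiffOn

theorem pd_coord (j k : Fin m) : pd j (coord k : SmoothFun Ω) = if j = k then 1 else 0 := by
  ext y
  rw [pd_apply_of_eq (F := Complex.ofRealCLM.comp (EuclideanSpace.proj (𝕜 := ℝ) k))
    (fun y => rfl), ContinuousLinearMap.fderiv]
  simp [eq_comm]
  split_ifs <;> simp

/-- Pointwise complex conjugation. -/
def conj : SmoothFun Ω →ₐ[ℝ] SmoothFun Ω where
  toFun f := ⟨fun y => starRingEnd ℂ (f y), fun y => starRingEnd ℂ (rep f y),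
    Complex.conjCLE.contDiff.comp_contDiffOn (contDiffOn_rep f), fun y => congrArg _ (rep_apply f y)⟩
  map_one' := ext fun y => map_one (starRingEnd ℂ)
  map_mul' f g := ext fun y => map_mul (starRingEnd ℂ) (f y) (g y)
  map_zero' := ext fun y => map_zero (starRingEnd ℂ)
  map_add' f g := ext fun y => map_add (starRingEnd ℂ) (f y) (g y)
  commutes' r := by
    ext y
    exact Complex.conj_ofReal r

@[simp] theorem conj_apply (f : SmoothFun Ω) (y : Ω) : conj f y = starRingEnd ℂ (f y) := rfl

theorem conj_conj (f : SmoothFun Ω) : conj (conj f) = f := by ext; simp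

theorem pd_conj (k : Fin m) (f : SmoothFun Ω) : pd k (conj f) = conj (pd k f) := by
  ext y
  have hd := differentiableAt_of_contDiffOn (contDiffOn_rep f) y
  rw [pd_apply_of_eq (F := fun y => Complex.conjCLE (rep f y))
    (fun y => by simp [rep_apply]), conj_apply, pd_apply_of_eq (rep_apply f)]
  have := (Complex.conjCLE.toContinuousLinearMap.hasFDerivAt.comp
    (y : EuclideanSpace ℝ (Fin m)) hd.hasFDerivAt).fderiv
  simp only [Function.comp_def] at this
  erw [this]
  rfl

theorem isUnit_of_ne_zero (f : SmoothFun Ω) (h : ∀ y, f y ≠ 0) : IsUnit f := by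
  refine IsUnit.of_mul_eq_one (mk (fun y => (rep f y)⁻¹) ((contDiffOn_rep f).inv fun y hy => ?_)) ?_
  · rw [rep_apply f ⟨y, hy⟩]; exact h _
  · ext y; simp [rep_apply, h]

/-- The absolute value of a smooth function without zeros. -/
def abs (f : SmoothFun Ω) (h : ∀ y, f y ≠ 0) : SmoothFun Ω :=
  mk (fun y => (‖rep f y‖ : ℂ)) (Complex.ofRealCLM.contDiff.comp_contDiffOn
    ((contDiffOn_rep f).norm ℂ fun y hy => by rw [rep_apply f ⟨y, hy⟩]; exact h _))

theorem abs_apply (f : SmoothFun Ω) (h : ∀ y, f y ≠ 0) (y : Ω) : abs f h y = (‖f y‖ : ℂ) :=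
  congrArg (fun z : ℂ => (‖z‖ : ℂ)) (rep_apply f y)

/-- The vector field with components `V`, as a derivation. -/
def vf (V : Fin m → SmoothFun Ω) : Derivation ℝ (SmoothFun Ω) (SmoothFun Ω) := ∑ k, V k • pd k

theorem vf_apply (V : Fin m → SmoothFun Ω) (f : SmoothFun Ω) : vf V f = ∑ k, V k * pd k f :=
  Derivation.sum_smul_apply _ _ _

theorem vf_coord (V : Fin m → SmoothFun Ω) (k : Fin m) : vf V (coord k) = V k := by
  simp [vf_apply, pd_coord]

theorem vf_eq_sum (V : Fin m → SmoothFun Ω) : vf V = ∑ k, vf V (coord k) • pd k := by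
  simp only [vf_coord]
  rfl

theorem vf_smul (a : SmoothFun Ω) (V : Fin m → SmoothFun Ω) : vf (a • V) = a • vf V := by
  simp [vf, Finset.smul_sum, smul_smul]

theorem vf_sum {κ : Type*} [Fintype κ] (V : κ → Fin m → SmoothFun Ω) :
    vf (∑ i, V i) = ∑ i, vf (V i) := by
  simp only [vf, Finset.sum_apply, Finset.sum_smul]
  exact Finset.sum_comm

/-- The commutator of two vector fields in coordinates. -/
theorem lie_vf (V W : Fin m → SmoothFun Ω) :
    ⁅vf V, vf W⁆ = vf fun k => vf V (W k) - vf W (V k) := by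
  ext1 f
  rw [Derivation.commutator_apply]
  simp only [vf_apply, map_sum, Derivation.leibniz, smul_eq_mul, sub_mul,
    Finset.sum_add_distrib, Finset.sum_sub_distrib, Finset.mul_sum, Finset.sum_mul]
  rw [Finset.sum_comm (f := fun i j => V i * (W j * pd j (pd i f)))]
  have h1 : ∀ i j, V j * (W i * pd i (pd j f)) = W i * (V j * pd j (pd i f)) := fun i j => by
    rw [pd_comm]; ring
  have h2 : ∀ (V W : Fin m → SmoothFun Ω) i j,
    pd i f * (V j * pd j (W i)) = V j * pd j (W i) * pd i f := fun V W i j => by ring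
  simp only [h1, h2]
  ring

theorem conj_vf (V : Fin m → SmoothFun Ω) :
    (vf V).conj conj conj_conj = vf fun k => conj (V k) := by
  ext1 f
  simp [Derivation.conj_apply, vf_apply, pd_conj, conj_conj]

attribute [irreducible] SmoothFun.pd SmoothFun.vf

end SmoothFun

/-! ### Vector fields in a chart -/

section Chart

open VectorField

variable {m : ℕ} {M : Type*} [TopologicalSpace M]
  [ChartedSpace (EuclideanSpace ℝ (Fin m)) M] [IsManifold (𝓡 m) ∞ M]

/-- The derivative at `φ⁻¹ y` of the chart `φ` around `p`. -/
def chartDeriv (p : M) (y : EuclideanSpace ℝ (Fin m)) :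
    TangentSpace (𝓡 m) ((extChartAt (𝓡 m) p).symm y) →L[ℝ] EuclideanSpace ℝ (Fin m) :=
  (mfderiv (𝓡 m) (𝓡 m) (extChartAt (𝓡 m) p).symm y).inverse

/-- The vector field `V` in the chart around `p`. -/
def chartVF (p : M) (V : ∀ x : M, TangentSpace (𝓡 m) x) (y : EuclideanSpace ℝ (Fin m)) :
    EuclideanSpace ℝ (Fin m) :=
  chartDeriv p y (V ((extChartAt (𝓡 m) p).symm y))

/-- Lets `ContinuousLinearMap.inverse` in `chartDeriv` be a genuine inverse. -/
theorem isInvertible_mfderiv_symm (p : M) {y : EuclideanSpace ℝ (Fin m)}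
    (hy : y ∈ (extChartAt (𝓡 m) p).target) :
    (mfderiv (𝓡 m) (𝓡 m) (extChartAt (𝓡 m) p).symm y).IsInvertible := by
  have : IsManifold (𝓡 m) 1 M := .of_le (n := ∞) (by simp)
  have h := isInvertible_mfderivWithin_extChartAt_symm (I := 𝓡 m) hy
  rwa [(𝓡 m).range_eq_univ, mfderivWithin_univ] at h

theorem isInvertible_chartDeriv (p : M) {y : EuclideanSpace ℝ (Fin m)}
    (hy : y ∈ (extChartAt (𝓡 m) p).target) : (chartDeriv p y).IsInvertible :=
  ContinuousLinearMap.isInvertible_inverse_iff.2 (isInvertible_mfderiv_symm p hy)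

theorem contMDiffAt_extChartAt_symm (p : M) {y : EuclideanSpace ℝ (Fin m)}
    (hy : y ∈ (extChartAt (𝓡 m) p).target) :
    ContMDiffAt (𝓡 m) (𝓡 m) ∞ (extChartAt (𝓡 m) p).symm y :=
  (contMDiffOn_extChartAt_symm p).contMDiffAt ((isOpen_extChartAt_target p).mem_nhds hy)

theorem chartVF_contDiffAt (p : M) {V : ∀ x : M, TangentSpace (𝓡 m) x}
    {y : EuclideanSpace ℝ (Fin m)} (hy : y ∈ (extChartAt (𝓡 m) p).target)
    (hV : ContMDiffAt (𝓡 m) (𝓡 m).tangent ∞ (fun x => (⟨x, V x⟩ : TangentBundle (𝓡 m) M))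
      ((extChartAt (𝓡 m) p).symm y)) : ContDiffAt ℝ ∞ (chartVF p V) y :=
  contMDiffAt_vectorSpace_iff_contDiffAt.1
    (hV.mpullback_vectorField_preimage (contMDiffAt_extChartAt_symm p hy)
      (isInvertible_mfderiv_symm p hy) (by simp))

theorem chartVF_mlieBracket (p : M) {V W : ∀ x : M, TangentSpace (𝓡 m) x}
    {y : EuclideanSpace ℝ (Fin m)} (hy : y ∈ (extChartAt (𝓡 m) p).target)
    (hV : ContMDiffAt (𝓡 m) (𝓡 m).tangent ∞ (fun x => (⟨x, V x⟩ : TangentBundle (𝓡 m) M))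
      ((extChartAt (𝓡 m) p).symm y))
    (hW : ContMDiffAt (𝓡 m) (𝓡 m).tangent ∞ (fun x => (⟨x, W x⟩ : TangentBundle (𝓡 m) M))
      ((extChartAt (𝓡 m) p).symm y)) :
    chartVF p (mlieBracket (𝓡 m) V W) y =
      fderiv ℝ (chartVF p W) y (chartVF p V y) - fderiv ℝ (chartVF p V) y (chartVF p W y) := by
  have : IsManifold (𝓡 m) (minSmoothness ℝ 3) M :=
    .of_le (n := ∞) (by simpa using WithTop.coe_le_coe.2 (le_top : (3 : ℕ∞) ≤ ⊤))
  have h := mpullback_mlieBracket (𝕜 := ℝ) (I := 𝓡 m) (n := ∞)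
    (hV.mdifferentiableAt (by simp)) (hW.mdifferentiableAt (by simp))
    (contMDiffAt_extChartAt_symm p hy)
    (by simpa using WithTop.coe_le_coe.2 (le_top : (2 : ℕ∞) ≤ ⊤))
  refine h.trans ?_
  rw [← mlieBracketWithin_univ, mlieBracketWithin_eq_lieBracketWithin]
  change lieBracketWithin ℝ (chartVF p V) (chartVF p W) Set.univ y = _
  rw [lieBracketWithin_univ]
  rfl

theorem mfderiv_eq_fderiv_chart {F : Type*} [NormedAddCommGroup F] [NormedSpace ℝ F] (p : M)
    {f : M → F} {y : EuclideanSpace ℝ (Fin m)} (hy : y ∈ (extChartAt (𝓡 m) p).target)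
    (hf : MDifferentiableAt (𝓡 m) 𝓘(ℝ, F) f ((extChartAt (𝓡 m) p).symm y))
    (u : TangentSpace (𝓡 m) ((extChartAt (𝓡 m) p).symm y)) :
    mfderiv (𝓡 m) 𝓘(ℝ, F) f ((extChartAt (𝓡 m) p).symm y) u =
      fderiv ℝ (fun z => f ((extChartAt (𝓡 m) p).symm z)) y (chartDeriv p y u) := by
  have h := mfderiv_comp y hf ((contMDiffAt_extChartAt_symm p hy).mdifferentiableAt (by simp))
  rw [mfderiv_eq_fderiv] at h
  change _ = fderiv ℝ (f ∘ (extChartAt (𝓡 m) p).symm) y _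
  rw [h]
  obtain ⟨A, hA⟩ := isInvertible_mfderiv_symm p hy
  rw [chartDeriv, ← hA]
  refine congrArg (mfderiv (𝓡 m) 𝓘(ℝ, F) f _) ?_
  rw [ContinuousLinearMap.inverse_equiv]
  exact (A.apply_symm_apply u).symm

/-- The vector field on the domain of the chart around `p` that is constant in this chart. -/
def constVF (p : M) (w : EuclideanSpace ℝ (Fin m)) (x : M) : TangentSpace (𝓡 m) x :=
  (mfderiv (𝓡 m) (𝓡 m) (extChartAt (𝓡 m) p) x).inverse w

theorem constVF_contMDiffOn (p : M) (w : EuclideanSpace ℝ (Fin m)) :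
    ContMDiffOn (𝓡 m) (𝓡 m).tangent ∞
      (fun x => (⟨x, constVF p w x⟩ : TangentBundle (𝓡 m) M)) (extChartAt (𝓡 m) p).source := by
  have : IsManifold (𝓡 m) 1 M := .of_le (n := ∞) (by simp)
  intro x hx
  refine ContMDiffAt.contMDiffWithinAt ?_
  have hc : ContMDiffAt (𝓡 m) (𝓡 m).tangent ∞ (fun y => (⟨y, w⟩ :
      TangentBundle (𝓡 m) (EuclideanSpace ℝ (Fin m)))) (extChartAt (𝓡 m) p x) :=
    contMDiffAt_vectorSpace_iff_contDiffAt.2 (contDiffAt_const (c := w))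
  exact hc.mpullback_vectorField_preimage
    (contMDiffAt_extChartAt' (n := ∞) (by rwa [← extChartAt_source (𝓡 m)]))
    (isInvertible_mfderiv_extChartAt hx) (n := ∞) (by simp)

theorem exists_constVF_eq (p : M) {x : M} (hx : x ∈ (extChartAt (𝓡 m) p).source)
    (u : TangentSpace (𝓡 m) x) : ∃ w, constVF p w x = u := by
  have : IsManifold (𝓡 m) 1 M := .of_le (n := ∞) (by simp)
  obtain ⟨A, hA⟩ := isInvertible_mfderiv_extChartAt (I := 𝓡 m) hx
  refine ⟨A u, ?_⟩
  change (mfderiv (𝓡 m) (𝓡 m) (extChartAt (𝓡 m) p) x).inverse (A u) = u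
  rw [← hA, ContinuousLinearMap.inverse_equiv]
  exact A.symm_apply_apply u

end Chart

/-! ### The divergence theorem on a compact manifold -/

section Divergence

open MeasureTheory

theorem contDiff_of_contDiffOn_of_eq_zero {E F : Type*} [NormedAddCommGroup E] [NormedSpace ℝ E]
    [NormedAddCommGroup F] [NormedSpace ℝ F] {f : E → F} {k : WithTop ℕ∞} {T K : Set E}
    (hT : IsOpen T) (hK : IsClosed K) (hKT : K ⊆ T) (hf : ContDiffOn ℝ k f T)
    (h0 : ∀ y ∉ K, f y = 0) : ContDiff ℝ k f := by
  rw [contDiff_iff_contDiffAt]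
  intro y
  by_cases hy : y ∈ K
  · exact hf.contDiffAt (hT.mem_nhds (hKT hy))
  · refine (contDiffAt_const (c := (0 : F))).congr_of_eventuallyEq ?_
    filter_upwards [hK.isOpen_compl.mem_nhds hy] with z hz using h0 z hz

theorem continuous_of_continuousOn_of_eq_zero {E F : Type*} [TopologicalSpace E]
    [TopologicalSpace F] [Zero F] {f : E → F} {T K : Set E}
    (hT : IsOpen T) (hK : IsClosed K) (hKT : K ⊆ T) (hf : ContinuousOn f T)
    (h0 : ∀ y ∉ K, f y = 0) : Continuous f := by
  rw [continuous_iff_continuousAt]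
  intro y
  by_cases hy : y ∈ K
  · exact hf.continuousAt (hT.mem_nhds (hKT hy))
  · refine (continuousAt_const (y := (0 : F))).congr ?_
    filter_upwards [hK.isOpen_compl.mem_nhds hy] with z hz using (h0 z hz).symm

variable {m : ℕ}

local notation "𝔼" => EuclideanSpace ℝ (Fin m)

theorem integrable_of_continuousOn_of_eq_zero {f : 𝔼 → ℝ} {T K : Set 𝔼}
    (hT : IsOpen T) (hK : IsCompact K) (hKT : K ⊆ T) (hf : ContinuousOn f T)
    (h0 : ∀ y ∉ K, f y = 0) : Integrable f :=
  (continuous_of_continuousOn_of_eq_zero hT hK.isClosed hKT hf h0).integrable_of_hasCompactSupport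
    (HasCompactSupport.intro hK h0)

theorem integral_fderiv_eq_zero {f : 𝔼 → ℝ} (hf : ContDiff ℝ 1 f) (hc : HasCompactSupport f)
    (e : 𝔼) : ∫ y, fderiv ℝ f y e = 0 := by
  have hd : Integrable fun y => fderiv ℝ f y e :=
    ((hf.continuous_fderiv (by simp)).clm_apply continuous_const).integrable_of_hasCompactSupport
      (hc.fderiv_apply ℝ e)
  have h := integral_mul_fderiv_eq_neg_fderiv_mul_of_integrable (μ := volume)
    (f := fun _ : 𝔼 => (1 : ℝ)) (g := f) (v := e) (by simp) (by simpa using hd)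
    (by simpa using hf.continuous.integrable_of_hasCompactSupport hc)
    (fun _ _ => differentiableAt_const _) (fun y _ => hf.differentiable (by simp) y)
  simpa using h

/-- The divergence of a vector field on `ℝᵐ`. -/
def euclideanDiv (v : 𝔼 → 𝔼) (y : 𝔼) : ℝ := ∑ k, fderiv ℝ v y (EuclideanSpace.single k 1) k

theorem continuousOn_euclideanDiv {v : 𝔼 → 𝔼} {T : Set 𝔼} (hT : IsOpen T)
    (hv : ContDiffOn ℝ 1 v T) : ContinuousOn (euclideanDiv v) T := by
  refine continuousOn_finsetSum _ fun k _ => ?_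
  exact (EuclideanSpace.proj (𝕜 := ℝ) k).continuous.comp_continuousOn
    ((hv.continuousOn_fderiv_of_isOpen hT (by simp)).clm_apply continuousOn_const)

/-- Integration by parts against a compactly supported function. -/
theorem integral_mul_euclideanDiv {b : 𝔼 → ℝ} {v : 𝔼 → 𝔼} {T K : Set 𝔼} (hT : IsOpen T)
    (hK : IsCompact K) (hKT : K ⊆ T) (hb : ContDiffOn ℝ 1 b T) (hv : ContDiffOn ℝ 1 v T)
    (h0 : ∀ y ∉ K, b y = 0) :
    ∫ y, b y * euclideanDiv v y = -∫ y, fderiv ℝ b y (v y) := by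
  have hbd : ContDiff ℝ 1 b := contDiff_of_contDiffOn_of_eq_zero hT hK.isClosed hKT hb h0
  have hb0 : ∀ y ∉ K, fderiv ℝ b y = 0 := fun y hy => by
    have : b =ᶠ[nhds y] fun _ => 0 := by
      filter_upwards [hK.isClosed.isOpen_compl.mem_nhds hy] with z hz using h0 z hz
    rw [this.fderiv_eq]; simp
  have hvk : ∀ k, ContDiffOn ℝ 1 (fun y => v y k) T := fun k =>
    (EuclideanSpace.proj (𝕜 := ℝ) k).contDiff.comp_contDiffOn hv
  have hu : ∀ k, ContDiff ℝ 1 fun y => b y * v y k := fun k =>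
    contDiff_of_contDiffOn_of_eq_zero hT hK.isClosed hKT (hb.mul (hvk k)) fun y hy => by
      simp [h0 y hy]
  have hu0 : ∀ k, HasCompactSupport fun y => b y * v y k := fun k =>
    HasCompactSupport.intro hK fun y hy => by simp [h0 y hy]
  have hprod : ∀ k y, fderiv ℝ (fun y => b y * v y k) y (EuclideanSpace.single k 1) =
      b y * fderiv ℝ v y (EuclideanSpace.single k 1) k +
        v y k * fderiv ℝ b y (EuclideanSpace.single k 1) := fun k y => by
    by_cases hy : y ∈ K
    · have hvy : DifferentiableAt ℝ v y :=
        (hv.contDiffAt (hT.mem_nhds (hKT hy))).differentiableAt (by simp)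
      have h1 : HasFDerivAt (fun y => v y k) _ y :=
        (EuclideanSpace.proj (𝕜 := ℝ) k).hasFDerivAt.comp y hvy.hasFDerivAt
      have h2 : HasFDerivAt (fun y => b y * v y k) _ y :=
        (hbd.differentiable (by simp) y).hasFDerivAt.mul h1
      rw [h2.fderiv]
      simp
    · have : (fun y => b y * v y k) =ᶠ[nhds y] fun _ => 0 := by
        filter_upwards [hK.isClosed.isOpen_compl.mem_nhds hy] with z hz
        simp [h0 z hz]
      rw [this.fderiv_eq, h0 y hy, hb0 y hy]
      simp
  have hi1 : ∀ k, Integrable fun y => b y * fderiv ℝ v y (EuclideanSpace.single k 1) k := fun k =>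
    integrable_of_continuousOn_of_eq_zero hT hK hKT (hb.continuousOn.mul
      ((EuclideanSpace.proj (𝕜 := ℝ) k).continuous.comp_continuousOn
      ((hv.continuousOn_fderiv_of_isOpen hT (by simp)).clm_apply continuousOn_const)))
      fun y hy => by simp [h0 y hy]
  have hi2 : ∀ k, Integrable fun y => v y k * fderiv ℝ b y (EuclideanSpace.single k 1) := fun k =>
    integrable_of_continuousOn_of_eq_zero hT hK hKT ((hvk k).continuousOn.mul
      (((hbd.continuous_fderiv (by simp)).clm_apply continuous_const).continuousOn))
      fun y hy => by simp [hb0 y hy]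
  have hk : ∀ k, ∫ y, b y * fderiv ℝ v y (EuclideanSpace.single k 1) k =
      -∫ y, v y k * fderiv ℝ b y (EuclideanSpace.single k 1) := fun k => by
    have h1 := integral_fderiv_eq_zero (hu k) (hu0 k) (EuclideanSpace.single k 1)
    simp only [hprod] at h1
    rw [integral_add (hi1 k) (hi2 k)] at h1
    linarith
  have hsum : ∀ y, fderiv ℝ b y (v y) = ∑ k, v y k * fderiv ℝ b y (EuclideanSpace.single k 1) :=
    fun y => by
      conv_lhs => rw [← (EuclideanSpace.basisFun (Fin m) ℝ).sum_repr (v y)]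
      simp
  simp only [euclideanDiv, Finset.mul_sum, hsum]
  rw [integral_finsetSum _ fun k _ => hi1 k, integral_finsetSum _ fun k _ => hi2 k,
    ← Finset.sum_neg_distrib]
  exact Finset.sum_congr rfl fun k _ => hk k

section Manifold

variable {M : Type*} [TopologicalSpace M] [ChartedSpace (EuclideanSpace ℝ (Fin m)) M]

local notation "φ" => extChartAt (𝓡 m)

/-- The function `u` in the chart around `p`, extended by zero. -/
def chartRep (p : M) (u : M → ℝ) : 𝔼 → ℝ := (φ p).target.indicator fun y => u ((φ p).symm y)

theorem chartRep_of_mem (p : M) (u : M → ℝ) {y : 𝔼} (hy : y ∈ (φ p).target) :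
    chartRep p u y = u ((φ p).symm y) := Set.indicator_of_mem hy _

theorem chartRep_eq_zero {p : M} {u : M → ℝ} {y : 𝔼} (hy : y ∉ φ p '' tsupport u) :
    chartRep p u y = 0 := by
  by_cases hyt : y ∈ (φ p).target
  · rw [chartRep_of_mem p u hyt]
    refine image_eq_zero_of_notMem_tsupport fun h => hy ⟨_, h, (φ p).right_inv hyt⟩
  · exact Set.indicator_of_notMem hyt _

theorem fderiv_chartRep_eq_zero {p : M} {u : M → ℝ} {y : 𝔼} (hy : (φ p).symm y ∉ tsupport u)
    (hyt : y ∈ (φ p).target) : fderiv ℝ (chartRep p u) y = 0 := by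
  have h1 : chartRep p u =ᶠ[nhds y] fun _ => 0 := by
    filter_upwards [(isOpen_extChartAt_target p).mem_nhds hyt,
      ((continuousAt_extChartAt_symm'' hyt).preimage_mem_nhds
        ((isClosed_tsupport u).isOpen_compl.mem_nhds hy))] with z hz hz'
    rw [chartRep_of_mem p u hz]
    exact image_eq_zero_of_notMem_tsupport hz'
  rw [h1.fderiv_eq]
  simp

theorem image_tsupport_subset {p : M} {u : M → ℝ} (hu : tsupport u ⊆ (φ p).source) :
    φ p '' tsupport u ⊆ (φ p).target := by
  rintro _ ⟨x, hx, rfl⟩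
  exact (φ p).map_source (hu hx)

theorem isCompact_image_tsupport [CompactSpace M] {p : M} {u : M → ℝ}
    (hu : tsupport u ⊆ (φ p).source) : IsCompact (φ p '' tsupport u) :=
  (isClosed_tsupport u).isCompact.image_of_continuousOn ((continuousOn_extChartAt p).mono hu)

variable [IsManifold (𝓡 m) ∞ M]

theorem contDiffOn_chartRep (p : M) {u : M → ℝ} (hu : ContMDiff (𝓡 m) 𝓘(ℝ, ℝ) ∞ u) :
    ContDiffOn ℝ ∞ (chartRep p u) (φ p).target := by
  have h1 : ContMDiffOn (𝓡 m) 𝓘(ℝ, ℝ) ∞ (fun y => u ((φ p).symm y)) (φ p).target :=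
    hu.comp_contMDiffOn (contMDiffOn_extChartAt_symm p)
  exact (contMDiffOn_iff_contDiffOn.1 h1).congr fun y hy => chartRep_of_mem p u hy

theorem contDiffAt_coordChange (p q : M) {y : 𝔼} (hy : y ∈ (φ p).target)
    (hyq : (φ p).symm y ∈ (φ q).source) : ContDiffAt ℝ ∞ (φ q ∘ (φ p).symm) y := by
  have h1 : ContMDiffAt (𝓡 m) (𝓡 m) ∞ (φ q ∘ (φ p).symm) y :=
    (contMDiffAt_extChartAt' (by rwa [← extChartAt_source (𝓡 m)])).comp y
      (contMDiffAt_extChartAt_symm p hy)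
  exact contMDiffAt_iff_contDiffAt.1 h1

/-- `W` is a vector density (a vector field times a positive density): `W p` is its expression in
the chart around `p`, and a change of coordinates `ψ` transforms it by `Dψ / |det Dψ|`. -/
def IsVectorDensity (W : M → 𝔼 → 𝔼) : Prop :=
  ∀ (p q : M) (y : 𝔼), y ∈ (φ p).target → (φ p).symm y ∈ (φ q).source →
    fderiv ℝ (φ q ∘ (φ p).symm) y (W p y) =
      |(fderiv ℝ (φ q ∘ (φ p).symm) y).det| • W q (φ q ((φ p).symm y))

/-- The integral of `w du(W)` is the same in the charts around `p` and `q`, by the change of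
variables formula: both integrands vanish outside the intersection of the two chart domains. -/
theorem integral_chartRep_eq {W : M → 𝔼 → 𝔼} (hW : IsVectorDensity W) {p q : M} {u w : M → ℝ}
    (hu : ContMDiff (𝓡 m) 𝓘(ℝ, ℝ) ∞ u) (hup : tsupport u ⊆ (φ p).source)
    (hwq : tsupport w ⊆ (φ q).source) :
    ∫ y, chartRep p w y * fderiv ℝ (chartRep p u) y (W p y) =
      ∫ y, chartRep q w y * fderiv ℝ (chartRep q u) y (W q y) := by
  set A : M → M → Set 𝔼 := fun p q => (φ p).target ∩ (φ p).symm ⁻¹' (φ q).source with hA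
  have hAo : ∀ p q, IsOpen (A p q) := fun p q =>
    (continuousOn_extChartAt_symm p).isOpen_inter_preimage (isOpen_extChartAt_target p)
      (isOpen_extChartAt_source q)
  set ψ := φ q ∘ (φ p).symm with hψ
  have himg : ψ '' A p q = A q p := by
    ext z
    constructor
    · rintro ⟨y, hy, rfl⟩
      refine ⟨(φ q).map_source hy.2, ?_⟩
      rw [Set.mem_preimage, hψ, Function.comp_apply, (φ q).left_inv hy.2]
      exact (φ p).map_target hy.1
    · intro hz
      refine ⟨φ p ((φ q).symm z), ⟨(φ p).map_source hz.2, ?_⟩, ?_⟩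
      · rw [Set.mem_preimage, (φ p).left_inv hz.2]
        exact (φ q).map_target hz.1
      · rw [hψ, Function.comp_apply, (φ p).left_inv hz.2, (φ q).right_inv hz.1]
  have hinj : Set.InjOn ψ (A p q) := fun y hy z hz h => by
    have h1 := (φ q).injOn hy.2 hz.2 h
    exact (φ p).symm.injOn hy.1 hz.1 h1
  have hd : ∀ y ∈ A p q, HasFDerivAt ψ (fderiv ℝ ψ y) y := fun y hy =>
    ((contDiffAt_coordChange p q hy.1 hy.2).differentiableAt (by simp)).hasFDerivAt
  have hl : ∀ y, y ∉ A p q → chartRep p w y * fderiv ℝ (chartRep p u) y (W p y) = 0 := by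
    intro y hy
    by_cases hyt : y ∈ (φ p).target
    · have : (φ p).symm y ∉ tsupport w := fun h => hy ⟨hyt, hwq h⟩
      rw [chartRep_of_mem p w hyt, image_eq_zero_of_notMem_tsupport this, zero_mul]
    · rw [chartRep, Set.indicator_of_notMem hyt, zero_mul]
  have hr : ∀ y, y ∉ A q p → chartRep q w y * fderiv ℝ (chartRep q u) y (W q y) = 0 := by
    intro y hy
    by_cases hyt : y ∈ (φ q).target
    · rw [fderiv_chartRep_eq_zero (fun h => hy ⟨hyt, hup h⟩) hyt]
      simp
    · rw [chartRep, Set.indicator_of_notMem hyt, zero_mul]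
  rw [← setIntegral_eq_integral_of_forall_compl_eq_zero hl,
    ← setIntegral_eq_integral_of_forall_compl_eq_zero hr, ← himg,
    integral_image_eq_integral_abs_det_fderiv_smul volume (hAo p q).measurableSet
      (fun y hy => (hd y hy).hasFDerivWithinAt) hinj]
  refine setIntegral_congr_fun (hAo p q).measurableSet fun y hy => ?_
  have hq : ψ y ∈ (φ q).target := (φ q).map_source hy.2
  have hwy : chartRep q w (ψ y) = chartRep p w y := by
    rw [chartRep_of_mem p w hy.1, chartRep_of_mem q w hq, hψ, Function.comp_apply,
      (φ q).left_inv hy.2]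
  have huy : chartRep p u =ᶠ[nhds y] chartRep q u ∘ ψ := by
    filter_upwards [(hAo p q).mem_nhds hy] with z hz
    have hqz : ψ z ∈ (φ q).target := (φ q).map_source hz.2
    rw [Function.comp_apply, chartRep_of_mem p u hz.1, chartRep_of_mem q u hqz, hψ, Function.comp_apply, (φ q).left_inv hz.2]
  have hdu : DifferentiableAt ℝ (chartRep q u) (ψ y) :=
    ((contDiffOn_chartRep q hu).contDiffAt
      ((isOpen_extChartAt_target q).mem_nhds hq)).differentiableAt (by simp)
  have h1 := hW p q y hy.1 hy.2
  change _ = _ • (chartRep q w (ψ y) * _)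
  rw [huy.fderiv_eq, fderiv_comp y hdu (hd y hy).differentiableAt, hwy,
    ContinuousLinearMap.comp_apply, h1, map_smul, smul_eq_mul, smul_eq_mul]
  exact mul_left_comm _ _ _

/-- The divergence theorem: on a compact manifold the divergence of a vector density cannot be
negative everywhere. -/
theorem IsVectorDensity.exists_euclideanDiv_nonneg [CompactSpace M] [T2Space M] [Nonempty M]
    {W : M → 𝔼 → 𝔼} (hW : IsVectorDensity W) (hs : ∀ p, ContDiffOn ℝ 1 (W p) (φ p).target) :
    ∃ p, ∃ y ∈ (φ p).target, 0 ≤ euclideanDiv (W p) y := by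
  by_contra! hneg
  obtain ⟨ρ, hρ⟩ := SmoothPartitionOfUnity.exists_isSubordinate_chartAt_source (𝓡 m) M
  have hsub : ∀ p, tsupport (ρ p) ⊆ (φ p).source := fun p => by
    rw [extChartAt_source]; exact hρ p
  have hρs : ∀ p, ContMDiff (𝓡 m) 𝓘(ℝ, ℝ) ∞ (ρ p) := fun p => (ρ p).contMDiff
  set s := ρ.locallyFinite.finite_nonempty_of_compact.toFinset with hs'
  have hsum : ∀ x, ∑ p ∈ s, ρ p x = 1 := fun x => by
    rw [← ρ.sum_eq_one (Set.mem_univ x)]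
    refine (finsum_eq_sum_of_support_subset _ fun p hp => ?_).symm
    simp only [hs', Set.Finite.coe_toFinset, Set.mem_ofPred_eq]
    exact ⟨x, hp⟩
  have ho := fun p : M => isOpen_extChartAt_target (I := 𝓡 m) p
  have hK := fun p => isCompact_image_tsupport (hsub p)
  have hKT := fun p => image_tsupport_subset (hsub p)
  have hz : ∀ p, ∀ y ∉ φ p '' tsupport (ρ p), chartRep p (ρ p) y = 0 :=
    fun p y hy => chartRep_eq_zero hy
  have hc := fun p q : M => contDiffOn_chartRep p (hρs q)
  have hfc : ∀ p q : M, ContinuousOn (fun y => fderiv ℝ (chartRep p (ρ q)) y (W p y))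
      (φ p).target := fun p q =>
    ((hc p q).continuousOn_fderiv_of_isOpen (ho p) (by simp)).clm_apply (hs p).continuousOn
  have hfz : ∀ p, ∀ y ∉ φ p '' tsupport (ρ p), fderiv ℝ (chartRep p (ρ p)) y = 0 := by
    intro p y hy
    have : chartRep p (ρ p) =ᶠ[nhds y] fun _ => 0 := by
      filter_upwards [(hK p).isClosed.isOpen_compl.mem_nhds hy] with z hz' using hz p z hz'
    rw [this.fderiv_eq]; simp
  -- the integrals of `dρ_p(W)` are split by `1 = ∑ ρ_q` and moved to the chart around `q`, where
  -- they cancel because `∑ dρ_p = d1 = 0`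
  have hone : ∀ p, ∀ y ∈ (φ p).target, ∑ q ∈ s, chartRep p (ρ q) y = 1 := fun p y hy => by
    simp only [chartRep_of_mem p _ hy, hsum]
  have hsplit : ∀ p, ∫ y, fderiv ℝ (chartRep p (ρ p)) y (W p y) =
      ∑ q ∈ s, ∫ y, chartRep p (ρ q) y * fderiv ℝ (chartRep p (ρ p)) y (W p y) := fun p => by
    rw [← integral_finsetSum]
    · refine integral_congr_ae (Filter.Eventually.of_forall fun y => ?_)
      simp only [← Finset.sum_mul]
      by_cases hy : y ∈ (φ p).target
      · rw [hone p y hy, one_mul]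
      · rw [hfz p y fun h => hy (hKT p h)]; simp
    · intro q _
      exact integrable_of_continuousOn_of_eq_zero (ho p) (hK p) (hKT p)
        ((hc p q).continuousOn.mul (hfc p p)) fun y hy => by simp [hfz p y hy]
  have hzero : ∑ p ∈ s, ∫ y, fderiv ℝ (chartRep p (ρ p)) y (W p y) = 0 := by
    simp only [hsplit]
    rw [Finset.sum_comm]
    refine Finset.sum_eq_zero fun q _ => ?_
    have h1 : ∀ p ∈ s, ∫ y, chartRep p (ρ q) y * fderiv ℝ (chartRep p (ρ p)) y (W p y) =
        ∫ y, chartRep q (ρ q) y * fderiv ℝ (chartRep q (ρ p)) y (W q y) := fun p _ =>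
      integral_chartRep_eq hW (hρs p) (hsub p) (hsub q)
    rw [Finset.sum_congr rfl h1, ← integral_finsetSum]
    · refine integral_eq_zero_of_ae (Filter.Eventually.of_forall fun y => ?_)
      change ∑ p ∈ s, _ = (0 : ℝ)
      rw [← Finset.mul_sum]
      by_cases hy : y ∈ (φ q).target
      · have h2 : (fun y => ∑ p ∈ s, chartRep q (ρ p) y) =ᶠ[nhds y] fun _ => 1 := by
          filter_upwards [(ho q).mem_nhds hy] with z hz' using hone q z hz'
        have h3 : fderiv ℝ (fun y => ∑ p ∈ s, chartRep q (ρ p) y) y =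
            ∑ p ∈ s, fderiv ℝ (chartRep q (ρ p)) y :=
          fderiv_fun_sum fun p _ => ((hc q p).contDiffAt
            ((ho q).mem_nhds hy)).differentiableAt (by simp)
        rw [← sum_apply, ← h3, h2.fderiv_eq]
        simp
      · rw [hz q y fun h => hy (hKT q h), zero_mul]
    · intro p _
      exact integrable_of_continuousOn_of_eq_zero (ho q) (hK q) (hKT q)
        ((hc q q).continuousOn.mul (hfc q p)) fun y hy => by simp [hz q y hy]
  have hparts : ∀ p, ∫ y, chartRep p (ρ p) y * euclideanDiv (W p) y =
      -∫ y, fderiv ℝ (chartRep p (ρ p)) y (W p y) := fun p =>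
    integral_mul_euclideanDiv (ho p) (hK p) (hKT p) ((hc p p).of_le (by simp)) (hs p) (hz p)
  have htot : ∑ p ∈ s, ∫ y, chartRep p (ρ p) y * euclideanDiv (W p) y = 0 := by
    simp only [hparts, Finset.sum_neg_distrib, hzero, neg_zero]
  -- but each of the integrals is at most zero, and one of them is negative
  have hcont : ∀ p, Continuous fun y => chartRep p (ρ p) y * -euclideanDiv (W p) y := fun p =>
    continuous_of_continuousOn_of_eq_zero (ho p) (hK p).isClosed (hKT p)
      ((hc p p).continuousOn.mul (continuousOn_euclideanDiv (ho p) (hs p)).neg)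
      fun y hy => by simp [hz p y hy]
  have hnn : ∀ p, 0 ≤ fun y => chartRep p (ρ p) y * -euclideanDiv (W p) y := fun p y => by
    by_cases hy : y ∈ (φ p).target
    · refine mul_nonneg ?_ (neg_nonneg.2 (hneg p y hy).le)
      rw [chartRep_of_mem p _ hy]
      exact ρ.nonneg p _
    · change 0 ≤ chartRep p (ρ p) y * _
      rw [hz p y fun h => hy (hKT p h), zero_mul]
  obtain ⟨x⟩ := ‹Nonempty M›
  obtain ⟨p, hp⟩ := ρ.exists_pos_of_mem (Set.mem_univ x)
  have hps : p ∈ s := by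
    simp only [hs', Set.Finite.mem_toFinset, Set.mem_ofPred_eq]
    exact ⟨x, hp.ne'⟩
  have hxs : x ∈ (φ p).source := hsub p (subset_tsupport _ hp.ne')
  have hpos : 0 < ∫ y, chartRep p (ρ p) y * -euclideanDiv (W p) y := by
    refine (hcont p).integral_pos_of_hasCompactSupport_nonneg_nonzero
      (HasCompactSupport.intro (hK p) fun y hy => by simp [hz p y hy]) (hnn p)
      (x := φ p x) ?_
    have hxt := (φ p).map_source hxs
    rw [chartRep_of_mem p _ hxt, (φ p).left_inv hxs]
    exact mul_ne_zero hp.ne' (neg_ne_zero.2 (hneg p _ hxt).ne)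
  have hlt : 0 < ∑ p ∈ s, ∫ y, chartRep p (ρ p) y * -euclideanDiv (W p) y :=
    Finset.sum_pos' (fun p _ => integral_nonneg (hnn p)) ⟨p, hps, hpos⟩
  simp only [mul_neg, integral_neg, Finset.sum_neg_distrib, htot, neg_zero] at hlt
  exact lt_irrefl _ hlt

end Manifold

end Divergence

/-! ### Complex vector fields in a chart -/

namespace CRGeometry

open VectorField
open TopologicalSpace (Opens)
open scoped ComplexOrder Matrix

section Complexification

variable {F : Type*} [AddCommGroup F] [Module ℝ F]

theorem rePart_smul (c : ℂ) (z : ℂ ⊗[ℝ] F) :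
    rePart (c • z) = c.re • rePart z - c.im • imPart z := by
  induction z with
  | zero => simp
  | tmul a u => simp [rePart, imPart, TensorProduct.smul_tmul', sub_smul, mul_smul]
  | add x y hx hy => simp only [smul_add, map_add, hx, hy]; abel

theorem imPart_smul (c : ℂ) (z : ℂ ⊗[ℝ] F) :
    imPart (c • z) = c.re • imPart z + c.im • rePart z := by
  induction z with
  | zero => simp
  | tmul a u => simp [rePart, imPart, TensorProduct.smul_tmul', add_smul, mul_smul]
  | add x y hx hy => simp only [smul_add, map_add, hx, hy]; abel

theorem rePart_conjC (z : ℂ ⊗[ℝ] F) : rePart (conjC z) = rePart z := by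
  rw [← ofReIm_rePart_imPart z, conjC_ofReIm, rePart_ofReIm, rePart_ofReIm]

theorem imPart_conjC (z : ℂ ⊗[ℝ] F) : imPart (conjC z) = -imPart z := by
  rw [← ofReIm_rePart_imPart z, conjC_ofReIm, imPart_ofReIm, imPart_ofReIm]

theorem complexVector_ext {z w : ℂ ⊗[ℝ] F} (hr : rePart z = rePart w)
    (hi : imPart z = imPart w) : z = w := by
  rw [← ofReIm_rePart_imPart z, ← ofReIm_rePart_imPart w, hr, hi]

theorem conjC_ofReal (u : F) : conjC (ofReIm u 0) = ofReIm u 0 := by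
  rw [conjC_ofReIm, neg_zero]

theorem ofReIm_eq (u v : F) : ofReIm u v = ofReIm u 0 + Complex.I • ofReIm v 0 := by
  simp [ofReIm, TensorProduct.smul_tmul']

theorem ofReIm_smul (r : ℝ) (u : F) : ofReIm (r • u) 0 = (r : ℂ) • ofReIm u 0 := by
  refine complexVector_ext ?_ ?_
  · rw [rePart_smul, rePart_ofReIm, rePart_ofReIm, imPart_ofReIm]; simp
  · rw [imPart_smul, rePart_ofReIm, imPart_ofReIm, imPart_ofReIm]; simp

/-- The components of the complexification of a real linear map with values in `ℝᵐ`. -/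
def complexify {m : ℕ} (L : F →ₗ[ℝ] EuclideanSpace ℝ (Fin m)) : ℂ ⊗[ℝ] F →ₗ[ℂ] Fin m → ℂ where
  toFun z k := (L (rePart z) k : ℂ) + Complex.I * (L (imPart z) k : ℂ)
  map_add' z w := by
    ext k
    simp
    ring
  map_smul' c z := by
    ext k
    simp [rePart_smul, imPart_smul]
    nth_rewrite 5 [← Complex.re_add_im c]
    linear_combination (-(L (imPart z) k : ℂ) * c.im) * Complex.I_mul_I

theorem complexify_apply {m : ℕ} (L : F →ₗ[ℝ] EuclideanSpace ℝ (Fin m)) (z : ℂ ⊗[ℝ] F)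
    (k : Fin m) :
    complexify L z k = (L (rePart z) k : ℂ) + Complex.I * (L (imPart z) k : ℂ) := rfl

theorem complexify_conjC {m : ℕ} (L : F →ₗ[ℝ] EuclideanSpace ℝ (Fin m)) (z : ℂ ⊗[ℝ] F)
    (k : Fin m) : complexify L (conjC z) k = starRingEnd ℂ (complexify L z k) := by
  simp [complexify_apply, rePart_conjC, imPart_conjC]

theorem complexify_injective {m : ℕ} {L : F →ₗ[ℝ] EuclideanSpace ℝ (Fin m)}
    (hL : Function.Injective L) : Function.Injective (complexify L) := by
  intro z w h
  have key : ∀ k, L (rePart z) k = L (rePart w) k ∧ L (imPart z) k = L (imPart w) k := fun k => by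
    have := congrFun h k
    rw [complexify_apply, complexify_apply, Complex.ext_iff] at this
    simpa using this
  refine complexVector_ext (hL ?_) (hL ?_)
  · ext k; exact (key k).1
  · ext k; exact (key k).2

end Complexification

set_option linter.unusedSectionVars false

section Manifold

variable {n : ℕ} {M : Type*} [TopologicalSpace M]
  [ChartedSpace (EuclideanSpace ℝ (Fin (2 * n + 1))) M] [IsManifold (𝓡 (2 * n + 1)) ∞ M]

local notation "𝔼" => EuclideanSpace ℝ (Fin (2 * n + 1))
local notation "φ" => extChartAt (𝓡 (2 * n + 1))
local notation "ι" => (Fin n ⊕ Fin n) ⊕ Unit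

/-- The components of complex tangent vectors in the chart around `p`. -/
def chartC (p : M) (y : 𝔼) : CTangent n ((φ p).symm y) →ₗ[ℂ] Fin (2 * n + 1) → ℂ :=
  complexify (chartDeriv p y).toLinearMap

theorem chartC_apply (p : M) (y : 𝔼) (z : CTangent n ((φ p).symm y)) (k) : chartC p y z k =
    (chartDeriv p y (rePart z) k : ℂ) + Complex.I * (chartDeriv p y (imPart z) k : ℂ) := rfl

theorem chartC_conjC (p : M) (y : 𝔼) (z : CTangent n ((φ p).symm y)) (k) :
    chartC p y (conjC z) k = starRingEnd ℂ (chartC p y z k) := complexify_conjC _ _ _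

theorem chartC_injective (p : M) {y : 𝔼} (hy : y ∈ (φ p).target) :
    Function.Injective (chartC p y) := by
  refine complexify_injective ?_
  obtain ⟨A, hA⟩ := isInvertible_chartDeriv p hy
  rw [← hA]
  exact A.injective

variable (n) in
/-- The part of the domain of the chart around `p` that corresponds to `U`. -/
def chartOpens (p : M) (U : Opens M) : Opens 𝔼 where
  carrier := (φ p).target ∩ (φ p).symm ⁻¹' U
  is_open' := (continuousOn_extChartAt_symm p).isOpen_inter_preimage
    (isOpen_extChartAt_target p) U.isOpen

/-- The point of `U` with coordinates `y`. -/
abbrev pt {p : M} {U : Opens M} (y : chartOpens n p U) : M := (φ p).symm y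

theorem pt_mem {p : M} {U : Opens M} (y : chartOpens n p U) : pt y ∈ U := y.2.2

theorem SmoothOn.contMDiffAt_rePart {V : ∀ x : M, CTangent n x} {U : Opens M} (hV : SmoothOn V U)
    {x : M} (hx : x ∈ U) : ContMDiffAt (𝓡 (2 * n + 1)) (𝓡 (2 * n + 1)).tangent ∞
      (fun x => (⟨x, rePart (V x)⟩ : TangentBundle (𝓡 (2 * n + 1)) M)) x :=
  hV.1.contMDiffAt (U.isOpen.mem_nhds hx)

theorem SmoothOn.contMDiffAt_imPart {V : ∀ x : M, CTangent n x} {U : Opens M} (hV : SmoothOn V U)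
    {x : M} (hx : x ∈ U) : ContMDiffAt (𝓡 (2 * n + 1)) (𝓡 (2 * n + 1)).tangent ∞
      (fun x => (⟨x, imPart (V x)⟩ : TangentBundle (𝓡 (2 * n + 1)) M)) x :=
  hV.2.contMDiffAt (U.isOpen.mem_nhds hx)

theorem contDiffOn_chartC (p : M) {V : ∀ x : M, CTangent n x} {U : Opens M} (hV : SmoothOn V U)
    (k : Fin (2 * n + 1)) :
    ContDiffOn ℝ ∞ (fun y => chartC p y (V ((φ p).symm y)) k) (chartOpens n p U) := by
  intro y hy
  refine ContDiffAt.contDiffWithinAt ?_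
  have h1 := chartVF_contDiffAt p hy.1 (hV.contMDiffAt_rePart hy.2)
  have h2 := chartVF_contDiffAt p hy.1 (hV.contMDiffAt_imPart hy.2)
  have hk := (Complex.ofRealCLM.comp (EuclideanSpace.proj (𝕜 := ℝ) k :
    𝔼 →L[ℝ] ℝ)).contDiff (n := ∞)
  exact (hk.contDiffAt.comp y h1).add (contDiffAt_const.mul (hk.contDiffAt.comp y h2))

/-- The components of a smooth complex vector field on `U` in the chart around `p`. -/
def comp (p : M) {V : ∀ x : M, CTangent n x} {U : Opens M} (hV : SmoothOn V U)
    (k : Fin (2 * n + 1)) : SmoothFun (chartOpens n p U) :=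
  SmoothFun.mk _ (contDiffOn_chartC p hV k)

theorem comp_apply (p : M) {V : ∀ x : M, CTangent n x} {U : Opens M} (hV : SmoothOn V U)
    (k : Fin (2 * n + 1)) (y : chartOpens n p U) : comp p hV k y = chartC p y (V (pt y)) k := rfl

theorem SmoothOn.conjC {V : ∀ x : M, CTangent n x} {U : Set M} (hV : SmoothOn V U) :
    SmoothOn (fun x => CRGeometry.conjC (V x)) U := by
  refine ⟨?_, ?_⟩
  · simpa only [rePart_conjC] using hV.1
  · simp only [imPart_conjC]
    exact hV.2.neg_section

theorem SmoothOn.mono {V : ∀ x : M, CTangent n x} {U U' : Set M} (hV : SmoothOn V U)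
    (h : U' ⊆ U) : SmoothOn V U' := ⟨hV.1.mono h, hV.2.mono h⟩

theorem comp_conjC (p : M) {V : ∀ x : M, CTangent n x} {U : Opens M} (hV : SmoothOn V U)
    (k : Fin (2 * n + 1)) : comp p hV.conjC k = SmoothFun.conj (comp p hV k) := by
  ext y
  exact chartC_conjC _ _ _ _

theorem fderiv_eq_sum {F : Type*} [NormedAddCommGroup F] [NormedSpace ℝ F] {m : ℕ}
    (L : EuclideanSpace ℝ (Fin m) →L[ℝ] F) (u : EuclideanSpace ℝ (Fin m)) :
    L u = ∑ l, u l • L (EuclideanSpace.single l 1) := by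
  conv_lhs => rw [← (EuclideanSpace.basisFun (Fin m) ℝ).sum_repr u]
  simp

theorem pd_comp (p : M) {V : ∀ x : M, CTangent n x} {U : Opens M} (hV : SmoothOn V U)
    (k l : Fin (2 * n + 1)) (y : chartOpens n p U) : SmoothFun.pd l (comp p hV k) y =
      (fderiv ℝ (chartVF p fun x => rePart (V x)) y (EuclideanSpace.single l 1) k : ℂ) +
      Complex.I *
        (fderiv ℝ (chartVF p fun x => imPart (V x)) y (EuclideanSpace.single l 1) k : ℂ) := by
  have h1 := (chartVF_contDiffAt p y.2.1 (hV.contMDiffAt_rePart y.2.2)).differentiableAt (by simp)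
  have h2 := (chartVF_contDiffAt p y.2.1 (hV.contMDiffAt_imPart y.2.2)).differentiableAt (by simp)
  rw [SmoothFun.pd_apply_of_eq (f := comp p hV k)
    (F := fun y => chartC p y (V ((φ p).symm y)) k) fun y => rfl]
  have := ((Complex.ofRealCLM.comp (EuclideanSpace.proj (𝕜 := ℝ) k :
    𝔼 →L[ℝ] ℝ)).hasFDerivAt.comp (y : 𝔼) h1.hasFDerivAt).add
    (((Complex.ofRealCLM.comp (EuclideanSpace.proj (𝕜 := ℝ) k :
    𝔼 →L[ℝ] ℝ)).hasFDerivAt.comp (y : 𝔼) h2.hasFDerivAt).const_mul Complex.I)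
  exact congrArg (fun L : 𝔼 →L[ℝ] ℂ => L (EuclideanSpace.single l 1)) this.fderiv

/-- The bracket of complex vector fields in a chart. -/
theorem chartC_bracket (p : M) {V W : ∀ x : M, CTangent n x} {U : Opens M} (hV : SmoothOn V U)
    (hW : SmoothOn W U) (y : chartOpens n p U) (k : Fin (2 * n + 1)) :
    chartC p y (bracket V W (pt y)) k =
      ⁅SmoothFun.vf (comp p hV), SmoothFun.vf (comp p hW)⁆ (SmoothFun.coord k) y := by
  rw [SmoothFun.lie_vf, SmoothFun.vf_coord, SmoothFun.sub_apply, SmoothFun.vf_apply,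
    SmoothFun.vf_apply, SmoothFun.sum_apply, SmoothFun.sum_apply]
  simp only [SmoothFun.mul_apply, pd_comp, comp_apply, chartC_apply]
  have hVr := hV.contMDiffAt_rePart y.2.2
  have hVi := hV.contMDiffAt_imPart y.2.2
  have hWr := hW.contMDiffAt_rePart y.2.2
  have hWi := hW.contMDiffAt_imPart y.2.2
  have e1 := chartVF_mlieBracket p y.2.1 hVr hWr
  have e2 := chartVF_mlieBracket p y.2.1 hVi hWi
  have e3 := chartVF_mlieBracket p y.2.1 hVr hWi
  have e4 := chartVF_mlieBracket p y.2.1 hVi hWr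
  have key : ∀ (X Y : ∀ x : M, TangentSpace (𝓡 (2 * n + 1)) x),
      ((fderiv ℝ (chartVF p X) y (chartVF p Y y) k : ℝ) : ℂ) =
      ∑ l, (chartDeriv p y (Y (pt y)) l : ℂ) *
        (fderiv ℝ (chartVF p X) y (EuclideanSpace.single l 1) k : ℂ) := fun X Y => by
    rw [fderiv_eq_sum]
    simp [chartVF]
    rfl
  have hr : chartDeriv p y (rePart (bracket V W (pt y))) =
      chartVF p (mlieBracket (𝓡 (2 * n + 1)) (fun x => rePart (V x)) (fun x => rePart (W x))) y -
      chartVF p (mlieBracket (𝓡 (2 * n + 1)) (fun x => imPart (V x)) (fun x => imPart (W x))) y := by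
    rw [bracket, rePart_ofReIm, map_sub]; rfl
  have hi : chartDeriv p y (imPart (bracket V W (pt y))) =
      chartVF p (mlieBracket (𝓡 (2 * n + 1)) (fun x => rePart (V x)) (fun x => imPart (W x))) y +
      chartVF p (mlieBracket (𝓡 (2 * n + 1)) (fun x => imPart (V x)) (fun x => rePart (W x))) y := by
    rw [bracket, imPart_ofReIm, map_add]; rfl
  rw [hr, hi, e1, e2, e3, e4]
  simp only [PiLp.add_apply, PiLp.sub_apply, Complex.ofReal_add, Complex.ofReal_sub, key,
    ← Finset.sum_sub_distrib, ← Finset.sum_add_distrib, Finset.mul_sum]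
  refine Finset.sum_congr rfl fun l _ => ?_
  ring_nf
  simp only [Complex.I_sq]
  ring

theorem mdifferentiableAt_of_eq_smoothFun {p : M} {U : Opens M} {f : M → ℂ}
    {g : SmoothFun (chartOpens n p U)} (hg : ∀ y : chartOpens n p U, f (pt y) = g y)
    (y : chartOpens n p U) : MDifferentiableAt (𝓡 (2 * n + 1)) 𝓘(ℝ, ℂ) f (pt y) := by
  have : IsManifold (𝓡 (2 * n + 1)) 1 M := .of_le (n := ∞) (by simp)
  have hs : pt y ∈ (φ p).source := (φ p).map_target y.2.1
  have hr : φ p (pt y) = y := (φ p).right_inv y.2.1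
  have h1 : MDifferentiableAt (𝓡 (2 * n + 1)) 𝓘(ℝ, ℂ) (SmoothFun.rep g) (φ p (pt y)) := by
    rw [hr]
    exact (SmoothFun.differentiableAt_of_contDiffOn
      (SmoothFun.contDiffOn_rep g) y).mdifferentiableAt
  have h2 := h1.comp (pt y) (mdifferentiableAt_extChartAt
    (by rwa [← extChartAt_source (𝓡 (2 * n + 1))]))
  refine h2.congr_of_eventuallyEq ?_
  filter_upwards [((isOpen_extChartAt_source p).inter U.isOpen).mem_nhds ⟨hs, pt_mem y⟩] with x hx
  have hx' : φ p x ∈ chartOpens n p U :=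
    ⟨(φ p).map_source hx.1, by rw [Set.mem_preimage, (φ p).left_inv hx.1]; exact hx.2⟩
  have := hg ⟨_, hx'⟩
  rw [pt, (φ p).left_inv hx.1] at this
  rw [this, Function.comp_apply, SmoothFun.rep_apply g ⟨_, hx'⟩]

/-- The derivative of a function along a complex vector field in a chart. -/
theorem cderiv_eq_vf (p : M) {V : ∀ x : M, CTangent n x} {U : Opens M} (hV : SmoothOn V U)
    {f : M → ℂ} {g : SmoothFun (chartOpens n p U)} (hg : ∀ y : chartOpens n p U, f (pt y) = g y)
    (y : chartOpens n p U) :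
    cderiv f (pt y) (V (pt y)) = SmoothFun.vf (comp p hV) g y := by
  have hf := mdifferentiableAt_of_eq_smoothFun hg y
  rw [SmoothFun.vf_apply, SmoothFun.sum_apply]
  simp only [SmoothFun.mul_apply, SmoothFun.pd_apply_of_eq (F := fun z => f ((φ p).symm z)) hg,
    comp_apply, chartC_apply]
  let a : ℂ := mfderiv (𝓡 (2 * n + 1)) 𝓘(ℝ, ℂ) f (pt y) (rePart (V (pt y)))
  let b : ℂ := mfderiv (𝓡 (2 * n + 1)) 𝓘(ℝ, ℂ) f (pt y) (imPart (V (pt y)))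
  have ha : a = _ := (mfderiv_eq_fderiv_chart p y.2.1 hf _).trans
    (fderiv_eq_sum (F := ℂ) (fderiv ℝ (fun z => f ((φ p).symm z)) y) _)
  have hb : b = _ := (mfderiv_eq_fderiv_chart p y.2.1 hf _).trans
    (fderiv_eq_sum (F := ℂ) (fderiv ℝ (fun z => f ((φ p).symm z)) y) _)
  change a + Complex.I * b = _
  rw [ha, hb]
  simp only [Complex.real_smul, Finset.mul_sum, ← Finset.sum_add_distrib]
  exact Finset.sum_congr rfl fun l _ => by ring

/-! ### Adapted frames -/

theorem SmoothOn.sum_const_smul {κ : Type*} [Fintype κ] {V : κ → ∀ x : M, CTangent n x} {U : Set M}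
    (hV : ∀ i, SmoothOn (V i) U) (c : κ → ℂ) : SmoothOn (fun x => ∑ i, c i • V i x) U := by
  refine ⟨?_, ?_⟩
  · simp only [map_sum, rePart_smul]
    exact ContMDiffOn.sum_section fun i _ => ((hV i).1.const_smul_section).sub_section
      (hV i).2.const_smul_section
  · simp only [map_sum, imPart_smul]
    exact ContMDiffOn.sum_section fun i _ => ((hV i).2.const_smul_section).add_section
      (hV i).1.const_smul_section

theorem finrank_CTangent (x : M) : Module.finrank ℂ (CTangent n x) = 2 * n + 1 := by
  have h : Module.finrank ℂ (ℂ ⊗[ℝ] 𝔼) = 2 * n + 1 := by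
    rw [Module.finrank_baseChange]; simp
  exact h

namespace CRStructure

variable {C : CRStructure n M}

theorem mem_T10_iff {x : M} {v : CTangent n x} : v ∈ C.T10 x ↔ conjC v ∈ C.T01 x := Iff.rfl

theorem conjC_mem_T10 {x : M} {v : CTangent n x} (h : v ∈ C.T01 x) : conjC v ∈ C.T10 x := by
  rwa [mem_T10_iff, conjC_conjC]

theorem T10_le_HC (x : M) : C.T10 x ≤ C.HC x := le_sup_left

theorem T01_le_HC (x : M) : C.T01 x ≤ C.HC x := le_sup_right

/-- A real vector field that is transverse to the leaves exists at each point: the complex rank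
of `T¹⁰ ⊕ T⁰¹` is `2 n`. -/
theorem exists_real_not_mem_HC (x : M) :
    ∃ u : TangentSpace (𝓡 (2 * n + 1)) x, ofReIm u 0 ∉ C.HC x := by
  by_contra! H
  have htop : C.HC x = ⊤ := by
    refine eq_top_iff.2 fun z _ => ?_
    rw [← ofReIm_rePart_imPart z, ofReIm_eq]
    exact add_mem (H _) ((C.HC x).smul_mem _ (H _))
  obtain ⟨U, -, hxU, e, -, he⟩ := C.exists_frame x
  have hspan : C.HC x ≤ Submodule.span ℂ (Set.range
      (Sum.elim (fun j => conjC (e j x)) fun j => e j x)) := by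
    have h01 : C.T01 x ≤ Submodule.span ℂ (Set.range fun j => e j x) := (he x hxU).2.ge
    refine sup_le (fun v hv => ?_) (h01.trans ?_)
    · obtain ⟨c, hc⟩ := (Submodule.mem_span_range_iff_exists_fun ℂ).1 (h01 hv)
      rw [← conjC_conjC v, ← hc, map_sum]
      refine Submodule.sum_mem _ fun j _ => ?_
      rw [map_smulₛₗ]
      exact Submodule.smul_mem _ _ (Submodule.subset_span ⟨.inl j, rfl⟩)
    · refine Submodule.span_mono ?_
      rintro _ ⟨j, rfl⟩
      exact ⟨.inr j, rfl⟩
  have h1 := finrank_range_le_card (R := ℂ)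
    (Sum.elim (fun j => conjC (e j x)) fun j => e j x)
  have hspan' := eq_top_iff.2 (htop ▸ hspan)
  rw [Set.finrank, hspan', finrank_top, finrank_CTangent] at h1
  simp at h1
  omega

/-- A local frame `e` of `T¹⁰` over `U` together with a real vector field `X` that lifts a
normalized section of the normal bundle. -/
structure AdaptedFrame (h : C.HermitianMetric) (U : Opens M) where
  /-- The frame of `T¹⁰`. -/
  e : Fin n → ∀ x : M, CTangent n x
  /-- The real vector field transverse to the leaves. -/
  X : ∀ x : M, CTangent n x
  smooth_e : ∀ j, SmoothOn (e j) U
  indep_e : ∀ x ∈ U, LinearIndependent ℂ fun j => e j x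
  span_e : ∀ x ∈ U, Submodule.span ℂ (Set.range fun j => e j x) = C.T10 x
  smooth_X : SmoothOn X U
  conj_X : ∀ x ∈ U, conjC (X x) = X x
  unit_X : ∀ x ∈ U, h.form x (C.toNormal x (X x)) (C.toNormal x (X x)) = 1

/-- The restriction of an adapted frame to a smaller open set. -/
def AdaptedFrame.restrict {h : C.HermitianMetric} {U U' : Opens M} (F : AdaptedFrame h U)
    (hU : U' ≤ U) : AdaptedFrame h U' where
  e := F.e
  X := F.X
  smooth_e j := (F.smooth_e j).mono hU
  indep_e x hx := F.indep_e x (hU hx)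
  span_e x hx := F.span_e x (hU hx)
  smooth_X := F.smooth_X.mono hU
  conj_X x hx := F.conj_X x (hU hx)
  unit_X x hx := F.unit_X x (hU hx)

theorem exists_adaptedFrame (h : C.HermitianMetric) (p : M) :
    ∃ U : Opens M, p ∈ U ∧ Nonempty (AdaptedFrame h U) := by
  obtain ⟨U₀, hU₀, hpU₀, f, hf, hspan⟩ := C.exists_frame p
  obtain ⟨u, hu⟩ := exists_real_not_mem_HC (C := C) p
  obtain ⟨w, hw⟩ := exists_constVF_eq p (mem_extChartAt_source (I := 𝓡 (2 * n + 1)) p) u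
  -- a real field that is transverse at `p`, hence near `p`; it is normalized by the metric below
  set Y : ∀ x : M, CTangent n x := fun x => ofReIm (constVF p w x) 0 with hY
  have hYs : SmoothOn Y (φ p).source := by
    refine ⟨?_, ?_⟩
    · simpa only [hY, rePart_ofReIm] using constVF_contMDiffOn p w
    · simp only [hY, imPart_ofReIm]
      exact (Bundle.contMDiff_zeroSection ℝ (TangentSpace (𝓡 (2 * n + 1)) : M → Type)).contMDiffOn
  set H : M → ℂ := fun x => h.form x (C.toNormal x (Y x)) (C.toNormal x (Y x)) with hH
  have hHs := h.smooth _ Y Y (isOpen_extChartAt_source p) hYs hYs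
  have hre : ContMDiffOn (𝓡 (2 * n + 1)) 𝓘(ℝ, ℝ) ∞ (fun x => (H x).re) (φ p).source :=
    Complex.reCLM.contDiff.contMDiff.comp_contMDiffOn hHs
  have hreal : ∀ x, ((H x).re : ℂ) = H x := fun x =>
    Complex.conj_eq_iff_re.1 (h.conj_symm x _ _)
  have hpos : 0 < (H p).re := by
    refine h.pos p _ fun h0 => hu ?_
    rw [← hw]
    exact (Submodule.Quotient.mk_eq_zero _).1 h0
  let U₁ : Opens M := ⟨U₀ ∩ ((φ p).source ∩ (fun x => (H x).re) ⁻¹' Set.Ioi 0),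
    hU₀.inter (hre.continuousOn.isOpen_inter_preimage (isOpen_extChartAt_source p) isOpen_Ioi)⟩
  have hr : ContMDiffOn (𝓡 (2 * n + 1)) 𝓘(ℝ, ℝ) ∞ (fun x => (Real.sqrt (H x).re)⁻¹) U₁ := by
    intro x hx
    have hx0 : (0 : ℝ) < (H x).re := hx.2.2
    have h1 : ContDiffAt ℝ ∞ (fun t : ℝ => (Real.sqrt t)⁻¹) (H x).re :=
      (Real.contDiffAt_sqrt hx0.ne').inv (Real.sqrt_pos.2 hx0).ne'
    exact ContMDiffAt.comp_contMDiffWithinAt (g := fun t : ℝ => (Real.sqrt t)⁻¹)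
      (f := fun x => (H x).re) x h1.contMDiffAt ((hre x hx.2.1).mono fun z (hz : z ∈ U₁) => hz.2.1)
  refine ⟨U₁, ⟨hpU₀, mem_extChartAt_source p, hpos⟩, ⟨{
    e := fun j x => conjC (f j x)
    X := fun x => ofReIm ((Real.sqrt (H x).re)⁻¹ • constVF p w x) 0
    smooth_e := fun j => ((hf j).mono fun x hx => hx.1).conjC
    indep_e := fun x hx => ?_
    span_e := fun x hx => ?_
    smooth_X := ⟨?_, ?_⟩
    conj_X := fun x _ => conjC_ofReal _
    unit_X := fun x hx => ?_ }⟩⟩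
  · rw [Fintype.linearIndependent_iff]
    intro g hg
    have h1 := congrArg conjC hg
    rw [map_sum, map_zero] at h1
    simp only [map_smulₛₗ, conjC_conjC] at h1
    intro j
    simpa using (Fintype.linearIndependent_iff.1 (hspan x hx.1).1) _ h1 j
  · refine le_antisymm (Submodule.span_le.2 ?_) fun v hv => ?_
    · rintro _ ⟨j, rfl⟩
      refine conjC_mem_T10 ?_
      rw [← (hspan x hx.1).2]
      exact Submodule.subset_span ⟨j, rfl⟩
    · rw [mem_T10_iff, ← (hspan x hx.1).2, Submodule.mem_span_range_iff_exists_fun] at hv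
      obtain ⟨c, hc⟩ := hv
      rw [← conjC_conjC v, ← hc, map_sum]
      refine Submodule.sum_mem _ fun j _ => ?_
      rw [map_smulₛₗ]
      exact Submodule.smul_mem _ _ (Submodule.subset_span ⟨j, rfl⟩)
  · simp only [rePart_ofReIm]
    exact hr.smul_section ((constVF_contMDiffOn p w).mono fun x hx => hx.2.1)
  · simp only [imPart_ofReIm]
    exact (Bundle.contMDiff_zeroSection ℝ (TangentSpace (𝓡 (2 * n + 1)) : M → Type)).contMDiffOn
  · have hx0 : (0 : ℝ) < (H x).re := hx.2.2
    rw [ofReIm_smul, map_smul, map_smul, map_smulₛₗ, LinearMap.smul_apply]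
    change _ • _ • H x = 1
    rw [← hreal x, smul_eq_mul, smul_eq_mul, Complex.conj_ofReal, ← Complex.ofReal_mul,
      ← Complex.ofReal_mul]
    norm_cast
    rw [← mul_assoc, ← mul_inv, Real.mul_self_sqrt hx0.le, inv_mul_cancel₀ hx0.ne']

end CRStructure

/-! ### The components of an adapted frame in a chart -/

variable (n) in
/-- An enumeration of the coordinates by the index type of the frames `(e, ē, X)`. -/
def coordEquiv : ι ≃ Fin (2 * n + 1) :=
  Fintype.equivFinOfCardEq (by simp; omega)

namespace CRStructure

variable {C : CRStructure n M}

namespace AdaptedFrame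

variable {h : C.HermitianMetric} {U : Opens M} (F : AdaptedFrame h U)

theorem e_mem {x : M} (hx : x ∈ U) (j : Fin n) : F.e j x ∈ C.T10 x := by
  rw [← F.span_e x hx]; exact Submodule.subset_span ⟨j, rfl⟩

theorem conj_e_mem {x : M} (hx : x ∈ U) (j : Fin n) : conjC (F.e j x) ∈ C.T01 x := F.e_mem hx j

theorem toNormal_X_ne_zero {x : M} (hx : x ∈ U) : C.toNormal x (F.X x) ≠ 0 := fun h0 => by
  have := F.unit_X x hx
  rw [h0] at this
  simp at this

/-- The frame `(e, ē, X)` as a single family. -/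
def b : ι → ∀ x : M, CTangent n x :=
  Sum.elim (Sum.elim F.e fun j x => conjC (F.e j x)) fun _ => F.X

theorem smooth_b (i : ι) : SmoothOn (F.b i) U := by
  rcases i with ((j | j) | _)
  exacts [F.smooth_e j, (F.smooth_e j).conjC, F.smooth_X]

theorem sum_b (x : M) (c : ι → ℂ) : ∑ i, c i • F.b i x =
    ∑ j, c (.inl (.inl j)) • F.e j x + ∑ j, c (.inl (.inr j)) • conjC (F.e j x)
      + c (.inr ()) • F.X x := by
  simp [Fintype.sum_sum_type, b]

theorem sum_e_mem {x : M} (hx : x ∈ U) (f : Fin n → ℂ) : ∑ j, f j • F.e j x ∈ C.T10 x :=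
  Submodule.sum_mem _ fun j _ => Submodule.smul_mem _ _ (F.e_mem hx j)

theorem sum_conj_e_mem {x : M} (hx : x ∈ U) (f : Fin n → ℂ) :
    ∑ j, f j • conjC (F.e j x) ∈ C.T01 x :=
  Submodule.sum_mem _ fun j _ => Submodule.smul_mem _ _ (F.conj_e_mem hx j)

theorem eq_zero_of_smul_X_mem {x : M} (hx : x ∈ U) {t : ℂ} (ht : t • F.X x ∈ C.HC x) : t = 0 := by
  have h0 : t • C.toNormal x (F.X x) = 0 := by
    rw [← map_smul]
    exact (Submodule.Quotient.mk_eq_zero _).2 ht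
  exact (smul_eq_zero.1 h0).resolve_right (F.toNormal_X_ne_zero hx)

theorem coeff_X_eq_zero {x : M} (hx : x ∈ U) {f g : Fin n → ℂ} {t : ℂ}
    (hm : ∑ j, f j • F.e j x + ∑ j, g j • conjC (F.e j x) + t • F.X x ∈ C.HC x) : t = 0 := by
  refine F.eq_zero_of_smul_X_mem hx ?_
  refine (Submodule.add_mem_iff_right _ (add_mem ?_ ?_)).1 hm
  exacts [T10_le_HC x (F.sum_e_mem hx f), T01_le_HC x (F.sum_conj_e_mem hx g)]

theorem eq_zero_of_sum_e {x : M} (hx : x ∈ U) {f : Fin n → ℂ}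
    (hf : ∑ j, f j • F.e j x ∈ C.T01 x) : f = 0 := by
  have h0 : ∑ j, f j • F.e j x = 0 :=
    Submodule.disjoint_def.1 (C.disjoint_conj x) _ (F.sum_e_mem hx f) hf
  exact funext fun j => Fintype.linearIndependent_iff.1 (F.indep_e x hx) f h0 j

theorem eq_zero_of_sum_conj_e {x : M} (hx : x ∈ U) {g : Fin n → ℂ}
    (hg : ∑ j, g j • conjC (F.e j x) ∈ C.T10 x) : g = 0 := by
  have h1 := F.eq_zero_of_sum_e hx (f := fun j => starRingEnd ℂ (g j)) (by
    rw [mem_T10_iff, map_sum] at hg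
    simpa only [map_smulₛₗ, conjC_conjC] using hg)
  exact funext fun j => by simpa using congrFun h1 j

theorem coeff_of_mem_T10 {x : M} (hx : x ∈ U) {f g : Fin n → ℂ} {t : ℂ}
    (hm : ∑ j, f j • F.e j x + ∑ j, g j • conjC (F.e j x) + t • F.X x ∈ C.T10 x) :
    g = 0 ∧ t = 0 := by
  have ht := F.coeff_X_eq_zero hx (T10_le_HC x hm)
  refine ⟨F.eq_zero_of_sum_conj_e hx ?_, ht⟩
  rw [ht, zero_smul, add_zero] at hm
  exact (Submodule.add_mem_iff_right _ (F.sum_e_mem hx f)).1 hm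

theorem coeff_of_mem_T01 {x : M} (hx : x ∈ U) {f g : Fin n → ℂ} {t : ℂ}
    (hm : ∑ j, f j • F.e j x + ∑ j, g j • conjC (F.e j x) + t • F.X x ∈ C.T01 x) :
    f = 0 ∧ t = 0 := by
  have ht := F.coeff_X_eq_zero hx (T01_le_HC x hm)
  refine ⟨F.eq_zero_of_sum_e hx ?_, ht⟩
  rw [ht, zero_smul, add_zero] at hm
  exact (Submodule.add_mem_iff_left _ (F.sum_conj_e_mem hx g)).1 hm

theorem coeff_eq_zero {x : M} (hx : x ∈ U) {f g : Fin n → ℂ} {t : ℂ}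
    (hm : ∑ j, f j • F.e j x + ∑ j, g j • conjC (F.e j x) + t • F.X x = 0) :
    f = 0 ∧ g = 0 ∧ t = 0 :=
  ⟨(F.coeff_of_mem_T01 hx (hm ▸ zero_mem _)).1, F.coeff_of_mem_T10 hx (hm ▸ zero_mem _)⟩

theorem linearIndependent_b {x : M} (hx : x ∈ U) : LinearIndependent ℂ fun i => F.b i x := by
  rw [Fintype.linearIndependent_iff]
  intro c hc
  rw [sum_b] at hc
  obtain ⟨h1, h2, h3⟩ := F.coeff_eq_zero hx hc
  rintro ((j | j) | ⟨⟩)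
  exacts [congrFun h1 j, congrFun h2 j, h3]

variable (p : M)

/-- The components of the frame in the chart around `p`. -/
def mat : Matrix ι ι (SmoothFun (chartOpens n p U)) :=
  Matrix.of fun i k => comp p (F.smooth_b i) (coordEquiv n k)

theorem det_apply {κ : Type*} [Fintype κ] [DecidableEq κ] {m : ℕ}
    {Ω : Opens (EuclideanSpace ℝ (Fin m))} (N : Matrix κ κ (SmoothFun Ω)) (y : Ω) :
    N.det y = (Matrix.of fun i k => N i k y).det :=
  (SmoothFun.eval y).map_det N

theorem det_mat_ne_zero (y : chartOpens n p U) : (F.mat p).det y ≠ 0 := by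
  rw [det_apply]
  have hli : LinearIndependent ℂ fun i => (Matrix.of fun i k => F.mat p i k y) i := by
    have h1 := (F.linearIndependent_b (pt_mem y)).map' (chartC p y)
      (LinearMap.ker_eq_bot.2 (chartC_injective p y.2.1))
    exact h1.map' (LinearEquiv.funCongrLeft ℂ ℂ (coordEquiv n)).toLinearMap
      (LinearEquiv.ker _)
  have := (Matrix.linearIndependent_rows_iff_isUnit.1 hli)
  rw [Matrix.isUnit_iff_isUnit_det] at this
  exact this.ne_zero

theorem isUnit_det_mat : IsUnit (F.mat p).det :=
  SmoothFun.isUnit_of_ne_zero _ (F.det_mat_ne_zero p)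

/-- The frame field `b i` as a derivation. -/
def der (i : ι) : Derivation ℝ (SmoothFun (chartOpens n p U)) (SmoothFun (chartOpens n p U)) :=
  SmoothFun.vf (comp p (F.smooth_b i))

theorem der_def (i : ι) : F.der p i = SmoothFun.vf (comp p (F.smooth_b i)) := rfl

theorem der_e (j : Fin n) : F.der p (.inl (.inl j)) = SmoothFun.vf (comp p (F.smooth_e j)) := rfl

theorem der_eb (j : Fin n) :
    F.der p (.inl (.inr j)) = SmoothFun.vf (comp p (F.smooth_e j).conjC) := rfl

theorem der_X : F.der p (.inr ()) = SmoothFun.vf (comp p F.smooth_X) := rfl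

attribute [irreducible] der

/-- Every vector field with smooth components is a combination of the frame. -/
theorem exists_coeff (W : Fin (2 * n + 1) → SmoothFun (chartOpens n p U)) :
    ∃ c : ι → SmoothFun (chartOpens n p U), W = ∑ i, c i • comp p (F.smooth_b i) := by
  refine ⟨Matrix.vecMul (fun k => W (coordEquiv n k)) (F.mat p)⁻¹, ?_⟩
  have h1 : Matrix.vecMul (Matrix.vecMul (fun k => W (coordEquiv n k)) (F.mat p)⁻¹) (F.mat p) =
      fun k => W (coordEquiv n k) := by
    rw [Matrix.vecMul_vecMul, Matrix.nonsing_inv_mul _ (F.isUnit_det_mat p), Matrix.vecMul_one]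
  ext1 k
  have h2 := congrFun h1 ((coordEquiv n).symm k)
  simp only [Equiv.apply_symm_apply] at h2
  rw [← h2]
  simp [Matrix.vecMul, dotProduct, mat]

theorem comp_sum_apply (c : ι → SmoothFun (chartOpens n p U)) (y : chartOpens n p U) (k) :
    (∑ i, c i • comp p (F.smooth_b i)) k y = chartC p y (∑ i, c i y • F.b i (pt y)) k := by
  rw [map_sum]
  simp only [Finset.sum_apply, Pi.smul_apply, map_smul, smul_eq_mul, SmoothFun.sum_apply,
    SmoothFun.mul_apply, comp_apply]

/-- A smooth vector field has smooth coefficients in the frame. -/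
theorem exists_section_coeff {V : ∀ x : M, CTangent n x} (hV : SmoothOn V U) :
    ∃ c : ι → SmoothFun (chartOpens n p U),
      SmoothFun.vf (comp p hV) = ∑ i, c i • F.der p i ∧
      ∀ y : chartOpens n p U, V (pt y) = ∑ i, c i y • F.b i (pt y) := by
  obtain ⟨c, hc⟩ := F.exists_coeff p (comp p hV)
  refine ⟨c, ?_, fun y => chartC_injective p y.2.1 (funext fun k => ?_)⟩
  · rw [hc, SmoothFun.vf_sum]
    simp only [SmoothFun.vf_smul, der_def]
  · rw [← comp_sum_apply, ← hc, comp_apply]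

/-- The bracket of smooth vector fields has smooth coefficients in the frame. -/
theorem exists_bracket_coeff {V W : ∀ x : M, CTangent n x} (hV : SmoothOn V U)
    (hW : SmoothOn W U) :
    ∃ c : ι → SmoothFun (chartOpens n p U),
      ⁅SmoothFun.vf (comp p hV), SmoothFun.vf (comp p hW)⁆ = ∑ i, c i • F.der p i ∧
      ∀ y : chartOpens n p U, bracket V W (pt y) = ∑ i, c i y • F.b i (pt y) := by
  obtain ⟨c, hc⟩ := F.exists_coeff p fun k =>
    SmoothFun.vf (comp p hV) (comp p hW k) - SmoothFun.vf (comp p hW) (comp p hV k)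
  refine ⟨c, ?_, fun y => chartC_injective p y.2.1 (funext fun k => ?_)⟩
  · rw [SmoothFun.lie_vf, hc, SmoothFun.vf_sum]
    simp only [SmoothFun.vf_smul, der_def]
  · rw [← comp_sum_apply, ← hc, chartC_bracket p hV hW, SmoothFun.lie_vf, SmoothFun.vf_coord]

theorem sum_der (c : ι → SmoothFun (chartOpens n p U)) : ∑ i, c i • F.der p i =
    ∑ j, c (.inl (.inl j)) • F.der p (.inl (.inl j)) +
    ∑ j, c (.inl (.inr j)) • F.der p (.inl (.inr j)) + c (.inr ()) • F.der p (.inr ()) := by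
  simp [Fintype.sum_sum_type]

theorem conj_der_e (j : Fin n) :
    (F.der p (.inl (.inl j))).conj SmoothFun.conj SmoothFun.conj_conj =
      F.der p (.inl (.inr j)) := by
  rw [der_e, der_eb, SmoothFun.conj_vf]
  exact congrArg SmoothFun.vf (funext fun k => (comp_conjC p (F.smooth_e j) k).symm)

theorem conj_der_X : (F.der p (.inr ())).conj SmoothFun.conj SmoothFun.conj_conj =
    F.der p (.inr ()) := by
  rw [der_X, SmoothFun.conj_vf]
  refine congrArg SmoothFun.vf (funext fun k => ?_)
  ext y
  rw [SmoothFun.conj_apply, comp_apply, ← chartC_conjC]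
  rw [F.conj_X _ (pt_mem y)]

theorem der_coord (i k) : F.der p i (SmoothFun.coord k) = comp p (F.smooth_b i) k := by
  rw [der_def, SmoothFun.vf_coord]

/-- The derivations `(e, ē, X)` are linearly independent over the smooth functions. -/
theorem coeff_der_eq_zero (f g : Fin n → SmoothFun (chartOpens n p U))
    (t : SmoothFun (chartOpens n p U))
    (h0 : ∑ j, f j • F.der p (.inl (.inl j)) + ∑ j, g j • F.der p (.inl (.inr j)) +
      t • F.der p (.inr ()) = 0) : f = 0 ∧ g = 0 ∧ t = 0 := by
  have key : ∀ y : chartOpens n p U, ∑ j, f j y • F.e j (pt y) +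
      ∑ j, g j y • conjC (F.e j (pt y)) + t y • F.X (pt y) = 0 := fun y => by
    let c : ι → SmoothFun (chartOpens n p U) := Sum.elim (Sum.elim f g) fun _ => t
    have h1 := F.sum_b (pt y) fun i => c i y
    change _ = ∑ j, f j y • F.e j (pt y) +
      ∑ j, g j y • conjC (F.e j (pt y)) + t y • F.X (pt y) at h1
    rw [← h1]
    refine chartC_injective p y.2.1 (funext fun k => ?_)
    rw [← comp_sum_apply, map_zero]
    have h2 : SmoothFun.vf (∑ i, c i • comp p (F.smooth_b i)) = 0 := by
      rw [SmoothFun.vf_sum]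
      simp only [SmoothFun.vf_smul, ← der_def]
      rw [← h0]
      exact F.sum_der p c
    rw [← SmoothFun.vf_coord (∑ i, c i • comp p (F.smooth_b i)) k, h2]
    rfl
  refine ⟨funext fun j => ?_, funext fun j => ?_, ?_⟩ <;> ext y
  · exact congrFun (F.coeff_eq_zero (pt_mem y) (key y)).1 j
  · exact congrFun (F.coeff_eq_zero (pt_mem y) (key y)).2.1 j
  · exact (F.coeff_eq_zero (pt_mem y) (key y)).2.2

end AdaptedFrame

end CRStructure

/-! ### The structure functions of an adapted frame -/

namespace CRStructure

variable {C : CRStructure n M}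

namespace AdaptedFrame

variable {h : C.HermitianMetric} {U : Opens M} (F : AdaptedFrame h U) (p : M)

/-- `T¹⁰` is involutive. The assumption concerns `T⁰¹`, so it is applied to the conjugate fields. -/
theorem exists_lie_e_e (i k : Fin n) : ∃ c : Fin n → SmoothFun (chartOpens n p U),
    ⁅F.der p (.inl (.inl i)), F.der p (.inl (.inl k))⁆ = ∑ l, c l • F.der p (.inl (.inl l)) := by
  obtain ⟨c, hc, hpt⟩ := F.exists_bracket_coeff p (F.smooth_e i).conjC (F.smooth_e k).conjC
  have hmem : ∀ y : chartOpens n p U, (fun l => c (.inl (.inl l)) y) = 0 ∧ c (.inr ()) y = 0 :=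
    fun y => by
      have h1 := C.involutive U _ _ U.isOpen ⟨(F.smooth_e i).conjC, fun x hx => F.conj_e_mem hx i⟩
        ⟨(F.smooth_e k).conjC, fun x hx => F.conj_e_mem hx k⟩ _ (pt_mem y)
      rw [hpt, sum_b] at h1
      exact F.coeff_of_mem_T01 (pt_mem y) h1
  have h1 : ∀ l, c (.inl (.inl l)) = 0 := fun l => SmoothFun.ext fun y => congrFun (hmem y).1 l
  have h2 : c (.inr ()) = 0 := SmoothFun.ext fun y => (hmem y).2
  rw [sum_der] at hc
  simp only [h1, h2, zero_smul, Finset.sum_const_zero, zero_add, add_zero] at hc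
  refine ⟨fun l => SmoothFun.conj (c (.inl (.inr l))), ?_⟩
  have h3 := congrArg (Derivation.conj SmoothFun.conj SmoothFun.conj_conj) hc
  simp only [Derivation.conj_lie, Derivation.conj_sum, Derivation.conj_smul] at h3
  simp only [← conj_der_e, Derivation.conj_conj] at h3
  rw [← h3]
  have h4 : ∀ i, F.der p (.inl (.inl i)) = (SmoothFun.vf (comp p (F.smooth_e i).conjC)).conj
      SmoothFun.conj SmoothFun.conj_conj := fun i => by
    rw [← der_eb, ← conj_der_e, Derivation.conj_conj]
  rw [h4, h4]

theorem exists_lie_e_conj (hC : C.IsLeviFlat) (j k : Fin n) :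
    ∃ f g : Fin n → SmoothFun (chartOpens n p U),
    ⁅F.der p (.inl (.inl j)), F.der p (.inl (.inr k))⁆ =
      ∑ l, f l • F.der p (.inl (.inl l)) + ∑ l, g l • F.der p (.inl (.inr l)) := by
  obtain ⟨c, hc, hpt⟩ := F.exists_bracket_coeff p (F.smooth_e j) (F.smooth_e k).conjC
  have h2 : c (.inr ()) = 0 := SmoothFun.ext fun y => by
    have h1 := hC U _ _ U.isOpen ⟨F.smooth_e j, fun x hx => T10_le_HC x (F.e_mem hx j)⟩
      ⟨(F.smooth_e k).conjC, fun x hx => T01_le_HC x (F.conj_e_mem hx k)⟩ _ (pt_mem y)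
    rw [hpt, sum_b] at h1
    exact F.coeff_X_eq_zero (pt_mem y) h1
  rw [sum_der, h2, zero_smul, add_zero, ← der_e, ← der_eb] at hc
  exact ⟨_, _, hc⟩

theorem exists_lie_e_X (j : Fin n) : ∃ (f g : Fin n → SmoothFun (chartOpens n p U))
    (a : SmoothFun (chartOpens n p U)), ⁅F.der p (.inl (.inl j)), F.der p (.inr ())⁆ =
      ∑ l, f l • F.der p (.inl (.inl l)) + ∑ l, g l • F.der p (.inl (.inr l)) -
        a • F.der p (.inr ()) := by
  obtain ⟨c, hc, -⟩ := F.exists_bracket_coeff p (F.smooth_e j) F.smooth_X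
  rw [sum_der, ← der_e, ← der_X] at hc
  refine ⟨fun l => c (.inl (.inl l)), fun l => c (.inl (.inr l)), -c (.inr ()), ?_⟩
  rw [neg_smul, sub_neg_eq_add]
  exact hc

/-- The frame over `U`, as derivations of the smooth functions in the chart around `p`. -/
def leviFlat (hC : C.IsLeviFlat) : LeviFlatFrame (SmoothFun (chartOpens n p U)) n where
  c := SmoothFun.conj
  c_c := SmoothFun.conj_conj
  e j := F.der p (.inl (.inl j))
  X := F.der p (.inr ())
  conj_X := F.conj_der_X p
  indep f g t h0 := F.coeff_der_eq_zero p f g t (by simpa only [conj_der_e] using h0)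
  cc i k := (F.exists_lie_e_e p i k).choose
  p j k := (F.exists_lie_e_conj p hC j k).choose
  q j k := (F.exists_lie_e_conj p hC j k).choose_spec.choose
  r j := (F.exists_lie_e_X p j).choose
  s j := (F.exists_lie_e_X p j).choose_spec.choose
  α j := (F.exists_lie_e_X p j).choose_spec.choose_spec.choose
  lie_e_e i k := (F.exists_lie_e_e p i k).choose_spec
  lie_e_conj j k := by
    simp only [conj_der_e]
    exact (F.exists_lie_e_conj p hC j k).choose_spec.choose_spec
  lie_e_X j := by
    simp only [conj_der_e]
    exact (F.exists_lie_e_X p j).choose_spec.choose_spec.choose_spec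

variable (hC : C.IsLeviFlat)

theorem leviFlat_c : (F.leviFlat p hC).c = SmoothFun.conj := rfl

theorem leviFlat_e (j : Fin n) : (F.leviFlat p hC).e j = F.der p (.inl (.inl j)) := rfl

theorem leviFlat_eb (j : Fin n) : (F.leviFlat p hC).eb j = F.der p (.inl (.inr j)) :=
  F.conj_der_e p j

theorem leviFlat_X : (F.leviFlat p hC).X = F.der p (.inr ()) := rfl

theorem leviFlat_b : (F.leviFlat p hC).b = F.der p := by
  funext i
  rcases i with ((j | j) | ⟨⟩)
  exacts [rfl, F.leviFlat_eb p hC j, rfl]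

attribute [irreducible] leviFlat

/-- Equal derivations come from equal values of the vector fields. -/
theorem eq_sum_of_der_eq {V W : ∀ x : M, CTangent n x} (hV : SmoothOn V U) (hW : SmoothOn W U)
    {c : ι → SmoothFun (chartOpens n p U)}
    (hc : ⁅SmoothFun.vf (comp p hV), SmoothFun.vf (comp p hW)⁆ = ∑ i, c i • F.der p i)
    (y : chartOpens n p U) : bracket V W (pt y) = ∑ i, c i y • F.b i (pt y) := by
  refine chartC_injective p y.2.1 (funext fun k => ?_)
  rw [chartC_bracket p hV hW, hc, ← comp_sum_apply]
  have h1 : ∑ i, c i • F.der p i = SmoothFun.vf (∑ i, c i • comp p (F.smooth_b i)) := by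
    rw [SmoothFun.vf_sum]
    simp only [SmoothFun.vf_smul, der_def]
  rw [h1, SmoothFun.vf_coord]

theorem bracket_eq_of_lie_eq {V W : ∀ x : M, CTangent n x} (hV : SmoothOn V U)
    (hW : SmoothOn W U) {f g : Fin n → SmoothFun (chartOpens n p U)}
    {t : SmoothFun (chartOpens n p U)}
    (hc : ⁅SmoothFun.vf (comp p hV), SmoothFun.vf (comp p hW)⁆ =
      ∑ l, f l • F.der p (.inl (.inl l)) + ∑ l, g l • F.der p (.inl (.inr l)) +
        t • F.der p (.inr ()))
    (y : chartOpens n p U) : bracket V W (pt y) = ∑ l, f l y • F.e l (pt y) +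
      ∑ l, g l y • conjC (F.e l (pt y)) + t y • F.X (pt y) := by
  let c : ι → SmoothFun (chartOpens n p U) := Sum.elim (Sum.elim f g) fun _ => t
  have h1 := F.eq_sum_of_der_eq p hV hW (c := c) (by rw [hc, sum_der]; rfl) y
  rw [h1, sum_b]
  rfl

theorem bracket_e_eb (j k : Fin n) (y : chartOpens n p U) : ∃ g : Fin n → ℂ,
    bracket (F.e j) (fun x => conjC (F.e k x)) (pt y) =
      ∑ l, (F.leviFlat p hC).p j k l y • F.e l (pt y) + ∑ l, g l • conjC (F.e l (pt y)) := by
  have h1 := (F.leviFlat p hC).lie_e_eb j k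
  simp only [leviFlat_e, leviFlat_eb] at h1
  have h2 := F.bracket_eq_of_lie_eq p (F.smooth_e j) (F.smooth_e k).conjC (t := 0)
    (by rw [← der_e, ← der_eb, h1, zero_smul, add_zero]) y
  refine ⟨fun l => (F.leviFlat p hC).q j k l y, h2.trans ?_⟩
  rw [SmoothFun.zero_apply, zero_smul, add_zero]

end AdaptedFrame

end CRStructure

/-! ### The connection form in an adapted frame -/

namespace CRStructure

variable {C : CRStructure n M}

namespace AdaptedFrame

variable {h : C.HermitianMetric} {U : Opens M} (F : AdaptedFrame h U) (p : M)

theorem exists_T10_coeff {V : ∀ x : M, CTangent n x} (hV : IsSection C.T10 V U) :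
    ∃ f : Fin n → SmoothFun (chartOpens n p U),
      SmoothFun.vf (comp p hV.1) = ∑ j, f j • F.der p (.inl (.inl j)) ∧
      ∀ y : chartOpens n p U, V (pt y) = ∑ j, f j y • F.e j (pt y) := by
  obtain ⟨c, hc, hVy⟩ := F.exists_section_coeff p hV.1
  have h0 : ∀ y : chartOpens n p U, (fun l => c (.inl (.inr l)) y) = 0 ∧ c (.inr ()) y = 0 :=
    fun y => by
      have h1 := hV.2 _ (pt_mem y)
      rw [hVy, sum_b] at h1
      exact F.coeff_of_mem_T10 (pt_mem y) h1
  have h1 : ∀ l, c (.inl (.inr l)) = 0 := fun l => SmoothFun.ext fun y => congrFun (h0 y).1 l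
  have h2 : c (.inr ()) = 0 := SmoothFun.ext fun y => (h0 y).2
  refine ⟨fun j => c (.inl (.inl j)), ?_, fun y => ?_⟩
  · rw [hc, sum_der]
    simp only [h1, h2, zero_smul, Finset.sum_const_zero, add_zero]
  · rw [hVy, sum_b]
    simp only [h1, h2, SmoothFun.zero_apply, zero_smul, Finset.sum_const_zero, add_zero]

theorem coeff_unique {x : M} (hx : x ∈ U) {f g : Fin n → ℂ}
    (hfg : ∑ j, f j • F.e j x = ∑ j, g j • F.e j x) : f = g := by
  rw [← sub_eq_zero]
  refine F.eq_zero_of_sum_e hx ?_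
  simp only [Pi.sub_apply, sub_smul, Finset.sum_sub_distrib, hfg, sub_self, zero_mem]

theorem toNormal_eq {x : M} (hx : x ∈ U) (f g : Fin n → ℂ) (t : ℂ) :
    C.toNormal x (∑ j, f j • F.e j x + ∑ j, g j • conjC (F.e j x) + t • F.X x) =
      t • C.toNormal x (F.X x) := by
  have h0 : C.toNormal x (∑ j, f j • F.e j x + ∑ j, g j • conjC (F.e j x)) = 0 :=
    (Submodule.Quotient.mk_eq_zero _).2
      (add_mem (T10_le_HC _ (F.sum_e_mem hx _)) (T01_le_HC _ (F.sum_conj_e_mem hx _)))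
  rw [map_add, map_smul, h0, zero_add]

/-- Modulo tangential fields, a lift of a normalized real section is `X` or `-X` near each point;
the sign is encoded as a smooth function of square `1`. -/
theorem exists_lift_coeff {W : ∀ x : M, CTangent n x} (hW : h.IsUnitRealLift W U) :
    ∃ (g k : Fin n → SmoothFun (chartOpens n p U)) (t : SmoothFun (chartOpens n p U)),
      SmoothFun.vf (comp p hW.1) = ∑ j, g j • F.der p (.inl (.inl j)) +
        ∑ j, k j • F.der p (.inl (.inr j)) + t • F.der p (.inr ()) ∧ t * t = 1 ∧
      ∀ y : chartOpens n p U, W (pt y) = ∑ j, g j y • F.e j (pt y) +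
        ∑ j, k j y • conjC (F.e j (pt y)) + t y • F.X (pt y) := by
  obtain ⟨c, hc, hWy⟩ := F.exists_section_coeff p hW.1
  rw [sum_der] at hc
  have hn : ∀ y : chartOpens n p U, C.toNormal (pt y) (W (pt y)) =
      c (.inr ()) y • C.toNormal (pt y) (F.X (pt y)) := fun y => by
    rw [hWy, sum_b, F.toNormal_eq (pt_mem y)]
  refine ⟨_, _, _, hc, SmoothFun.ext fun y => ?_, fun y => (hWy y).trans (F.sum_b _ _)⟩
  obtain ⟨hr, hu⟩ := hW.2 _ (pt_mem y)
  have hne := F.toNormal_X_ne_zero (pt_mem y)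
  have hXr : C.normalConj (pt y) (C.toNormal (pt y) (F.X (pt y))) =
      C.toNormal (pt y) (F.X (pt y)) :=
    congrArg (C.toNormal (pt y)) (F.conj_X _ (pt_mem y))
  rw [hn, map_smulₛₗ, hXr] at hr
  have h1 : starRingEnd ℂ (c (.inr ()) y) = c (.inr ()) y := smul_left_injective ℂ hne hr
  rw [hn, map_smul, map_smulₛₗ, LinearMap.smul_apply, F.unit_X _ (pt_mem y), h1] at hu
  simpa using hu

variable (hC : C.IsLeviFlat)

/-- The equation `π [V, W] = -α(V) π W` that defines the connection form holds for all sections `V`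
of `T¹⁰` and all lifts `W` of normalized real sections. -/
theorem toNormal_bracket {V W : ∀ x : M, CTangent n x} (hV : IsSection C.T10 V U)
    (hW : h.IsUnitRealLift W U) (y : chartOpens n p U) (v : Fin n → ℂ)
    (hv : V (pt y) = ∑ j, v j • F.e j (pt y)) :
    C.toNormal (pt y) (bracket V W (pt y)) =
      -((∑ j, v j * (F.leviFlat p hC).α j y) • C.toNormal (pt y) (W (pt y))) := by
  obtain ⟨f, hf, hVy⟩ := F.exists_T10_coeff p hV
  obtain ⟨g, k, t, hg, ht, hn⟩ := F.exists_lift_coeff p hW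
  obtain ⟨c, hc, hB⟩ := F.exists_bracket_coeff p hV.1 hW.1
  obtain rfl : (fun j => f j y) = v := F.coeff_unique (pt_mem y) ((hVy y).symm.trans hv)
  rw [hf, hg, sum_der] at hc
  have h1 := (F.leviFlat p hC).lie_section_lift f g k ht (fun l => c (.inl (.inl l)))
    (fun l => c (.inl (.inr l))) (c (.inr ())) (by
      simp only [leviFlat_e, leviFlat_eb, leviFlat_X]; exact hc)
  rw [hB, sum_b, F.toNormal_eq (pt_mem y), hn, F.toNormal_eq (pt_mem y), h1, smul_smul, ← neg_smul]
  congr 1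
  simp only [SmoothFun.neg_apply, SmoothFun.mul_apply, SmoothFun.sum_apply]
  ring

theorem isUnitRealLift_X : h.IsUnitRealLift F.X U :=
  ⟨F.smooth_X, fun x hx => ⟨congrArg (C.toNormal x) (F.conj_X x hx), F.unit_X x hx⟩⟩

theorem isSection_e (j : Fin n) : IsSection C.T10 (F.e j) U :=
  ⟨F.smooth_e j, fun _ hx => F.e_mem hx j⟩

theorem isSection_sum_e (v : Fin n → ℂ) : IsSection C.T10 (fun x => ∑ j, v j • F.e j x) U :=
  ⟨SmoothOn.sum_const_smul F.smooth_e v, fun _ hx => F.sum_e_mem hx v⟩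

theorem toNormal_bracket_e_X (j : Fin n) (y : chartOpens n p U) :
    C.toNormal (pt y) (bracket (F.e j) F.X (pt y)) =
      -((F.leviFlat p hC).α j y • C.toNormal (pt y) (F.X (pt y))) := by
  rw [F.toNormal_bracket p hC (F.isSection_e j) F.isUnitRealLift_X y (Pi.single j 1)
    (by simp [Pi.single_apply])]
  simp [Pi.single_apply]

/-- The same point as a point of a smaller coordinate domain. -/
def shrink {U' : Opens M} (y : chartOpens n p U) (hy : pt y ∈ U') : chartOpens n p U' :=
  ⟨y, y.2.1, hy⟩

/-- The structure functions `α` are values at a point of a form that does not involve `U`. -/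
theorem restrict_α {U' : Opens M} (hU : U' ≤ U) (y : chartOpens n p U) (hy : pt y ∈ U')
    (j : Fin n) : ((F.restrict hU).leviFlat p hC).α j (shrink p y hy) =
      (F.leviFlat p hC).α j y := by
  have h1 := (F.restrict hU).toNormal_bracket_e_X p hC j (shrink p y hy)
  have h2 := F.toNormal_bracket_e_X p hC j y
  exact smul_left_injective ℂ (F.toNormal_X_ne_zero (pt_mem y))
    (neg_injective (h1.symm.trans h2))

theorem isAlphaValue (y : chartOpens n p U) (v : Fin n → ℂ) :
    h.IsAlphaValue (pt y) (∑ j, v j • F.e j (pt y)) (∑ j, v j * (F.leviFlat p hC).α j y) := by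
  intro U' V W hU' hy hV hVv hW
  -- the test sections live on another open set, so the frame is restricted to the intersection
  set U'' : Opens M := U ⊓ ⟨U', hU'⟩ with hU''
  have hle : U'' ≤ U := inf_le_left
  have hle' : (U'' : Set M) ⊆ U' := fun x hx => hx.2
  have hy' : pt y ∈ U'' := ⟨pt_mem y, hy⟩
  have h1 := (F.restrict hle).toNormal_bracket p hC (V := V) (W := W)
    ⟨hV.1.mono hle', fun x hx => hV.2 x (hle' hx)⟩
    ⟨hW.1.mono hle', fun x hx => hW.2 x (hle' hx)⟩ (shrink p y hy') v hVv
  simp only [F.restrict_α p hC hle y hy'] at h1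
  exact h1

/-- The connection form in an adapted frame. -/
theorem alpha_eq (y : chartOpens n p U) (v : Fin n → ℂ) :
    h.alpha (pt y) (∑ j, v j • F.e j (pt y)) = ∑ j, v j * (F.leviFlat p hC).α j y := by
  have h1 := F.isAlphaValue p hC y v
  have h2 : h.IsAlphaValue (pt y) _ (h.alpha (pt y) _) := Classical.epsilon_spec ⟨_, h1⟩
  have e1 := h1 U _ _ U.isOpen (pt_mem y) (F.isSection_sum_e v) rfl F.isUnitRealLift_X
  have e2 := h2 U _ _ U.isOpen (pt_mem y) (F.isSection_sum_e v) rfl F.isUnitRealLift_X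
  exact smul_left_injective ℂ (F.toNormal_X_ne_zero (pt_mem y))
    (neg_injective (e2.symm.trans e1))

theorem alpha_e (y : chartOpens n p U) (j : Fin n) :
    h.alpha (pt y) (F.e j (pt y)) = (F.leviFlat p hC).α j y := by
  have h1 := F.alpha_eq p hC y (Pi.single j 1)
  simpa [Pi.single_apply] using h1

end AdaptedFrame

end CRStructure

/-! ### The curvature form in an adapted frame -/

namespace CRStructure

variable {C : CRStructure n M}

namespace AdaptedFrame

variable {h : C.HermitianMetric} {U : Opens M} (F : AdaptedFrame h U) (p : M)

variable (hC : C.IsLeviFlat)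

theorem eq_of_add_eq_add_of_mem {x : M} {a b a' b' : CTangent n x} (ha : a ∈ C.T10 x)
    (hb : b ∈ C.T01 x) (ha' : a' ∈ C.T10 x) (hb' : b' ∈ C.T01 x) (hab : a + b = a' + b') :
    a = a' := by
  rw [← sub_eq_zero]
  refine Submodule.disjoint_def.1 (C.disjoint_conj x) _ (sub_mem ha ha') ?_
  rw [sub_eq_sub_iff_add_eq_add.2 (hab.trans (add_comm a' b'))]
  exact sub_mem hb' hb

theorem bracket_e_eb_unique (j k : Fin n) (y : chartOpens n p U) {a b : CTangent n (pt y)}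
    (ha : a ∈ C.T10 (pt y)) (hb : b ∈ C.T01 (pt y))
    (hab : bracket (F.e j) (fun x => conjC (F.e k x)) (pt y) = a + b) :
    a = ∑ l, (F.leviFlat p hC).p j k l y • F.e l (pt y) := by
  obtain ⟨g, hg⟩ := F.bracket_e_eb p hC j k y
  exact eq_of_add_eq_add_of_mem ha hb (F.sum_e_mem (pt_mem y) _)
    (F.sum_conj_e_mem (pt_mem y) _) (hab.symm.trans hg)

theorem restrict_p {U' : Opens M} (hU : U' ≤ U) (y : chartOpens n p U) (hy : pt y ∈ U')
    (j k l : Fin n) : ((F.restrict hU).leviFlat p hC).p j k l (shrink p y hy) =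
      (F.leviFlat p hC).p j k l y := by
  obtain ⟨g, hg⟩ := (F.restrict hU).bracket_e_eb p hC j k (shrink p y hy)
  have h1 := F.bracket_e_eb_unique p hC j k y ((F.restrict hU).sum_e_mem hy _)
    ((F.restrict hU).sum_conj_e_mem hy _) hg
  exact congrFun (F.coeff_unique (pt_mem y) h1) l

/-- The curvature matrix in terms of the connection form, which does not depend on the frame. -/
theorem Θ_eq (j k : Fin n) (y : chartOpens n p U) : (F.leviFlat p hC).Θ j k y =
    -cderiv (fun x => h.alpha x (F.e j x)) (pt y) (conjC (F.e k (pt y))) -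
      ∑ l, (F.leviFlat p hC).p j k l y * (F.leviFlat p hC).α l y := by
  rw [LeviFlatFrame.Θ_apply, leviFlat_eb, der_eb, cderiv_eq_vf p (F.smooth_e k).conjC
    (g := (F.leviFlat p hC).α j) (fun y => F.alpha_e p hC y j) y]
  simp only [SmoothFun.sub_apply, SmoothFun.neg_apply, SmoothFun.sum_apply, SmoothFun.mul_apply]

theorem restrict_Θ {U' : Opens M} (hU : U' ≤ U) (y : chartOpens n p U) (hy : pt y ∈ U')
    (j k : Fin n) : ((F.restrict hU).leviFlat p hC).Θ j k (shrink p y hy) =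
      (F.leviFlat p hC).Θ j k y := by
  rw [Θ_eq, Θ_eq]
  simp only [restrict_p, restrict_α]
  rfl

/-- The equation that defines the curvature form holds for all sections `V` and `W` of `T¹⁰` over
`U`, with the sesquilinear form of the matrix `Θ`. -/
theorem isThetaValue_aux {V W : ∀ x : M, CTangent n x} (hV : IsSection C.T10 V U)
    (hW : IsSection C.T10 W U) (y : chartOpens n p U) (v w : Fin n → ℂ)
    (hv : V (pt y) = ∑ j, v j • F.e j (pt y)) (hw : W (pt y) = ∑ j, w j • F.e j (pt y))
    {a b : CTangent n (pt y)} (ha : a ∈ C.T10 (pt y)) (hb : b ∈ C.T01 (pt y))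
    (hab : bracket V (fun x => conjC (W x)) (pt y) = a + b) :
    ∑ j, ∑ k, v j * starRingEnd ℂ (w k) * (F.leviFlat p hC).Θ j k y =
      -cderiv (fun x => h.alpha x (V x)) (pt y) (conjC (W (pt y))) - h.alpha (pt y) a := by
  set L := F.leviFlat p hC with hL
  obtain ⟨f, hf, hVy⟩ := F.exists_T10_coeff p hV
  obtain ⟨g, hg, hWy⟩ := F.exists_T10_coeff p hW
  obtain ⟨c, hc, hB⟩ := F.exists_bracket_coeff p hV.1 hW.1.conjC
  obtain rfl : (fun j => f j y) = v := F.coeff_unique (pt_mem y) ((hVy y).symm.trans hv)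
  obtain rfl : (fun j => g j y) = w := F.coeff_unique (pt_mem y) ((hWy y).symm.trans hw)
  have hWc : SmoothFun.vf (comp p hW.1.conjC) =
      ∑ k, SmoothFun.conj (g k) • F.der p (.inl (.inr k)) := by
    have h1 : SmoothFun.vf (comp p hW.1.conjC) =
        (SmoothFun.vf (comp p hW.1)).conj SmoothFun.conj SmoothFun.conj_conj := by
      rw [SmoothFun.conj_vf]
      exact congrArg SmoothFun.vf (funext fun k => comp_conjC p hW.1 k)
    rw [h1, hg, Derivation.conj_sum]
    simp only [Derivation.conj_smul, conj_der_e]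
  have hX : c (.inr ()) = 0 := SmoothFun.ext fun y => by
    have h1 := hC U _ _ U.isOpen ⟨hV.1, fun x hx => T10_le_HC x (hV.2 x hx)⟩
      ⟨hW.1.conjC, fun x hx => T01_le_HC x (hW.2 x hx)⟩ _ (pt_mem y)
    rw [hB, sum_b] at h1
    exact F.coeff_X_eq_zero (pt_mem y) h1
  rw [hf, hWc, sum_der, hX, zero_smul, add_zero] at hc
  have hcl := L.lie_section_conj f (fun k => SmoothFun.conj (g k)) (fun l => c (.inl (.inl l)))
    (fun l => c (.inl (.inr l))) (by simp only [hL, leviFlat_e, leviFlat_eb]; exact hc)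
  have hay : a = ∑ l, c (.inl (.inl l)) y • F.e l (pt y) := by
    rw [hB, sum_b, hX, SmoothFun.zero_apply, zero_smul, add_zero] at hab
    exact eq_of_add_eq_add_of_mem ha hb (F.sum_e_mem (pt_mem y) _)
      (F.sum_conj_e_mem (pt_mem y) _) hab.symm
  have hα : ∀ y : chartOpens n p U, h.alpha (pt y) (V (pt y)) = (∑ j, f j * L.α j) y := fun y => by
    rw [hVy, F.alpha_eq p hC]
    simp only [SmoothFun.sum_apply, SmoothFun.mul_apply, hL]
  have hd := cderiv_eq_vf (f := fun x => h.alpha x (V x)) p hW.1.conjC hα y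
  rw [hd, hay, F.alpha_eq p hC, hWc]
  -- the derivatives of the coefficients `f` cancel between the two terms
  have key : ∑ j, ∑ k, f j * SmoothFun.conj (g k) * L.Θ j k =
      -(∑ k, SmoothFun.conj (g k) • F.der p (.inl (.inr k))) (∑ j, f j * L.α j) -
        ∑ l, c (.inl (.inl l)) * L.α l := by
    rw [Derivation.sum_smul_apply]
    simp only [hcl, LeviFlatFrame.Θ_apply, ← hL, ← F.leviFlat_eb p hC, map_sum,
      Derivation.leibniz, smul_eq_mul]
    simp only [sub_mul, mul_sub, mul_add, Finset.sum_sub_distrib, Finset.sum_add_distrib,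
      Finset.mul_sum, Finset.sum_mul]
    rw [Finset.sum_comm_cycle (f := fun x x_1 i => f x_1 * SmoothFun.conj (g i) * L.p x_1 i x *
        L.α x), Finset.sum_comm_cycle (f := fun i x x_1 => f x_1 * SmoothFun.conj (g i) *
        L.p x_1 i x * L.α x), Finset.sum_comm (f := fun x i => SmoothFun.conj (g x) *
        (f i * L.eb x (L.α i))), Finset.sum_comm (f := fun x i => SmoothFun.conj (g x) *
        (L.α i * L.eb x (f i)))]
    simp only [mul_neg, Finset.sum_neg_distrib, mul_comm, mul_left_comm, mul_assoc]
    ring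
  have := congrArg (fun u : SmoothFun (chartOpens n p U) => u y) key
  simpa only [SmoothFun.sum_apply, SmoothFun.mul_apply, SmoothFun.sub_apply, SmoothFun.neg_apply,
    SmoothFun.conj_apply] using this

theorem isThetaValue (y : chartOpens n p U) (v w : Fin n → ℂ) :
    h.IsThetaValue (pt y) (∑ j, v j • F.e j (pt y)) (∑ j, w j • F.e j (pt y))
      (∑ j, ∑ k, v j * starRingEnd ℂ (w k) * (F.leviFlat p hC).Θ j k y) := by
  intro U' V W hU' hy hV hVv hW hWw a ha b hb hab
  set U'' : Opens M := U ⊓ ⟨U', hU'⟩ with hU''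
  have hle : U'' ≤ U := inf_le_left
  have hle' : (U'' : Set M) ⊆ U' := fun x hx => hx.2
  have hy' : pt y ∈ U'' := ⟨pt_mem y, hy⟩
  have h1 := (F.restrict hle).isThetaValue_aux p hC (V := V) (W := W)
    ⟨hV.1.mono hle', fun x hx => hV.2 x (hle' hx)⟩
    ⟨hW.1.mono hle', fun x hx => hW.2 x (hle' hx)⟩ (shrink p y hy') v w hVv hWw ha hb hab
  simp only [F.restrict_Θ p hC hle y hy'] at h1
  rw [← hWw]
  exact h1

/-- The curvature form in an adapted frame. -/
theorem theta_eq (y : chartOpens n p U) (v w : Fin n → ℂ) :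
    h.theta (pt y) (∑ j, v j • F.e j (pt y)) (∑ j, w j • F.e j (pt y)) =
      ∑ j, ∑ k, v j * starRingEnd ℂ (w k) * (F.leviFlat p hC).Θ j k y := by
  have h1 := F.isThetaValue p hC y v w
  have h2 : h.IsThetaValue (pt y) _ _ (h.theta (pt y) _ _) := Classical.epsilon_spec ⟨_, h1⟩
  have hmem := hC U _ _ U.isOpen
    ⟨(F.isSection_sum_e v).1, fun x hx => T10_le_HC x (F.sum_e_mem hx v)⟩
    ⟨(F.isSection_sum_e w).1.conjC, fun x hx => T01_le_HC x (F.sum_e_mem hx w)⟩ _ (pt_mem y)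
  obtain ⟨a, ha, b, hb, hab⟩ := Submodule.mem_sup.1 hmem
  have e1 := h1 U _ _ U.isOpen (pt_mem y) (F.isSection_sum_e v) rfl (F.isSection_sum_e w) rfl
    a ha b hb hab.symm
  have e2 := h2 U _ _ U.isOpen (pt_mem y) (F.isSection_sum_e v) rfl (F.isSection_sum_e w) rfl
    a ha b hb hab.symm
  exact e2.trans e1.symm

end AdaptedFrame

end CRStructure

/-! ### The density `det Θ / |det (e, ē, X)|` -/

theorem chartDeriv_eq_mfderiv (p : M) {y : 𝔼} (hy : y ∈ (φ p).target) :
    chartDeriv p y = mfderiv (𝓡 (2 * n + 1)) (𝓡 (2 * n + 1)) (φ p) ((φ p).symm y) := by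
  have : IsManifold (𝓡 (2 * n + 1)) 1 M := .of_le (n := ∞) (by simp)
  have h := mfderiv_extChartAt_comp_mfderivWithin_extChartAt_symm (I := 𝓡 (2 * n + 1)) hy
  rw [(𝓡 (2 * n + 1)).range_eq_univ, mfderivWithin_univ] at h
  obtain ⟨A, hA⟩ := isInvertible_mfderiv_symm p hy
  rw [chartDeriv, ← hA, ContinuousLinearMap.inverse_equiv]
  rw [← hA] at h
  ext1 u
  have h1 := congrArg (fun L : 𝔼 →L[ℝ] 𝔼 => L (A.symm u)) h
  refine Eq.trans ?_ (h1.symm.trans ?_)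
  · rfl
  · exact congrArg _ (A.apply_symm_apply u)

/-- The chain rule for the components of a vector in two charts. -/
theorem fderiv_coordChange_mfderiv (p q : M) {x : M} (hp : x ∈ (φ p).source)
    (hq : x ∈ (φ q).source) (u : TangentSpace (𝓡 (2 * n + 1)) x) :
    fderiv ℝ (φ q ∘ (φ p).symm) (φ p x)
        (mfderiv (𝓡 (2 * n + 1)) (𝓡 (2 * n + 1)) (φ p) x u) =
      mfderiv (𝓡 (2 * n + 1)) (𝓡 (2 * n + 1)) (φ q) x u := by
  have : IsManifold (𝓡 (2 * n + 1)) 1 M := .of_le (n := ∞) (by simp)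
  have hs : (φ p).symm (φ p x) = x := (φ p).left_inv hp
  have h1 : MDifferentiableAt (𝓡 (2 * n + 1)) (𝓡 (2 * n + 1)) (φ q ∘ (φ p).symm) (φ p x) :=
    ((contDiffAt_coordChange p q ((φ p).map_source hp) (by rwa [hs])).differentiableAt
      (by simp)).mdifferentiableAt
  have h2 : MDifferentiableAt (𝓡 (2 * n + 1)) (𝓡 (2 * n + 1)) (φ p) x :=
    mdifferentiableAt_extChartAt (by rwa [← extChartAt_source (𝓡 (2 * n + 1))])
  have h3 : φ q =ᶠ[nhds x] (φ q ∘ (φ p).symm) ∘ φ p := by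
    filter_upwards [(isOpen_extChartAt_source p).mem_nhds hp] with z hz
    rw [Function.comp_apply, Function.comp_apply, (φ p).left_inv hz]
  have h4 := mfderiv_comp x h1 h2
  rw [mfderiv_eq_fderiv] at h4
  rw [h3.mfderiv_eq, h4]
  rfl

/-- The matrix of the components `L (b i)_k`. -/
def componentMatrix {F : Type*} [AddCommGroup F] [Module ℝ F] (L : F →ₗ[ℝ] 𝔼)
    (b : ι → ℂ ⊗[ℝ] F) : Matrix ι ι ℂ :=
  Matrix.of fun i k => complexify L (b i) (coordEquiv n k)

theorem componentMatrix_sum {F : Type*} [AddCommGroup F] [Module ℝ F] (L : F →ₗ[ℝ] 𝔼)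
    (b b' : ι → ℂ ⊗[ℝ] F) (G : Matrix ι ι ℂ) (h : ∀ i, b' i = ∑ l, G i l • b l) :
    componentMatrix L b' = G * componentMatrix L b := by
  ext i k
  simp [componentMatrix, h, Matrix.mul_apply]

theorem norm_det_componentMatrix_comp {F : Type*} [AddCommGroup F] [Module ℝ F] (L : F →ₗ[ℝ] 𝔼)
    (b : ι → ℂ ⊗[ℝ] F) (T : 𝔼 →L[ℝ] 𝔼) :
    ‖(componentMatrix (T.toLinearMap ∘ₗ L) b).det‖ = |T.det| * ‖(componentMatrix L b).det‖ := by
  set N := LinearMap.toMatrix (EuclideanSpace.basisFun (Fin (2 * n + 1)) ℝ).toBasis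
    (EuclideanSpace.basisFun (Fin (2 * n + 1)) ℝ).toBasis T.toLinearMap with hN
  have hT : T.det = N.det := by
    rw [hN, LinearMap.det_toMatrix]
  have hTu : ∀ u k, T u k = ∑ l, N k l * u l := fun u k => by
    have h1 := congrFun (LinearMap.toMatrix_mulVec_repr
      (EuclideanSpace.basisFun (Fin (2 * n + 1)) ℝ).toBasis
      (EuclideanSpace.basisFun (Fin (2 * n + 1)) ℝ).toBasis T.toLinearMap u) k
    rw [← hN] at h1
    simp [Matrix.mulVec, dotProduct] at h1
    exact h1.symm
  have hmat : componentMatrix (T.toLinearMap ∘ₗ L) b = componentMatrix L b *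
      ((N.map Complex.ofRealHom).submatrix (coordEquiv n) (coordEquiv n)).transpose := by
    ext i k
    rw [Matrix.mul_apply]
    simp only [componentMatrix, Matrix.of_apply, complexify_apply, LinearMap.comp_apply,
      ContinuousLinearMap.coe_coe, hTu, Matrix.transpose_apply, Matrix.submatrix_apply,
      Matrix.map_apply, Complex.ofRealHom_eq_coe, Complex.ofReal_sum, Complex.ofReal_mul]
    rw [(coordEquiv n).sum_comp fun l => ((L (rePart (b i)) l : ℂ) +
      Complex.I * (L (imPart (b i)) l : ℂ)) * (N (coordEquiv n k) l : ℂ), Finset.mul_sum,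
      ← Finset.sum_add_distrib]
    exact Finset.sum_congr rfl fun l _ => by ring
  rw [hmat, Matrix.det_mul, Matrix.det_transpose, Matrix.det_submatrix_equiv_self, norm_mul,
    mul_comm, hT]
  congr 1
  have := (RingHom.map_det Complex.ofRealHom N).symm
  rw [RingHom.mapMatrix_apply] at this
  rw [this]
  simp

namespace CRStructure

variable {C : CRStructure n M}

namespace AdaptedFrame

variable {h : C.HermitianMetric} {U : Opens M} (F : AdaptedFrame h U)

/-- The matrix of the curvature form. -/
def thetaMatrix (x : M) : Matrix (Fin n) (Fin n) ℂ :=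
  Matrix.of fun j k => h.theta x (F.e j x) (F.e k x)

/-- The value at `x` of the density `det Θ / |det (e, ē, X)|` in the chart around `p`. -/
def density (p x : M) : ℝ :=
  (F.thetaMatrix x).det.re / ‖(componentMatrix
    (mfderiv (𝓡 (2 * n + 1)) (𝓡 (2 * n + 1)) (φ p) x).toLinearMap fun i => F.b i x).det‖

variable (hC : C.IsLeviFlat)

theorem thetaMatrix_pt (p : M) (y : chartOpens n p U) :
    F.thetaMatrix (pt y) = Matrix.of fun j k => (F.leviFlat p hC).Θ j k y := by
  ext j k
  have h1 := F.theta_eq p hC y (Pi.single j 1) (Pi.single k 1)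
  simp only [Pi.single_apply, ite_smul, one_smul, zero_smul, Finset.sum_ite_eq',
    Finset.mem_univ, if_true] at h1
  rw [thetaMatrix, Matrix.of_apply, h1, Matrix.of_apply]
  simp

theorem componentMatrix_pt (p : M) (y : chartOpens n p U) :
    componentMatrix (mfderiv (𝓡 (2 * n + 1)) (𝓡 (2 * n + 1)) (φ p) (pt y)).toLinearMap
      (fun i => F.b i (pt y)) = Matrix.of fun i k => F.mat p i k y := by
  rw [← chartDeriv_eq_mfderiv p y.2.1]
  rfl

theorem exists_pt (p : M) {x : M} (hx : x ∈ U) (hp : x ∈ (φ p).source) :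
    ∃ y : chartOpens n p U, pt y = x :=
  ⟨⟨φ p x, (φ p).map_source hp, by rw [Set.mem_preimage, (φ p).left_inv hp]; exact hx⟩,
    (φ p).left_inv hp⟩

theorem det_componentMatrix_ne_zero (p : M) {x : M} (hx : x ∈ U) (hp : x ∈ (φ p).source) :
    (componentMatrix (mfderiv (𝓡 (2 * n + 1)) (𝓡 (2 * n + 1)) (φ p) x).toLinearMap
      fun i => F.b i x).det ≠ 0 := by
  obtain ⟨y, rfl⟩ := exists_pt p hx hp
  rw [componentMatrix_pt, ← det_apply]
  exact F.det_mat_ne_zero p y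

/-- The density does not depend on the frame: a change of frame is block triangular with diagonal
blocks `A`, `Ā` and `±1`, and multiplies both `det Θ` and `|det (e, ē, X)|` by `|det A|²`. -/
theorem density_eq (hC : C.IsLeviFlat) {U' : Opens M} (F' : AdaptedFrame h U') (p : M) {x : M} (hx : x ∈ U)
    (hx' : x ∈ U') (hp : x ∈ (φ p).source) : F'.density p x = F.density p x := by
  have hdet := F'.det_componentMatrix_ne_zero p hx' hp
  obtain ⟨y, rfl⟩ := exists_pt p (U := U ⊓ U') ⟨hx, hx'⟩ hp
  set F₀ := F.restrict (inf_le_left : U ⊓ U' ≤ U) with hF₀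
  set F₁ := F'.restrict (inf_le_right : U ⊓ U' ≤ U') with hF₁
  have ha : ∀ j, ∃ a : Fin n → ℂ, F'.e j (pt y) = ∑ l, a l • F.e l (pt y) := fun j => by
    obtain ⟨f, -, hf⟩ := F₀.exists_T10_coeff p (F₁.isSection_e j)
    exact ⟨_, hf y⟩
  choose a ha using ha
  obtain ⟨g, k, t, -, ht, hX⟩ := F₀.exists_lift_coeff p F₁.isUnitRealLift_X
  have hX := hX y
  have ht : ‖t y‖ = 1 := by
    have h1 := congrArg (fun u : SmoothFun _ => ‖u y‖) ht
    simp only [SmoothFun.mul_apply, SmoothFun.one_apply, norm_mul, norm_one] at h1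
    exact (mul_self_eq_one_iff.1 h1).resolve_right
      fun h2 => absurd (norm_nonneg (t y)) (by rw [h2]; norm_num)
  set A : Matrix (Fin n) (Fin n) ℂ := Matrix.of a with hA
  set G : Matrix ι ι ℂ := Matrix.fromBlocks
    (Matrix.fromBlocks A 0 0 (A.map (starRingEnd ℂ))) 0
    (Matrix.of fun _ => Sum.elim (fun l => g l y) fun l => k l y)
    (Matrix.of fun _ _ => t y) with hG
  have hGb : ∀ i, F'.b i (pt y) = ∑ l, G i l • F.b l (pt y) := by
    rintro ((j | j) | ⟨⟩)
    · rw [F.sum_b]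
      simp only [hG, Matrix.fromBlocks_apply₁₁, Matrix.fromBlocks_apply₁₂, Matrix.zero_apply,
        zero_smul, Finset.sum_const_zero, add_zero]
      exact ha j
    · rw [F.sum_b]
      simp only [hG, Matrix.fromBlocks_apply₁₁, Matrix.fromBlocks_apply₁₂,
        Matrix.fromBlocks_apply₂₁, Matrix.fromBlocks_apply₂₂, Matrix.zero_apply,
        zero_smul, Finset.sum_const_zero, add_zero, zero_add, Matrix.map_apply]
      have h1 := congrArg conjC (ha j)
      rw [map_sum] at h1
      simp only [map_smulₛₗ] at h1
      exact h1
    · rw [F.sum_b]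
      simp only [hG, Matrix.fromBlocks_apply₂₁, Matrix.fromBlocks_apply₂₂, Matrix.of_apply,
        Sum.elim_inl, Sum.elim_inr]
      exact hX
  have hmat := componentMatrix_sum (mfderiv (𝓡 (2 * n + 1)) (𝓡 (2 * n + 1)) (φ p)
    (pt y)).toLinearMap (fun i => F.b i (pt y)) (fun i => F'.b i (pt y)) G hGb
  have hGdet : G.det = A.det * starRingEnd ℂ A.det * t y := by
    rw [hG, Matrix.det_fromBlocks_zero₁₂, Matrix.det_fromBlocks_zero₁₂, RingHom.map_det]
    congr 1
    simp
  have hGn : ‖G.det‖ = ‖A.det‖ ^ 2 := by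
    rw [hGdet, norm_mul, norm_mul, ht, RCLike.norm_conj]; ring
  have hθ : F'.thetaMatrix (pt y) = A * F.thetaMatrix (pt y) * A.conjTranspose := by
    have h0 := F₀.thetaMatrix_pt hC p y
    change F.thetaMatrix (pt y) = _ at h0
    rw [h0]
    ext j k
    rw [thetaMatrix, Matrix.of_apply, ha j, ha k]
    refine (F₀.theta_eq p hC y (a j) (a k)).trans ?_
    simp only [Matrix.mul_apply, Finset.sum_mul, Matrix.of_apply, Matrix.conjTranspose_apply, hA]
    rw [Finset.sum_comm]
    exact Finset.sum_congr rfl fun l _ => Finset.sum_congr rfl fun m _ => by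
      simp only [RCLike.star_def]; ring
  have hθd : (F'.thetaMatrix (pt y)).det.re = ‖A.det‖ ^ 2 * (F.thetaMatrix (pt y)).det.re := by
    rw [hθ, Matrix.det_mul, Matrix.det_mul, Matrix.det_conjTranspose]
    have h1 : A.det * (F.thetaMatrix (pt y)).det * star A.det =
        ((‖A.det‖ ^ 2 : ℝ) : ℂ) * (F.thetaMatrix (pt y)).det := by
      rw [Complex.ofReal_pow, ← Complex.mul_conj']
      simp only [RCLike.star_def]; ring
    rw [h1, Complex.re_ofReal_mul]
  rw [hmat, Matrix.det_mul] at hdet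
  have hA0 : ‖A.det‖ ^ 2 ≠ 0 := by
    rw [← hGn]
    exact norm_ne_zero_iff.2 (left_ne_zero_of_mul hdet)
  rw [density, density, hmat, Matrix.det_mul, norm_mul, hGn, hθd]
  exact mul_div_mul_left _ _ hA0

end AdaptedFrame

end CRStructure

/-! ### The gradient of the connection form -/

namespace CRStructure

variable {C : CRStructure n M}

namespace HermitianMetric

variable (h : C.HermitianMetric)

/-- `ζ` is the vector of type `(0,1)` at `x` with `Θ_h(· ⊗ ζ) = α_h`. -/
def IsGradient (x : M) (ζ : CTangent n x) : Prop :=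
  ζ ∈ C.T01 x ∧ ∀ v ∈ C.T10 x, h.theta x v (conjC ζ) = h.alpha x v

/-- The vector of type `(0,1)` that represents `α_h` with respect to `Θ_h`. -/
def gradient (x : M) : CTangent n x := Classical.epsilon (h.IsGradient x)

/-- An adapted frame around `x`. -/
def frameAt (x : M) : AdaptedFrame h (exists_adaptedFrame h x).choose :=
  (exists_adaptedFrame h x).choose_spec.2.some

theorem mem_frameAt (x : M) : x ∈ (exists_adaptedFrame h x).choose :=
  (exists_adaptedFrame h x).choose_spec.1

/-- The vector density `det Θ / |det (e, ē, X)| · 2 Re ζ`, where `ζ` is the gradient, in the chart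
around `p`. -/
def flux (p x : M) : 𝔼 :=
  (h.frameAt x).density p x •
    mfderiv (𝓡 (2 * n + 1)) (𝓡 (2 * n + 1)) (φ p) x ((2 : ℝ) • rePart (h.gradient x))

/-- The transformation rule of a density. -/
theorem density_coordChange {U : Opens M} (F : AdaptedFrame h U) (p q : M) {x : M} (hx : x ∈ U)
    (hp : x ∈ (φ p).source) (hq : x ∈ (φ q).source) :
    |(fderiv ℝ (φ q ∘ (φ p).symm) (φ p x)).det| * F.density q x = F.density p x := by
  set T := fderiv ℝ (φ q ∘ (φ p).symm) (φ p x) with hT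
  have h1 : (mfderiv (𝓡 (2 * n + 1)) (𝓡 (2 * n + 1)) (φ q) x).toLinearMap =
      T.toLinearMap ∘ₗ (mfderiv (𝓡 (2 * n + 1)) (𝓡 (2 * n + 1)) (φ p) x).toLinearMap :=
    LinearMap.ext fun u => (fderiv_coordChange_mfderiv p q hp hq u).symm
  have h2 := F.det_componentMatrix_ne_zero q hx hq
  have h3 := norm_det_componentMatrix_comp
    (mfderiv (𝓡 (2 * n + 1)) (𝓡 (2 * n + 1)) (φ p) x).toLinearMap (fun i => F.b i x) T
  have h4 := congrArg (fun L : TangentSpace (𝓡 (2 * n + 1)) x →ₗ[ℝ] 𝔼 =>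
    ‖(componentMatrix L fun i => F.b i x).det‖) h1
  have h5 := h4.trans h3
  have h6 := norm_ne_zero_iff.2 h2
  have h7 := h6
  erw [h5] at h7
  rw [AdaptedFrame.density, AdaptedFrame.density]
  rw [← mul_div_assoc, div_eq_div_iff h6 (right_ne_zero_of_mul h7)]
  refine Eq.trans ?_ (congrArg (_ * ·) h5.symm)
  ring

theorem isVectorDensity_flux : IsVectorDensity fun p y => h.flux p ((φ p).symm y) := by
  intro p q y hy hyq
  set x := (φ p).symm y with hx
  have hp : x ∈ (φ p).source := (φ p).map_target hy
  have hxy : φ p x = y := (φ p).right_inv hy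
  change fderiv ℝ (φ q ∘ (φ p).symm) y (h.flux p x) =
    |(fderiv ℝ (φ q ∘ (φ p).symm) y).det| • h.flux q ((φ q).symm (φ q x))
  rw [(φ q).left_inv hyq, ← hxy]
  set T := fderiv ℝ (φ q ∘ (φ p).symm) (φ p x) with hT
  set u : TangentSpace (𝓡 (2 * n + 1)) x := (2 : ℝ) • rePart (h.gradient x)
  let a : 𝔼 := mfderiv (𝓡 (2 * n + 1)) (𝓡 (2 * n + 1)) (φ p) x u
  let b : 𝔼 := mfderiv (𝓡 (2 * n + 1)) (𝓡 (2 * n + 1)) (φ q) x u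
  have hab : T a = b := fderiv_coordChange_mfderiv p q hp hyq u
  have hd := h.density_coordChange (h.frameAt x) p q (h.mem_frameAt x) hp hyq
  change T ((h.frameAt x).density p x • a) = |T.det| • (h.frameAt x).density q x • b
  rw [map_smul, hab, smul_smul, hd]

end HermitianMetric

namespace AdaptedFrame

variable {h : C.HermitianMetric} {U : Opens M} (F : AdaptedFrame h U)

theorem isHermitian_thetaMatrix (hC : C.IsLeviFlat) (p : M) (y : chartOpens n p U) : (F.thetaMatrix (pt y)).IsHermitian := by
  rw [F.thetaMatrix_pt hC]
  ext j k
  have h1 := congrArg (fun u : SmoothFun _ => u y) ((F.leviFlat p hC).c_Θ j k)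
  rw [leviFlat_c] at h1
  exact h1

theorem posDef_thetaMatrix (hC : C.IsLeviFlat) (p : M) {c : ℝ} (hc : 0 ≤ c) (hpos : h.CurvaturePos c)
    (y : chartOpens n p U) : (F.thetaMatrix (pt y)).PosDef := by
  have hH := F.isHermitian_thetaMatrix hC p y
  refine Matrix.PosDef.of_dotProduct_mulVec_pos hH fun v hv => ?_
  have him := hH.im_star_dotProduct_mulVec_self v
  have hval : star v ⬝ᵥ (F.thetaMatrix (pt y) *ᵥ v) = h.theta (pt y)
      (∑ j, starRingEnd ℂ (v j) • F.e j (pt y)) (∑ j, starRingEnd ℂ (v j) • F.e j (pt y)) := by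
    rw [F.theta_eq p hC, F.thetaMatrix_pt hC]
    simp only [dotProduct, Matrix.mulVec, Finset.mul_sum, Matrix.of_apply, Pi.star_apply,
      Complex.conj_conj]
    exact Finset.sum_congr rfl fun j _ => Finset.sum_congr rfl fun k _ => by
      simp only [RCLike.star_def]; ring
  have hne : ∑ j, starRingEnd ℂ (v j) • F.e j (pt y) ≠ 0 := fun h0 => hv (funext fun j => by
    simpa using Fintype.linearIndependent_iff.1 (F.indep_e _ (pt_mem y)) _ h0 j)
  have h1 := hpos (pt y) _ (F.sum_e_mem (pt_mem y) _) hne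
  rw [← hval] at h1
  refine Complex.pos_iff.2 ⟨?_, him.symm⟩
  have := mul_nonneg hc (sq_nonneg ‖h.alpha (pt y) (∑ j, starRingEnd ℂ (v j) • F.e j (pt y))‖)
  linarith

theorem gradient_eq (hC : C.IsLeviFlat) (p : M) (y : chartOpens n p U) (hdet : (F.leviFlat p hC).Θ.det y ≠ 0)
    {z : Fin n → SmoothFun (chartOpens n p U)}
    (hz : ∀ j, ∑ k, (F.leviFlat p hC).Θ j k * z k = (F.leviFlat p hC).α j) :
    h.IsGradient (pt y) (h.gradient (pt y)) ∧
      h.gradient (pt y) = ∑ k, z k y • conjC (F.e k (pt y)) := by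
  have hzy : ∀ j, ∑ k, (F.leviFlat p hC).Θ j k y * z k y = (F.leviFlat p hC).α j y := fun j => by
    rw [← hz j]
    simp only [SmoothFun.sum_apply, SmoothFun.mul_apply]
  have hconj : ∀ w : Fin n → ℂ, conjC (∑ k, w k • conjC (F.e k (pt y))) =
      ∑ k, starRingEnd ℂ (w k) • F.e k (pt y) := fun w => by
    rw [map_sum]
    simp only [map_smulₛₗ, conjC_conjC]
  have h1 : h.IsGradient (pt y) (∑ k, z k y • conjC (F.e k (pt y))) := by
    refine ⟨F.sum_conj_e_mem (pt_mem y) _, fun v hv => ?_⟩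
    rw [← F.span_e _ (pt_mem y), Submodule.mem_span_range_iff_exists_fun] at hv
    obtain ⟨v, rfl⟩ := hv
    rw [hconj, F.theta_eq p hC, F.alpha_eq p hC]
    refine Finset.sum_congr rfl fun j _ => ?_
    rw [← hzy, Finset.mul_sum]
    exact Finset.sum_congr rfl fun k _ => by rw [Complex.conj_conj]; ring
  have h2 : h.IsGradient (pt y) (h.gradient (pt y)) := Classical.epsilon_spec ⟨_, h1⟩
  refine ⟨h2, ?_⟩
  obtain ⟨w, hw⟩ : ∃ w : Fin n → ℂ, h.gradient (pt y) = ∑ k, w k • conjC (F.e k (pt y)) := by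
    have h3 := conjC_mem_T10 h2.1
    rw [← F.span_e _ (pt_mem y), Submodule.mem_span_range_iff_exists_fun] at h3
    obtain ⟨v, hv⟩ := h3
    refine ⟨fun k => starRingEnd ℂ (v k), ?_⟩
    rw [← conjC_conjC (h.gradient (pt y)), ← hv, map_sum]
    simp only [map_smulₛₗ]
  set N : Matrix (Fin n) (Fin n) ℂ := Matrix.of fun j k => (F.leviFlat p hC).Θ j k y with hN
  have h4 : N *ᵥ w = N *ᵥ fun k => z k y := by
    funext j
    have h5 := h2.2 _ (F.e_mem (pt_mem y) j)
    rw [hw, hconj, F.alpha_e p hC] at h5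
    have h6 := F.theta_eq p hC y (Pi.single j 1) fun k => starRingEnd ℂ (w k)
    simp only [Pi.single_apply, ite_smul, one_smul, zero_smul, Finset.sum_ite_eq',
      Finset.mem_univ, if_true, ite_mul, one_mul, zero_mul, Complex.conj_conj] at h6
    rw [Finset.sum_comm] at h6
    simp only [Finset.sum_ite_eq', Finset.mem_univ, if_true] at h6
    rw [h6, ← hzy] at h5
    simp only [Matrix.mulVec, dotProduct, hN, Matrix.of_apply, mul_comm (w _)] at h5 ⊢
    simpa only [mul_comm] using h5
  have h7 : IsUnit N := by
    rw [Matrix.isUnit_iff_isUnit_det, isUnit_iff_ne_zero, hN, ← det_apply]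
    exact hdet
  have h8 := Matrix.mulVec_injective_iff_isUnit.2 h7 h4
  rw [hw, h8]

end AdaptedFrame

end CRStructure

/-! ### The divergence of the gradient -/

namespace CRStructure

variable {C : CRStructure n M}

namespace AdaptedFrame

variable {h : C.HermitianMetric} {U : Opens M} (F : AdaptedFrame h U)

/-- A combination of frame fields is determined by its values on the coordinates. -/
theorem eq_sum_pd (p : M) {E : Derivation ℝ (SmoothFun (chartOpens n p U))
    (SmoothFun (chartOpens n p U))}
    (hE : E ∈ Submodule.span (SmoothFun (chartOpens n p U)) (Set.range (F.der p))) :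
    E = ∑ k : ι, E (SmoothFun.coord (coordEquiv n k)) • SmoothFun.pd (coordEquiv n k) := by
  obtain ⟨c, rfl⟩ := (Submodule.mem_span_range_iff_exists_fun _).1 hE
  have h1 : ∑ i, c i • F.der p i = SmoothFun.vf (∑ i, c i • comp p (F.smooth_b i)) := by
    rw [SmoothFun.vf_sum]
    simp only [SmoothFun.vf_smul, der_def]
  rw [h1, (coordEquiv n).sum_comp fun k =>
    SmoothFun.vf (∑ i, c i • comp p (F.smooth_b i)) (SmoothFun.coord k) • SmoothFun.pd k]
  exact SmoothFun.vf_eq_sum _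

/-- Conjugation permutes the rows of the matrix of the frame `(e, ē, X)`. -/
theorem conj_det_mat (p : M) : ∃ s : ℤ, SmoothFun.conj (F.mat p).det = s * (F.mat p).det := by
  set σ : Equiv.Perm ι := Equiv.sumCongr (Equiv.sumComm _ _) (Equiv.refl _) with hσ
  refine ⟨Equiv.Perm.sign σ, ?_⟩
  rw [← Matrix.det_permute, AlgHom.map_det]
  congr 1
  have hj : ∀ j k, comp p (F.smooth_b (.inl (.inr j))) k =
      SmoothFun.conj (comp p (F.smooth_b (.inl (.inl j))) k) := fun j k =>
    comp_conjC p (F.smooth_e j) k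
  ext1 i k
  rw [AlgHom.mapMatrix_apply, Matrix.map_apply, Matrix.submatrix_apply]
  rcases i with ((j | j) | ⟨⟩)
  · exact (hj j _).symm
  · change SmoothFun.conj (comp p (F.smooth_b (.inl (.inr j))) _) = comp p (F.smooth_b _) _
    rw [hj, SmoothFun.conj_conj]
    rfl
  · ext y
    change starRingEnd ℂ (chartC p y (F.X (pt y)) _) = chartC p y (F.X (pt y)) _
    rw [← chartC_conjC, F.conj_X _ (pt_mem y)]
    rfl

theorem B_eq_mat (hC : C.IsLeviFlat) (p : M) :
    (F.leviFlat p hC).B (fun k => SmoothFun.coord (coordEquiv n k)) = F.mat p := by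
  ext1 i k
  rw [LeviFlatFrame.B, Matrix.of_apply, leviFlat_b, der_coord]
  rfl

/-- The vector density `h.flux` in a chart: it is `2 Re (g ζ)`, where `g` is a positive density
and `div (g ζ) = g (ᾱ(ζ) - n)`. -/
theorem exists_flux_eq (hC : C.IsLeviFlat) (p : M) {c : ℝ} (hc : 0 ≤ c)
    (hpos : h.CurvaturePos c) :
    ∃ (g : SmoothFun (chartOpens n p U)) (z : Fin n → SmoothFun (chartOpens n p U))
      (V : Fin (2 * n + 1) → SmoothFun (chartOpens n p U)),
      (∀ y, ∃ r : ℝ, 0 < r ∧ g y = r) ∧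
      (∀ y : chartOpens n p U, h.IsGradient (pt y) (h.gradient (pt y)) ∧
        h.gradient (pt y) = ∑ k, z k y • conjC (F.e k (pt y))) ∧
      (∀ (y : chartOpens n p U) k, (h.flux p (pt y) k : ℂ) = (V k + SmoothFun.conj (V k)) y) ∧
      ∑ k, SmoothFun.pd k (V k) =
        g * (∑ k, z k * SmoothFun.conj ((F.leviFlat p hC).α k) - n) := by
  set L := F.leviFlat p hC with hL
  have hdet : ∀ y : chartOpens n p U, 0 < L.Θ.det y := fun y => by
    rw [det_apply, ← F.thetaMatrix_pt hC p y]
    exact (F.posDef_thetaMatrix hC p hc hpos y).det_pos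
  have hu : IsUnit L.Θ.det := SmoothFun.isUnit_of_ne_zero _ fun y => (hdet y).ne'
  set γ := SmoothFun.abs (F.mat p).det (F.det_mat_ne_zero p) with hγ
  have hγy : ∀ y, γ y = (‖(F.mat p).det y‖ : ℂ) := fun y => SmoothFun.abs_apply _ _ y
  have hγu : IsUnit γ := SmoothFun.isUnit_of_ne_zero _ fun y => by
    rw [hγy]
    exact_mod_cast norm_ne_zero_iff.2 (F.det_mat_ne_zero p y)
  obtain ⟨γ', hγ'⟩ := hγu.exists_left_inv
  set g := L.Θ.det * γ' with hg
  have hgγ : g * γ = L.Θ.det := by rw [hg, mul_assoc, hγ', mul_one]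
  set z := L.Θ⁻¹ *ᵥ L.α with hz'
  have hz : ∀ j, ∑ k, L.Θ j k * z k = L.α j := fun j => by
    have h1 : L.Θ *ᵥ z = L.α := by
      rw [hz', Matrix.mulVec_mulVec, Matrix.mul_nonsing_inv _ hu, Matrix.one_mulVec]
    exact congrFun h1 j
  have hgy : ∀ y : chartOpens n p U, g y = ((L.Θ.det y).re / ‖(F.mat p).det y‖ : ℝ) := fun y => by
    have h1 : g y * γ y = L.Θ.det y := by rw [← SmoothFun.mul_apply, hgγ]
    have h2 : ((L.Θ.det y).re : ℂ) = L.Θ.det y :=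
      Complex.ext rfl (Complex.pos_iff.1 (hdet y)).2
    rw [Complex.ofReal_div, h2, ← h1, hγy, mul_div_cancel_right₀]
    exact_mod_cast norm_ne_zero_iff.2 (F.det_mat_ne_zero p y)
  have hgrad := fun y : chartOpens n p U => F.gradient_eq hC p y (hdet y).ne' hz
  obtain ⟨s, hs⟩ := F.conj_det_mat p
  refine ⟨g, z, fun k => g * L.Z z (SmoothFun.coord k), fun y => ⟨_, ?_, hgy y⟩, hgrad, ?_, ?_⟩
  · exact div_pos (Complex.pos_iff.1 (hdet y)).1 (norm_pos_iff.2 (F.det_mat_ne_zero p y))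
  · intro y k
    have hdens : (h.frameAt (pt y)).density p (pt y) =
        (L.Θ.det y).re / ‖(F.mat p).det y‖ := by
      rw [F.density_eq hC (h.frameAt (pt y)) p (pt_mem y) (h.mem_frameAt _)
        ((φ p).map_target y.2.1), density, F.componentMatrix_pt, F.thetaMatrix_pt hC,
        ← det_apply, ← det_apply]
    have hZ : L.Z z (SmoothFun.coord k) y = chartC p y (h.gradient (pt y)) k := by
      rw [(hgrad y).2, LeviFlatFrame.Z_apply, map_sum, Finset.sum_apply, SmoothFun.sum_apply]
      refine Finset.sum_congr rfl fun j _ => ?_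
      rw [hL, leviFlat_eb, der_coord, map_smul]
      rfl
    have hflux : h.flux p (pt y) k = (h.frameAt (pt y)).density p (pt y) *
        (2 * chartDeriv p y (rePart (h.gradient (pt y))) k) := by
      rw [chartDeriv_eq_mfderiv p y.2.1, HermitianMetric.flux, map_smul]
      rfl
    rw [hflux, hdens]
    simp only [SmoothFun.add_apply, SmoothFun.conj_apply, SmoothFun.mul_apply, hZ, hgy,
      chartC_apply, map_mul, map_add, Complex.conj_ofReal, Complex.conj_I, Complex.ofReal_mul]
    push_cast
    ring
  · have h1 := L.divergence_Z (fun k : ι => SmoothFun.pd (coordEquiv n k))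
      (fun k : ι => SmoothFun.coord (coordEquiv n k)) (fun E hE => by
        rw [hL, F.leviFlat_b] at hE
        exact F.eq_sum_pd p hE) z hz g γ s hgγ (by
        rw [hL, B_eq_mat, mul_left_comm, ← hs]
        ext y
        rw [SmoothFun.mul_apply, SmoothFun.mul_apply, SmoothFun.conj_apply, hγy,
          Complex.mul_conj']
        ring) hγu
    rw [(coordEquiv n).sum_comp fun k => SmoothFun.pd k (g * L.Z z (SmoothFun.coord k))] at h1
    rw [h1, hL, leviFlat_c]

end AdaptedFrame

namespace HermitianMetric

variable {h : C.HermitianMetric}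

theorem contDiffAt_flux (hC : C.IsLeviFlat) {c : ℝ} (hc : 0 ≤ c) (hpos : h.CurvaturePos c)
    (p : M) {y : 𝔼} (hy : y ∈ (φ p).target) :
    ContDiffAt ℝ ∞ (fun y => h.flux p ((φ p).symm y)) y := by
  obtain ⟨g, z, V, -, -, hV, -⟩ := (h.frameAt ((φ p).symm y)).exists_flux_eq hC p hc hpos
  rw [contDiffAt_euclidean]
  intro k
  have hyΩ : y ∈ chartOpens n p (exists_adaptedFrame h ((φ p).symm y)).choose :=
    ⟨hy, h.mem_frameAt _⟩
  have h1 := (Complex.reCLM.contDiff (n := ∞)).contDiffAt.comp y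
    ((SmoothFun.contDiffOn_rep (V k + SmoothFun.conj (V k))).contDiffAt
      ((Opens.isOpen _).mem_nhds hyΩ))
  refine h1.congr_of_eventuallyEq ?_
  filter_upwards [(Opens.isOpen _).mem_nhds hyΩ] with w hw
  rw [Function.comp_apply, SmoothFun.rep_apply _ ⟨w, hw⟩, ← hV ⟨w, hw⟩]
  rfl

/-- If `Θ` dominates `c |α|²` with `c > 1 / n`, then `a = α(ζ̄) = Θ(ζ̄ ⊗ ζ)` satisfies
`Re a > c |a|² ≥ c (Re a)²`, whence `Re a < n`. If `ζ = 0` this holds because `n ≥ 1`. -/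
theorem alpha_conj_gradient_re_lt {c : ℝ} (hn : 1 ≤ n) (hcn : 1 / (n : ℝ) < c)
    (hpos : h.CurvaturePos c) {x : M} {ζ : CTangent n x} (hζ : h.IsGradient x ζ)
    (h0 : h.alpha x 0 = 0) : (h.alpha x (conjC ζ)).re < n := by
  have hn' : (0 : ℝ) < n := by exact_mod_cast hn
  have hc : 0 < c := lt_trans (by positivity) hcn
  have hmem := conjC_mem_T10 hζ.1
  by_cases hz : conjC ζ = 0
  · rw [hz, h0]
    simpa using hn'
  have h1 := hpos x _ hmem hz
  rw [hζ.2 _ hmem] at h1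
  set a := h.alpha x (conjC ζ)
  by_contra! hge
  have h2 : a.re ^ 2 ≤ ‖a‖ ^ 2 := by
    rw [← sq_abs a.re]
    exact pow_le_pow_left₀ (abs_nonneg _) (Complex.abs_re_le_norm a) 2
  have h3 : 1 < c * n := by rwa [div_lt_iff₀ hn'] at hcn
  have h4 : c * a.re ^ 2 ≤ c * ‖a‖ ^ 2 := mul_le_mul_of_nonneg_left h2 hc.le
  nlinarith [mul_le_mul_of_nonneg_left hge hc.le]

theorem euclideanDiv_flux_neg (hC : C.IsLeviFlat) {c : ℝ} (hn : 1 ≤ n) (hcn : 1 / (n : ℝ) < c)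
    (hpos : h.CurvaturePos c) (p : M) {y : 𝔼} (hy : y ∈ (φ p).target) :
    euclideanDiv (fun y => h.flux p ((φ p).symm y)) y < 0 := by
  have hc : 0 ≤ c := (lt_trans (by positivity) hcn).le
  set F := h.frameAt ((φ p).symm y) with hF
  obtain ⟨g, z, V, hg, hgrad, hV, hdiv⟩ := F.exists_flux_eq hC p hc hpos
  set y' : chartOpens n p (exists_adaptedFrame h ((φ p).symm y)).choose :=
    ⟨y, hy, h.mem_frameAt _⟩ with hy'
  have hd := (h.contDiffAt_flux hC hc hpos p hy).differentiableAt (by simp)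
  have hk : ∀ k, ((fderiv ℝ (fun y => h.flux p ((φ p).symm y)) y (EuclideanSpace.single k 1) k
      : ℝ) : ℂ) = SmoothFun.pd k (V k + SmoothFun.conj (V k)) y' := fun k => by
    rw [SmoothFun.pd_apply_of_eq (F := fun y => (h.flux p ((φ p).symm y) k : ℂ))
      (fun y => hV y k)]
    have h1 : HasFDerivAt (fun y => (h.flux p ((φ p).symm y) k : ℂ)) _ y :=
      (Complex.ofRealCLM.comp (EuclideanSpace.proj (𝕜 := ℝ) k : 𝔼 →L[ℝ] ℝ)).hasFDerivAt.comp y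
        hd.hasFDerivAt
    rw [hy', h1.fderiv]
    rfl
  obtain ⟨r, hr, hgr⟩ := hg y'
  set a := ∑ k, z k y' * starRingEnd ℂ ((F.leviFlat p hC).α k y') with ha
  have hdy : (∑ k, SmoothFun.pd k (V k)) y' = r * (a - n) := by
    rw [hdiv, SmoothFun.mul_apply, hgr, SmoothFun.sub_apply, SmoothFun.sum_apply]
    simp only [SmoothFun.mul_apply, SmoothFun.conj_apply]
    congr 2
  have hsum : ((euclideanDiv (fun y => h.flux p ((φ p).symm y)) y : ℝ) : ℂ) =
      ((2 * (r * (a.re - n)) : ℝ) : ℂ) := by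
    rw [euclideanDiv, Complex.ofReal_sum]
    simp only [hk, map_add, SmoothFun.pd_conj, SmoothFun.add_apply, SmoothFun.conj_apply,
      Finset.sum_add_distrib]
    rw [← map_sum, ← SmoothFun.sum_apply, hdy, Complex.add_conj]
    congr 2
    rw [Complex.re_ofReal_mul]
    simp
  rw [Complex.ofReal_inj] at hsum
  have hα : h.alpha (pt y') (conjC (h.gradient (pt y'))) = starRingEnd ℂ a := by
    rw [(hgrad y').2, map_sum]
    simp only [map_smulₛₗ, conjC_conjC]
    rw [F.alpha_eq p hC, ha, map_sum]
    simp only [map_mul, Complex.conj_conj]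
  have h0 : h.alpha (pt y') 0 = 0 := by
    have h1 := F.alpha_eq p hC y' 0
    simpa using h1
  have hlt := h.alpha_conj_gradient_re_lt hn hcn hpos (hgrad y').1 h0
  rw [hα, Complex.conj_re] at hlt
  rw [hsum]
  nlinarith

theorem not_curvaturePos [T2Space M] [CompactSpace M] [Nonempty M] (hC : C.IsLeviFlat) {c : ℝ}
    (hn : 1 ≤ n) (hcn : 1 / (n : ℝ) < c) : ¬h.CurvaturePos c := fun hpos => by
  have hc : 0 ≤ c := (lt_trans (by positivity) hcn).le
  obtain ⟨p, y, hy, hnn⟩ := h.isVectorDensity_flux.exists_euclideanDiv_nonneg fun p y hy =>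
    ((h.contDiffAt_flux hC hc hpos p hy).of_le (by simp)).contDiffWithinAt
  exact (h.euclideanDiv_flux_neg hC hn hcn hpos p hy).not_ge hnn

end HermitianMetric

end CRStructure

end Manifold

end CRGeometry

end

theorem lemma1 (n : ℕ) (hn : 1 ≤ n) (M : Type*) [TopologicalSpace M] [T2Space M]
    [CompactSpace M] [Nonempty M]
    [ChartedSpace (EuclideanSpace ℝ (Fin (2 * n + 1))) M]
    [IsManifold (𝓡 (2 * n + 1)) ∞ M]
    (C : CRGeometry.CRStructure n M) (hC : C.IsLeviFlat) :
    C.dfIndex ≤ 1 / ((n : ℝ) + 1) := by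
  refine Real.sSup_le ?_ (by positivity)
  rintro η ⟨h0, h1, h, hpos⟩
  by_contra! hlt
  refine h.not_curvaturePos hC hn ?_ hpos
  have hn' : (0 : ℝ) < n := by exact_mod_cast hn
  rw [div_lt_iff₀ (by positivity)] at hlt
  rw [div_lt_div_iff₀ hn' (by linarith)]
  linarith
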